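/- **Notation.** For $\xi\in\mathbb R^3$ put $\langle\xi\rangle=\sqrt{2+|\xi|^2}$, $H(\xi)=|\xi|\langle\xi\rangle$, $U(\xi)=|\xi|/\langle\xi\rangle$. Let $\varphi$ be a smooth radial real-valued bump function on $\mathbb R^3$, supported in $\{|\xi|\le \frac{11}{10}\}$ and equal to $1$ on the unit ball, and let $\psi(\xi)=\varphi(\xi)-\varphi(2\xi)$, $\tilde\psi(\xi)=\psi(2\xi)+\psi(\xi)+\psi(\xi/2)$. For $\beta\in\mathbb R$ let $$A_1(\xi_1,\xi_2)=(4+4\beta)+\frac{2\,\xi_1\cdot\xi_2}{2+|\xi_1|^2+|\xi_2|^2},\qquad A_2(\xi_1,\xi_2)=-\frac{2\langle\xi_1\rangle\langle\xi_2\rangle}{2+|\xi_1|^2+|\xi_2|^2}\,\frac{\xi_1}{|\xi_1|}\cdot\frac{\xi_2}{|\xi_2|}.$$ Always $\xi=\xi_1+\xi_2$; $\nabla_\xi$ is the gradient in $\xi$ with $\xi_2$ fixed and $\xi_1=\xi-\xi_2$; $\nabla_{\xi_2}$ is the gradient in $\xi_2$ with $\xi$ fixed and $\xi_1=\xi-\xi_2$.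 Put $$\Phi=H(\xi)+H(\xi_2)-H(\xi_1),\qquad \xi^{\perp_k}=\xi-\Bigl(\xi\cdot\frac{\xi_k}{|\xi_k|}\Bigr)\frac{\xi_k}{|\xi_k|}.$$ For a symbol $b=b(\xi_1,\xi_2)$ (scalar, vector or tensor valued) let $$\|b\|_*=\min\Bigl\{\|b\|_{L^\infty_\xi\dot H^1_{\xi_1}}^{1/2}\|b\|_{L^\infty_\xi\dot H^2_{\xi_1}}^{1/2},\ \|b\|_{L^\infty_\xi\dot H^1_{\xi_2}}^{1/2}\|b\|_{L^\infty_\xi\dot H^2_{\xi_2}}^{1/2}\Bigr\},$$ where for fixed $\xi$ one regards $b$ as the function $\xi_1\mapsto b(\xi_1,\xi-\xi_1)$, respectively $\xi_2\mapsto b(\xi-\xi_2,\xi_2)$. **Proposition.** For all $N_1,N_2\in 2^{\mathbb Z}$ there are functions $\rho_j=\rho_j^{N_1,N_2}:\mathbb R^3\times\mathbb R^3\to[0,\infty)$, $1\le j\le 8$, smooth where $\xi_1,\xi_2,\xi\neq0$, with $\sum_{j=1}^8\rho_j=1$ on the support of $\chi(\xi_1,\xi_2):=\tilde\psi(\xi_1/N_1)\tilde\psi(\xi_2/N_2)$,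 such that at all points with $\xi\ne0$ and $\rho_j\chi\neq0$ one has $\Phi\neq0$ if $j\in\{1,2,3,6\}$ (time non-resonance), $\nabla_{\xi_2}\Phi\ne0$ if $j\in\{5,7,8\}$ (space non-resonance), and $\xi^{\perp_2}\cdot\nabla_{\xi_2}\Phi\neq0$ if $j=4$ (angular non-resonance), and such that the following holds for every $\beta\in\mathbb R$ and every $A\in\{A_1,A_2\}$. All implicit constants depend only on $\varphi$ and $\beta$, not on $N_1,N_2$; a condition on $N_1,N_2$ 'in $\operatorname{supp} b$' means that it holds unless $b\equiv0$. * For $j\in\{1,2,3,6\}$ let $b_j^T=\rho_j\,\chi\,A\,U(\xi)\,\dfrac{\nabla_\xi\Phi}{\Phi}$. Then * $\|b_1^T\|_*\lesssim \frac1{N_2}$, with $N_1\lesssim N_2$ in $\operatorname{supp}b_1^T$; * $\|b_j^T\|_*\lesssim 1$, with $N_1\sim N_2$ in $\operatorname{supp}b_j^T$, for $j\in\{2,3\}$; * $\|b_6^T\|_*\lesssim \frac1{N_1N_2^{1/2}}$, with $N_2\lesssim N_1\lesssim1$ in $\operatorname{supp}b_6^T$. * For $j\in\{5,7,8\}$ let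 $b_j^X=\rho_j\,\chi\,A\,U(\xi)\,\dfrac{\nabla_\xi\Phi\otimes\nabla_{\xi_2}\Phi}{|\nabla_{\xi_2}\Phi|^2}$ and $\tilde b_j^X=\nabla_{\xi_2}\cdot b_j^X$ (divergence in the second tensor index). Then * $\|b_5^X\|_*\lesssim\frac{N_2}{N_1}$ and $\|\tilde b_5^X\|_*\lesssim\frac1{N_2}\cdot\frac{N_2}{N_1}=\frac1{N_1}$, with $N_1\gtrsim1$ and $N_1\ge 64N_2$ in the supports of $b_5^X$ and $\tilde b_5^X$; * $\|b_j^X\|_*\lesssim\frac1{N_1^{1/2}}$ and $\|\tilde b_j^X\|_*\lesssim\frac1{N_2}\cdot\frac1{N_1^{1/2}}$, with $N_2\lesssim N_1\lesssim1$ in the supports of $b_j^X$ and $\tilde b_j^X$, for $j\in\{7,8\}$. * Let $m=\rho_4\,\chi\,A\,U(\xi)\,\dfrac{\nabla_\xi\Phi}{\xi^{\perp_2}\cdot\nabla H(\xi_1)}$ and $$b^\angle=\nabla_{\xi_2}\cdot[m\otimes\xi^{\perp_2}],\qquad b_k^\angle=m\otimes\frac{\xi_k\times\xi^{\perp_k}}{|\xi_k|^2}\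 (k\in\{1,2\}),\qquad \tilde b^\angle=m\otimes\Bigl[\Bigl(\xi\cdot\frac{\xi_1}{|\xi_1|}\Bigr)\frac{\xi_1}{|\xi_1|}-\Bigl(\xi\cdot\frac{\xi_2}{|\xi_2|}\Bigr)\frac{\xi_2}{|\xi_2|}\Bigr].$$ Then $\|b^\angle\|_*+\|b_k^\angle\|_*+\|\tilde b^\angle\|_*\lesssim1$ for $k\in\{1,2\}$, with $1\lesssim N_1\sim N_2$ in the supports of these multipliers. -/

import Mathlib

open MeasureTheory
open scoped ENNReal ContDiff

noncomputable section

namespace CubicQuintic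

/-- Frequency space `ℝ³` with its Euclidean norm. -/
abbrev E : Type := EuclideanSpace ℝ (Fin 3)

/-- The space of `3 × 3` tensors with the Frobenius norm. -/
abbrev T : Type := EuclideanSpace ℝ (Fin 3 × Fin 3)

/-- The `k`-th standard basis vector of `ℝ³`. -/
def e (k : Fin 3) : E := EuclideanSpace.single k 1

/-! ### Homogeneous Sobolev norms and the norm on symbols -/

section Norms

variable {F : Type*} [NormedAddCommGroup F] [NormedSpace ℝ F]

/-- `D` is the family of all weak partial derivatives of order `s` of `f`: for every
`α = (α₁, …, α_s)` with entries in `{1, 2, 3}`, `D α = ∂_{α₁} ⋯ ∂_{α_s} f` in the sense of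
distributions. -/
def IsWeakDeriv (s : ℕ) (f : E → F) (D : (Fin s → Fin 3) → E → F) : Prop :=
  LocallyIntegrable f ∧ ∀ α : Fin s → Fin 3, LocallyIntegrable (D α) ∧
    ∀ g : E → ℝ, ContDiff ℝ ∞ g → HasCompactSupport g →
      ∫ x, (iteratedFDeriv ℝ s g x fun j => e (α j)) • f x = (-1 : ℝ) ^ s • ∫ x, g x • D α x

/-- The norm of the homogeneous Sobolev space `Ḣˢ(ℝ³)` for an integer `s`, i.e. the `L²` norm of
the (a.e. unique) tensor of weak derivatives of order `s`; it is `∞` if there are no such weak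
derivatives. -/
def hdotNorm (s : ℕ) (f : E → F) : ℝ≥0∞ :=
  ⨅ (D : (Fin s → Fin 3) → E → F) (_ : IsWeakDeriv s f D),
    (∑ α, eLpNorm (D α) 2 volume ^ 2) ^ (1 / 2 : ℝ)

/-- `‖b‖_{L^∞_ξ Ḣˢ_{ξ₁}}`: for fixed `ξ`, `b` is a function of `ξ₁` through `b (ξ₁, ξ - ξ₁)`. -/
def linftyHdot₁ (s : ℕ) (b : E → E → F) : ℝ≥0∞ :=
  essSup (fun ξ : E => hdotNorm s fun ξ₁ => b ξ₁ (ξ - ξ₁)) volume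

/-- `‖b‖_{L^∞_ξ Ḣˢ_{ξ₂}}`: for fixed `ξ`, `b` is a function of `ξ₂` through `b (ξ - ξ₂, ξ₂)`. -/
def linftyHdot₂ (s : ℕ) (b : E → E → F) : ℝ≥0∞ :=
  essSup (fun ξ : E => hdotNorm s fun ξ₂ => b (ξ - ξ₂) ξ₂) volume

/-- The 'norm' of a symbol `b = b (ξ₁, ξ₂)`. -/
def symbNorm (b : E → E → F) : ℝ≥0∞ :=
  min (linftyHdot₁ 1 b ^ (1 / 2 : ℝ) * linftyHdot₁ 2 b ^ (1 / 2 : ℝ))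
    (linftyHdot₂ 1 b ^ (1 / 2 : ℝ) * linftyHdot₂ 2 b ^ (1 / 2 : ℝ))

end Norms

/-! ### Cutoffs, dispersion relation and phase -/

/-- A radial bump function, supported in `{|ξ| ≤ 11/10}` and equal to one on the unit ball. -/
structure IsBump (φ : E → ℝ) : Prop where
  smooth : ContDiff ℝ ∞ φ
  radial : ∀ ξ η : E, ‖ξ‖ = ‖η‖ → φ ξ = φ η
  eq_one : ∀ ξ : E, ‖ξ‖ ≤ 1 → φ ξ = 1
  eq_zero : ∀ ξ : E, 11 / 10 < ‖ξ‖ → φ ξ = 0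

/-- `ψ(ξ) = φ(ξ) - φ(2ξ)`. -/
def psi (φ : E → ℝ) (ξ : E) : ℝ := φ ξ - φ ((2 : ℝ) • ξ)

/-- `ψ̃(ξ) = ψ(2ξ) + ψ(ξ) + ψ(ξ/2)`. -/
def psiTilde (φ : E → ℝ) (ξ : E) : ℝ :=
  psi φ ((2 : ℝ) • ξ) + psi φ ξ + psi φ ((2 : ℝ)⁻¹ • ξ)

/-- `ψ̃(ξ₁/N₁) ψ̃(ξ₂/N₂)`. -/
def cutoff (φ : E → ℝ) (N₁ N₂ : ℝ) (ξ₁ ξ₂ : E) : ℝ :=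
  psiTilde φ (N₁⁻¹ • ξ₁) * psiTilde φ (N₂⁻¹ • ξ₂)

/-- `⟨ξ⟩ = √(2 + |ξ|²)`. -/
def jap (ξ : E) : ℝ := √(2 + ‖ξ‖ ^ 2)

/-- `H(ξ) = |ξ| ⟨ξ⟩`. -/
def H (ξ : E) : ℝ := ‖ξ‖ * jap ξ

/-- `U(ξ) = |ξ| / ⟨ξ⟩`. -/
def U (ξ : E) : ℝ := ‖ξ‖ / jap ξ

/-- The unit vector `ξ / |ξ|`. -/
def unit (ξ : E) : E := ‖ξ‖⁻¹ • ξ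

/-- `A₁(ξ₁, ξ₂) = (4 + 4β) + 2 ξ₁·ξ₂ / (2 + |ξ₁|² + |ξ₂|²)`. -/
def A₁ (β : ℝ) (ξ₁ ξ₂ : E) : ℝ :=
  (4 + 4 * β) + 2 * inner ℝ ξ₁ ξ₂ / (2 + ‖ξ₁‖ ^ 2 + ‖ξ₂‖ ^ 2)

/-- `A₂(ξ₁, ξ₂) = - 2 ⟨ξ₁⟩⟨ξ₂⟩ / (2 + |ξ₁|² + |ξ₂|²) (ξ₁/|ξ₁|)·(ξ₂/|ξ₂|)`. -/
def A₂ (ξ₁ ξ₂ : E) : ℝ :=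
  -(2 * jap ξ₁ * jap ξ₂ / (2 + ‖ξ₁‖ ^ 2 + ‖ξ₂‖ ^ 2)) * inner ℝ (unit ξ₁) (unit ξ₂)

/-- The phase `Φ = H(ξ) + H(ξ₂) - H(ξ₁)`, where `ξ = ξ₁ + ξ₂`. -/
def Φ (ξ₁ ξ₂ : E) : ℝ := H (ξ₁ + ξ₂) + H ξ₂ - H ξ₁

/-- `∇_ξ b`: the gradient in `ξ` with `ξ₂` fixed and `ξ₁ = ξ - ξ₂`. -/
def gradXi (b : E → E → ℝ) (ξ₁ ξ₂ : E) : E :=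
  gradient (fun ξ : E => b (ξ - ξ₂) ξ₂) (ξ₁ + ξ₂)

/-- `∇_{ξ₂} b`: the gradient in `ξ₂` with `ξ` fixed and `ξ₁ = ξ - ξ₂`. -/
def gradXi₂ (b : E → E → ℝ) (ξ₁ ξ₂ : E) : E :=
  gradient (fun η : E => b (ξ₁ + ξ₂ - η) η) ξ₂

/-- The tensor product `(u v)_{ik} = u_i v_k`. -/
def tensor (u v : E) : T := WithLp.toLp 2 fun p => u p.1 * v p.2

/-- `(∇_{ξ₂} · B)_i = ∑ₖ ∂_{ξ₂,k} B_{ik}`, where `ξ` is fixed and `ξ₁ = ξ - ξ₂`. -/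
def divXi₂ (B : E → E → T) (ξ₁ ξ₂ : E) : E :=
  WithLp.toLp 2 fun i =>
    ∑ k : Fin 3, fderiv ℝ (fun η : E => B (ξ₁ + ξ₂ - η) η (i, k)) ξ₂ (e k)

/-- The part of `ξ` orthogonal to `η`: `ξ - (ξ · η/|η|) η/|η|`. -/
def perp (ξ η : E) : E := ξ - (inner ℝ ξ (unit η)) • unit η

/-- The cross product in `ℝ³`. -/
def cross (u v : E) : E := WithLp.toLp 2 (crossProduct u.ofLp v.ofLp)

/-! ### The multipliers

Here `κ` is the product of a function `ρⱼ` of the decomposition, of `ψ̃(ξ₁/N₁) ψ̃(ξ₂/N₂)` and of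
`A(ξ₁, ξ₂)`. -/

/-- `b^T = κ U(ξ) ∇_ξΦ / Φ` (vector valued). -/
def bT (κ : E → E → ℝ) (ξ₁ ξ₂ : E) : E :=
  (κ ξ₁ ξ₂ * U (ξ₁ + ξ₂) / Φ ξ₁ ξ₂) • gradXi Φ ξ₁ ξ₂

/-- `b^X = κ U(ξ) ∇_ξΦ ∇_{ξ₂}Φ / |∇_{ξ₂}Φ|²` (tensor valued). -/
def bX (κ : E → E → ℝ) (ξ₁ ξ₂ : E) : T :=
  (κ ξ₁ ξ₂ * U (ξ₁ + ξ₂) / ‖gradXi₂ Φ ξ₁ ξ₂‖ ^ 2) • tensor (gradXi Φ ξ₁ ξ₂) (gradXi₂ Φ ξ₁ ξ₂)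

/-- `b̃^X = ∇_{ξ₂} · b^X` (vector valued). -/
def bXtilde (κ : E → E → ℝ) : E → E → E := divXi₂ (bX κ)

/-- `m = κ U(ξ) ∇_ξΦ / (ξ^{⊥₂} · ∇H(ξ₁))` (vector valued). -/
def mAng (κ : E → E → ℝ) (ξ₁ ξ₂ : E) : E :=
  (κ ξ₁ ξ₂ * U (ξ₁ + ξ₂) / inner ℝ (perp (ξ₁ + ξ₂) ξ₂) (gradient H ξ₁)) • gradXi Φ ξ₁ ξ₂

/-- `b^∠ = ∇_{ξ₂} · [m ξ^{⊥₂}]` (vector valued). -/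
def bAng (κ : E → E → ℝ) : E → E → E :=
  divXi₂ fun ξ₁ ξ₂ => tensor (mAng κ ξ₁ ξ₂) (perp (ξ₁ + ξ₂) ξ₂)

/-- `b₁^∠ = m (ξ₁ × ξ^{⊥₁}) / |ξ₁|²` (tensor valued). -/
def bAng₁ (κ : E → E → ℝ) (ξ₁ ξ₂ : E) : T :=
  tensor (mAng κ ξ₁ ξ₂) ((‖ξ₁‖ ^ 2)⁻¹ • cross ξ₁ (perp (ξ₁ + ξ₂) ξ₁))

/-- `b₂^∠ = m (ξ₂ × ξ^{⊥₂}) / |ξ₂|²` (tensor valued). -/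
def bAng₂ (κ : E → E → ℝ) (ξ₁ ξ₂ : E) : T :=
  tensor (mAng κ ξ₁ ξ₂) ((‖ξ₂‖ ^ 2)⁻¹ • cross ξ₂ (perp (ξ₁ + ξ₂) ξ₂))

/-- `b̃^∠ = m [(ξ · ξ₁/|ξ₁|) ξ₁/|ξ₁| - (ξ · ξ₂/|ξ₂|) ξ₂/|ξ₂|]` (tensor valued). -/
def bAngTilde (κ : E → E → ℝ) (ξ₁ ξ₂ : E) : T :=
  tensor (mAng κ ξ₁ ξ₂)
    ((inner ℝ (ξ₁ + ξ₂) (unit ξ₁)) • unit ξ₁ - (inner ℝ (ξ₁ + ξ₂) (unit ξ₂)) • unit ξ₂)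

/-! ### Partitions into non-resonant regions -/

/-- `ρ₁, …, ρ₈` (here indexed by `j + 1` for `j : Fin 8`) is a partition of unity on the support of
`ψ̃(ξ₁/N₁) ψ̃(ξ₂/N₂)`, smooth away from `ξ₁ = 0`, `ξ₂ = 0`, `ξ = 0`, into regions of time
non-resonance (`Φ ≠ 0`) for `ρ₁, ρ₂, ρ₃, ρ₆`, of space non-resonance (`∇_{ξ₂}Φ ≠ 0`) for
`ρ₅, ρ₇, ρ₈` and of angular non-resonance (`ξ^{⊥₂} · ∇_{ξ₂}Φ ≠ 0`) for `ρ₄`.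
(`Φ` and `ξ^{⊥₂}` vanish where `ξ = 0`, so these points, at which `U(ξ) = 0`, are exempt.) -/
structure IsNonresonantPartition (φ : E → ℝ) (N₁ N₂ : ℝ) (ρ : Fin 8 → E → E → ℝ) : Prop where
  nonneg : ∀ j ξ₁ ξ₂, 0 ≤ ρ j ξ₁ ξ₂
  smooth : ∀ j, ContDiffOn ℝ ∞ (fun p : E × E => ρ j p.1 p.2)
    {p | p.1 ≠ 0 ∧ p.2 ≠ 0 ∧ p.1 + p.2 ≠ 0}
  sum_eq_one : ∀ p ∈ tsupport (fun p : E × E => cutoff φ N₁ N₂ p.1 p.2),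
    ∑ j, ρ j p.1 p.2 = 1
  time : ∀ j ∈ ({0, 1, 2, 5} : Finset (Fin 8)), ∀ ξ₁ ξ₂, ξ₁ + ξ₂ ≠ 0 →
    ρ j ξ₁ ξ₂ * cutoff φ N₁ N₂ ξ₁ ξ₂ ≠ 0 → Φ ξ₁ ξ₂ ≠ 0
  space : ∀ j ∈ ({4, 6, 7} : Finset (Fin 8)), ∀ ξ₁ ξ₂, ξ₁ + ξ₂ ≠ 0 →
    ρ j ξ₁ ξ₂ * cutoff φ N₁ N₂ ξ₁ ξ₂ ≠ 0 → gradXi₂ Φ ξ₁ ξ₂ ≠ 0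
  angular : ∀ ξ₁ ξ₂, ξ₁ + ξ₂ ≠ 0 → ρ 3 ξ₁ ξ₂ * cutoff φ N₁ N₂ ξ₁ ξ₂ ≠ 0 →
    inner ℝ (perp (ξ₁ + ξ₂) ξ₂) (gradXi₂ Φ ξ₁ ξ₂) ≠ 0

end CubicQuintic

end

open CubicQuintic

noncomputable section

namespace CubicQuintic

/-! ### Uniform symbol estimates at a point -/

section SymbolCalculus

variable {ι V F G W : Type*} [NormedAddCommGroup V] [NormedSpace ℝ V]
  [NormedAddCommGroup F] [NormedSpace ℝ F] [NormedAddCommGroup G] [NormedSpace ℝ G]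
  [NormedAddCommGroup W] [NormedSpace ℝ W]

/-! The quantity `symbNorm` interpolates halfway between Ḣ¹ and Ḣ², that is at Ḣ^{3/2}, which is
dilation invariant in ℝ³. A symbol that for fixed ξ lives on a ball of radius R in ξ₂ and satisfies
|∂ᵏb| ≲ M R⁻ᵏ for k ≤ 2 therefore has norm ≲ M (`symbNorm_le_of_ball`). Everything reduces to
pointwise bounds, and these come from a calculus (`Symb`, `Ell`) closed under products, inverses,
square roots and composition. The base point is part of the index of a family, so a constant
independent of the index is uniform in ξ, ξ₂, N₁, N₂ and A at once.

Write μ for the cosine of the angle between ξ and ξ₂. Since H² is a polynomial in |·|², multiplying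
Φ by H(ξ) + H(ξ₂) + H(ξ₁) gives 2|ξ||ξ₂|P with an explicit P = `phaseFactor` (`Φ_mul_sum`). P is
positive for μ > 0, and near μ = -1 it is at most -(|ξ| + |ξ₂|)². Thus Φ can vanish only at
intermediate angles, and there either ∇_{ξ₂}Φ or its component along ξ^{⊥₂} is nonzero. The weights
depend on N₁, N₂ and μ only: for N₁ ≪ N₂, ρ₁ = 1, as H(ξ₂) dominates H(ξ₁); for N₂ ≪ N₁ with N₁ ≥ 1,
ρ₅ = 1, as |∇H(ξ₁)| dominates |∇H(ξ₂)|; for N₁ ∼ N₂ with N₁ ≥ 1, ρ₂ takes the nearly parallel or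
antiparallel directions and ρ₄ the others, where ξ^{⊥₂}·∇H(ξ₁) ∼ |ξ|²(1 - μ²) ≠ 0; for N₂ ≲ N₁ < 1,
ρ₆ takes 1 + μ ≲ N₁² or μ ≥ 1/4, and ρ₇ the rest. The functions ρ₃ and ρ₈ are zero.

The last region is the delicate one. With λ² = 1 + μ + N₁² one has |P| ∼ λ² on the support of ρ₆,
|∇_{ξ₂}Φ| ∼ |ξ|λ/N₁ on that of ρ₇, and |∇_ξΦ| ≲ N₂λ/N₁ throughout, while a ξ₂-derivative costs
(N₂λ)⁻¹. The singularity at λ → N₁ is integrated using that the cap 1 + μ ≤ t has relative volume ≲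
t (`volume_cap_le`), which gives a factor N₁^{-3/2} (`symbNorm_le_of_cap`). -/

theorem norm_iteratedFDeriv_bilinear_at (B : F →L[ℝ] G →L[ℝ] W) {f : V → F} {g : V → G} {x : V}
    {n : ℕ} (hf : ContDiffAt ℝ n f x) (hg : ContDiffAt ℝ n g x) :
    ‖iteratedFDeriv ℝ n (fun y => B (f y) (g y)) x‖ ≤
      ‖B‖ * ∑ i ∈ Finset.range (n + 1), (n.choose i : ℝ) * ‖iteratedFDeriv ℝ i f x‖ *
        ‖iteratedFDeriv ℝ (n - i) g x‖ := by
  obtain ⟨u, hu, hfu⟩ := hf.contDiffOn le_rfl (by simp)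
  obtain ⟨v, hv, hgv⟩ := hg.contDiffOn le_rfl (by simp)
  obtain ⟨s, hs, hso, hxs⟩ := mem_nhds_iff.1 (Filter.inter_mem hu hv)
  have h := B.norm_iteratedFDerivWithin_le_of_bilinear
    (hfu.mono fun y hy => (hs hy).1) (hgv.mono fun y hy => (hs hy).2) hso.uniqueDiffOn hxs le_rfl
  simpa only [iteratedFDerivWithin_of_isOpen _ hso hxs] using h

theorem norm_iteratedFDeriv_comp_at {g : F → G} {f : V → F} {x : V} {n : ℕ}
    (hg : ContDiffAt ℝ n g (f x)) (hf : ContDiffAt ℝ n f x) {C D : ℝ}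
    (hC : ∀ i ≤ n, ‖iteratedFDeriv ℝ i g (f x)‖ ≤ C)
    (hD : ∀ i, 1 ≤ i → i ≤ n → ‖iteratedFDeriv ℝ i f x‖ ≤ D ^ i) :
    ‖iteratedFDeriv ℝ n (fun y => g (f y)) x‖ ≤ n.factorial * C * D ^ n := by
  obtain ⟨u, hu, hfu⟩ := hf.contDiffOn le_rfl (by simp)
  obtain ⟨v, hv, hgv⟩ := hg.contDiffOn le_rfl (by simp)
  obtain ⟨t, ht, hto, hxt⟩ := mem_nhds_iff.1 hv
  obtain ⟨s, hs, hso, hxs⟩ := mem_nhds_iff.1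
    (Filter.inter_mem hu (hf.continuousAt.preimage_mem_nhds (hto.mem_nhds hxt)))
  have h := norm_iteratedFDerivWithin_comp_le (hgv.mono ht)
    (hfu.mono fun y hy => (hs hy).1) le_rfl hto.uniqueDiffOn hso.uniqueDiffOn
    (fun y hy => (hs hy).2) hxs (C := C) (D := D)
    (fun i hi => by rw [iteratedFDerivWithin_of_isOpen _ hto hxt]; exact hC i hi)
    (fun i h1 hi => by rw [iteratedFDerivWithin_of_isOpen _ hso hxs]; exact hD i h1 hi)
  rw [iteratedFDerivWithin_of_isOpen _ hso hxs] at h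
  exact h

/-- The family `f i` is smooth at `x i`, and its derivatives of order `k ≤ n` at this point are
bounded by `M i * w i ^ k`, up to a constant that does not depend on `i`. -/
structure Symb (n : ℕ) (x : ι → V) (w M : ι → ℝ) (f : ι → V → F) : Prop where
  w_nonneg : ∀ i, 0 ≤ w i
  M_nonneg : ∀ i, 0 ≤ M i
  contDiffAt : ∀ i, ContDiffAt ℝ ∞ (f i) (x i)
  bound : ∃ C : ℝ, 0 ≤ C ∧ ∀ i, ∀ k ≤ n, ‖iteratedFDeriv ℝ k (f i) (x i)‖ ≤ C * (M i * w i ^ k)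

variable {n : ℕ} {x : ι → V} {w M M' : ι → ℝ} {f : ι → V → F} {g : ι → V → G}

theorem _root_.ContDiffAt.of_infty {f : V → F} {x : V} (h : ContDiffAt ℝ ∞ f x) (k : ℕ) :
    ContDiffAt ℝ k f x :=
  h.of_le (by exact_mod_cast le_top)

namespace Symb

theorem norm_le (hf : Symb n x w M f) : ∃ C : ℝ, 0 ≤ C ∧ ∀ i, ‖f i (x i)‖ ≤ C * M i := by
  obtain ⟨C, hC, h⟩ := hf.bound
  exact ⟨C, hC, fun i => by simpa using h i 0 (Nat.zero_le _)⟩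

theorem congr {f' : ι → V → F} (hf : Symb n x w M f) (h : ∀ i, f' i =ᶠ[nhds (x i)] f i) :
    Symb n x w M f' := by
  obtain ⟨C, hC, hb⟩ := hf.bound
  refine ⟨hf.w_nonneg, hf.M_nonneg, fun i => (hf.contDiffAt i).congr_of_eventuallyEq (h i),
    C, hC, fun i k hk => ?_⟩
  rw [((h i).iteratedFDeriv ℝ k).eq_of_nhds]
  exact hb i k hk

theorem of_const (hw : ∀ i, 0 ≤ w i) {c : ι → F} (C : ℝ) (hM : ∀ i, 0 ≤ M i)
    (hc : ∀ i, ‖c i‖ ≤ C * M i) : Symb n x w M fun i _ => c i := by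
  refine ⟨hw, hM, fun i => contDiffAt_const, max C 0, le_max_right _ _, fun i k _ => ?_⟩
  rcases k with _ | k
  · have : C * M i ≤ max C 0 * M i := mul_le_mul_of_nonneg_right (le_max_left _ _) (hM i)
    simpa using (hc i).trans this
  · rw [iteratedFDeriv_succ_const]
    have := hM i
    have := hw i
    simp only [Pi.zero_apply, norm_zero]
    positivity

/-- Trade the size of a symbol against that of its derivatives. -/
theorem shift {w' : ι → ℝ} (hf : Symb n x w M f) (C : ℝ) (hw' : ∀ i, 0 ≤ w' i)
    (hM' : ∀ i, 0 ≤ M' i) (h1 : ∀ i, w i ≤ C * w' i)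
    (h2 : ∀ i, M i * w i ≤ C * (M' i * w' i)) (h3 : ∀ i, ‖f i (x i)‖ ≤ C * M' i) :
    Symb n x w' M' f := by
  obtain ⟨D, hD, hb⟩ := hf.bound
  obtain ⟨C, hC, h1, h2, h3⟩ : ∃ C : ℝ, 1 ≤ C ∧ (∀ i, w i ≤ C * w' i) ∧
      (∀ i, M i * w i ≤ C * (M' i * w' i)) ∧ (∀ i, ‖f i (x i)‖ ≤ C * M' i) :=
    ⟨max C 1, le_max_right _ _,
      fun i => (h1 i).trans (mul_le_mul_of_nonneg_right (le_max_left _ _) (hw' i)),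
      fun i => (h2 i).trans (mul_le_mul_of_nonneg_right (le_max_left _ _)
        (mul_nonneg (hM' i) (hw' i))),
      fun i => (h3 i).trans (mul_le_mul_of_nonneg_right (le_max_left _ _) (hM' i))⟩
  have hC0 : 0 ≤ C := zero_le_one.trans hC
  refine ⟨hw', hM', hf.contDiffAt, (D + 1) * C ^ (n + 1), by positivity, fun i k hk => ?_⟩
  have hwi := hf.w_nonneg i
  have hMi := hf.M_nonneg i
  have hw'i := hw' i
  have hM'i := hM' i
  rcases k with _ | k
  · simp only [norm_iteratedFDeriv_zero, pow_zero, mul_one]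
    refine (h3 i).trans (mul_le_mul_of_nonneg_right ?_ hM'i)
    have : C ≤ C ^ (n + 1) := le_self_pow₀ hC (by omega)
    nlinarith
  -- One factor w is paired with M and the other k are compared with w' separately. So M ≲ M' is
  -- never needed: the value at the base point is controlled by `h3` alone.
  · calc ‖iteratedFDeriv ℝ (k + 1) (f i) (x i)‖ ≤ D * (M i * w i ^ (k + 1)) := hb i _ hk
      _ = D * ((M i * w i) * w i ^ k) := by ring
      _ ≤ D * ((C * (M' i * w' i)) * (C * w' i) ^ k) := by
          refine mul_le_mul_of_nonneg_left (mul_le_mul (h2 i) ?_ (by positivity) (by positivity)) hD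
          exact pow_le_pow_left₀ hwi (h1 i) k
      _ = D * C ^ (k + 1) * (M' i * w' i ^ (k + 1)) := by ring
      _ ≤ (D + 1) * C ^ (n + 1) * (M' i * w' i ^ (k + 1)) := by
          refine mul_le_mul_of_nonneg_right (mul_le_mul (by linarith) ?_ (by positivity)
            (by positivity)) (by positivity)
          exact pow_le_pow_right₀ hC (by omega)

theorem mono (hf : Symb n x w M f) (C : ℝ) (hM' : ∀ i, 0 ≤ M' i) (h : ∀ i, M i ≤ C * M' i) :
    Symb n x w M' f := by
  obtain ⟨D, hD, hb⟩ := hf.bound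
  refine ⟨hf.w_nonneg, hM', hf.contDiffAt, D * max C 0, by positivity, fun i k hk => ?_⟩
  refine (hb i k hk).trans ?_
  have := hf.w_nonneg i
  have h' : M i ≤ max C 0 * M' i :=
    (h i).trans (mul_le_mul_of_nonneg_right (le_max_left _ _) (hM' i))
  calc D * (M i * w i ^ k) ≤ D * (max C 0 * M' i * w i ^ k) := by gcongr
    _ = _ := by ring

theorem bilinear (B : F →L[ℝ] G →L[ℝ] W) (hf : Symb n x w M f) (hg : Symb n x w M' g) :
    Symb n x w (fun i => M i * M' i) fun i y => B (f i y) (g i y) := by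
  obtain ⟨C, hC, hb⟩ := hf.bound
  obtain ⟨D, hD, hb'⟩ := hg.bound
  refine ⟨hf.w_nonneg, fun i => mul_nonneg (hf.M_nonneg i) (hg.M_nonneg i), fun i =>
    B.isBoundedBilinearMap.contDiff.contDiffAt.comp (x i)
      ((hf.contDiffAt i).prodMk (hg.contDiffAt i)),
    ‖B‖ * (C * D * 2 ^ n), by positivity, fun i k hk => ?_⟩
  have hwi := hf.w_nonneg i
  have hMi := hf.M_nonneg i
  have hM'i := hg.M_nonneg i
  refine (norm_iteratedFDeriv_bilinear_at B ((hf.contDiffAt i).of_infty k)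
    ((hg.contDiffAt i).of_infty k)).trans ?_
  have key : ∑ j ∈ Finset.range (k + 1), (k.choose j : ℝ) * ‖iteratedFDeriv ℝ j (f i) (x i)‖ *
        ‖iteratedFDeriv ℝ (k - j) (g i) (x i)‖ ≤
      ∑ j ∈ Finset.range (k + 1), (k.choose j : ℝ) * (C * D * (M i * M' i * w i ^ k)) := by
    refine Finset.sum_le_sum fun j hj => ?_
    have hjk : j ≤ k := Nat.lt_succ_iff.1 (Finset.mem_range.1 hj)
    calc (k.choose j : ℝ) * ‖iteratedFDeriv ℝ j (f i) (x i)‖ *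
          ‖iteratedFDeriv ℝ (k - j) (g i) (x i)‖
        ≤ (k.choose j : ℝ) * (C * (M i * w i ^ j)) * (D * (M' i * w i ^ (k - j))) := by
          gcongr
          · exact hb i j (hjk.trans hk)
          · exact hb' i (k - j) ((Nat.sub_le _ _).trans hk)
      _ = (k.choose j : ℝ) * (C * D * (M i * M' i * (w i ^ j * w i ^ (k - j)))) := by ring
      _ = _ := by rw [← pow_add, Nat.add_sub_cancel' hjk]
  rw [← Finset.sum_mul, ← Nat.cast_sum, Nat.sum_range_choose] at key
  calc _ ≤ ‖B‖ * (((2 ^ k : ℕ) : ℝ) * (C * D * (M i * M' i * w i ^ k))) := by gcongr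
    _ ≤ ‖B‖ * (2 ^ n * (C * D * (M i * M' i * w i ^ k))) := by
        push_cast
        gcongr
        exact one_le_two
    _ = _ := by ring

theorem add {f' : ι → V → F} (hf : Symb n x w M f) (hg : Symb n x w M f') :
    Symb n x w M fun i y => f i y + f' i y := by
  obtain ⟨C, hC, hb⟩ := hf.bound
  obtain ⟨D, hD, hb'⟩ := hg.bound
  refine ⟨hf.w_nonneg, hf.M_nonneg, fun i => (hf.contDiffAt i).add (hg.contDiffAt i), C + D,
    by positivity, fun i k hk => ?_⟩
  change ‖iteratedFDeriv ℝ k (f i + f' i) (x i)‖ ≤ _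
  rw [iteratedFDeriv_add_apply ((hf.contDiffAt i).of_infty k) ((hg.contDiffAt i).of_infty k),
    add_mul]
  exact (norm_add_le _ _).trans (add_le_add (hb i k hk) (hb' i k hk))

theorem neg (hf : Symb n x w M f) : Symb n x w M fun i y => -f i y := by
  obtain ⟨C, hC, hb⟩ := hf.bound
  refine ⟨hf.w_nonneg, hf.M_nonneg, fun i => (hf.contDiffAt i).neg, C, hC, fun i k hk => ?_⟩
  change ‖iteratedFDeriv ℝ k (-f i) (x i)‖ ≤ _
  rw [iteratedFDeriv_neg_apply, norm_neg]
  exact hb i k hk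

theorem sub {f' : ι → V → F} (hf : Symb n x w M f) (hg : Symb n x w M f') :
    Symb n x w M fun i y => f i y - f' i y := by
  simpa only [sub_eq_add_neg] using hf.add hg.neg

theorem clm (L : F →L[ℝ] G) (hf : Symb n x w M f) : Symb n x w M fun i y => L (f i y) := by
  obtain ⟨C, hC, hb⟩ := hf.bound
  refine ⟨hf.w_nonneg, hf.M_nonneg, fun i => L.contDiff.contDiffAt.comp (x i) (hf.contDiffAt i),
    ‖L‖ * C, by positivity, fun i k hk => ?_⟩
  refine (L.norm_iteratedFDeriv_comp_left ((hf.contDiffAt i).of_infty k) le_rfl).trans ?_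
  rw [mul_assoc]
  exact mul_le_mul_of_nonneg_left (hb i k hk) (norm_nonneg _)

theorem smul {a : ι → V → ℝ} (ha : Symb n x w M a) (hf : Symb n x w M' f) :
    Symb n x w (fun i => M i * M' i) fun i y => a i y • f i y :=
  ha.bilinear (ContinuousLinearMap.lsmul ℝ ℝ) hf

theorem mul {a b : ι → V → ℝ} (ha : Symb n x w M a) (hb : Symb n x w M' b) :
    Symb n x w (fun i => M i * M' i) fun i y => a i y * b i y :=
  ha.smul hb

theorem fderiv (hf : Symb (n + 1) x w M f) :
    Symb n x w (fun i => M i * w i) fun i => _root_.fderiv ℝ (f i) := by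
  obtain ⟨C, hC, hb⟩ := hf.bound
  refine ⟨hf.w_nonneg, fun i => mul_nonneg (hf.M_nonneg i) (hf.w_nonneg i),
    fun i => (hf.contDiffAt i).fderiv_right (by simp), C, hC, fun i k hk => ?_⟩
  rw [norm_iteratedFDeriv_fderiv]
  refine (hb i (k + 1) (by omega)).trans_eq (by ring)

theorem of_le {m : ℕ} (hf : Symb n x w M f) (h : m ≤ n) : Symb m x w M f := by
  obtain ⟨C, hC, hb⟩ := hf.bound
  exact ⟨hf.w_nonneg, hf.M_nonneg, hf.contDiffAt, C, hC, fun i k hk => hb i k (hk.trans h)⟩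

/-- The values at the base points stay in a compact set, where finitely many derivatives of g are
bounded; the Faà di Bruno bound then keeps the scale w. -/
theorem comp {g : F → G} {K U : Set F} (hU : IsOpen U) (hg : ContDiffOn ℝ ∞ g U)
    (hK : IsCompact K) (hKU : K ⊆ U) (hf : Symb n x w (fun _ => 1) f)
    (hfK : ∀ i, f i (x i) ∈ K) : Symb n x w (fun _ => 1) fun i y => g (f i y) := by
  obtain ⟨C, hC, hb⟩ := hf.bound
  have hgat : ∀ i, ContDiffAt ℝ ∞ g (f i (x i)) := fun i =>
    hg.contDiffAt (hU.mem_nhds (hKU (hfK i)))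
  have hbd : ∀ k : ℕ, ∃ D : ℝ, ∀ y ∈ K, ‖iteratedFDeriv ℝ k g y‖ ≤ D := by
    intro k
    have hc : ContinuousOn (iteratedFDeriv ℝ k g) K :=
      ((hg.continuousOn_iteratedFDerivWithin (m := k) (by exact_mod_cast le_top)
        hU.uniqueDiffOn).congr
        fun y hy => (iteratedFDerivWithin_of_isOpen k hU hy).symm).mono hKU
    obtain ⟨D, hD⟩ := hK.exists_bound_of_continuousOn hc
    exact ⟨D, hD⟩
  choose D hD using hbd
  set A := ∑ k ∈ Finset.range (n + 1), |D k| with hA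
  have hAD : ∀ k ≤ n, D k ≤ A := fun k hk => (le_abs_self _).trans
    (Finset.single_le_sum (f := fun k => |D k|) (fun _ _ => abs_nonneg _)
      (Finset.mem_range.2 (Nat.lt_succ_of_le hk)))
  have hA0 : 0 ≤ A := Finset.sum_nonneg fun _ _ => abs_nonneg _
  refine ⟨hf.w_nonneg, fun _ => zero_le_one, fun i => (hgat i).comp (x i) (hf.contDiffAt i),
    n.factorial * A * (C + 1) ^ n, by positivity, fun i k hk => ?_⟩
  have hwi := hf.w_nonneg i
  refine (norm_iteratedFDeriv_comp_at (C := A) (D := (C + 1) * w i) ((hgat i).of_infty k)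
    ((hf.contDiffAt i).of_infty k) (fun j hj => (hD j _ (hfK i)).trans (hAD j (hj.trans hk)))
    fun j h1 hj => ?_).trans ?_
  · refine (hb i j (hj.trans hk)).trans ?_
    rw [one_mul, mul_pow]
    gcongr
    calc C ≤ C + 1 := by linarith
      _ ≤ (C + 1) ^ j := le_self_pow₀ (by linarith) (by omega)
  · rw [mul_pow, one_mul, ← mul_assoc]
    gcongr
    linarith

theorem const_smul {c m : ι → ℝ} (C : ℝ) (hm : ∀ i, 0 ≤ m i) (hc : ∀ i, |c i| ≤ C * m i)
    (hf : Symb n x w M f) : Symb n x w (fun i => m i * M i) fun i y => c i • f i y :=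
  (of_const hf.w_nonneg C hm hc : Symb n x w m fun i _ => c i).smul hf

/-- Composition with a smooth homogeneous function on the half line. -/
theorem comp_scaled {g : ℝ → ℝ} {m : ℝ → ℝ} (hg : ContDiffOn ℝ ∞ g (Set.Ioi 0))
    (hgm : ∀ t s, 0 < t → 0 < s → g (t * s) = m t * g s) (hm : ∀ t, 0 < t → 0 ≤ m t)
    {a : ι → V → ℝ} (ha : Symb n x w M a) (hM : ∀ i, 0 < M i)
    {c : ℝ} (hc : 0 < c) (hlow : ∀ i, c * M i ≤ a i (x i)) :
    Symb n x w (fun i => m (M i)) fun i y => g (a i y) := by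
  obtain ⟨C, hC, hb⟩ := ha.norm_le
  -- Dividing by M puts the values into the compact interval [c, C] inside the half line;
  -- homogeneity restores the factor m(M) afterwards.
  have h1 : Symb n x w (fun _ => 1) fun i y => (M i)⁻¹ • a i y :=
    (ha.const_smul 1 (m := fun i => (M i)⁻¹) (fun i => (inv_pos.2 (hM i)).le) fun i => by
      rw [abs_of_pos (inv_pos.2 (hM i)), one_mul]).mono 1 (fun _ => zero_le_one) fun i => by
        rw [inv_mul_cancel₀ (hM i).ne', one_mul]
  have h2 := h1.comp (g := g) (K := Set.Icc c C) isOpen_Ioi hg isCompact_Icc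
    (fun t ht => hc.trans_le ht.1) fun i => by
      have := hM i
      rw [smul_eq_mul, inv_mul_eq_div]
      exact ⟨(le_div_iff₀ this).2 (hlow i),
        (div_le_iff₀ this).2 ((le_abs_self _).trans (hb i))⟩
  refine ((h2.const_smul 1 (c := fun i => m (M i)) (m := fun i => m (M i))
    (fun i => hm _ (hM i)) fun i => by rw [abs_of_nonneg (hm _ (hM i)), one_mul]).mono 1
    (fun i => hm _ (hM i)) fun i => by simp).congr fun i => ?_
  have hpos : 0 < a i (x i) := (mul_pos hc (hM i)).trans_le (hlow i)
  filter_upwards [(ha.contDiffAt i).continuousAt.eventually (eventually_gt_nhds hpos)] with y hy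
  rw [smul_eq_mul, ← hgm _ _ (hM i) (smul_pos (inv_pos.2 (hM i)) hy), smul_eq_mul,
    mul_inv_cancel_left₀ (hM i).ne']

theorem inv_of_pos {a : ι → V → ℝ} (ha : Symb n x w M a) (hM : ∀ i, 0 < M i)
    {c : ℝ} (hc : 0 < c) (hlow : ∀ i, c * M i ≤ a i (x i)) :
    Symb n x w (fun i => (M i)⁻¹) fun i y => (a i y)⁻¹ :=
  comp_scaled (g := fun t => t⁻¹) (m := fun t => t⁻¹)
    (contDiffOn_inv ℝ |>.mono fun _ (ht : 0 < _) => ht.ne')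
    (fun t s _ _ => mul_inv t s) (fun _ ht => (inv_pos.2 ht).le) ha hM hc hlow

theorem sqrt {a : ι → V → ℝ} (ha : Symb n x w M a) (hM : ∀ i, 0 < M i)
    {c : ℝ} (hc : 0 < c) (hlow : ∀ i, c * M i ≤ a i (x i)) :
    Symb n x w (fun i => √(M i)) fun i y => √(a i y) :=
  comp_scaled (g := Real.sqrt) (m := Real.sqrt)
    (fun _ (ht : 0 < _) => (Real.contDiffAt_sqrt ht.ne').contDiffWithinAt)
    (fun _ s ht _ => Real.sqrt_mul ht.le s) (fun t _ => Real.sqrt_nonneg t) ha hM hc hlow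

theorem inv {a : ι → V → ℝ} (ha : Symb n x w M a) (hM : ∀ i, 0 < M i)
    {c : ℝ} (hc : 0 < c) (hlow : ∀ i, c * M i ≤ |a i (x i)|) :
    Symb n x w (fun i => (M i)⁻¹) fun i y => (a i y)⁻¹ := by
  have h1 : Symb n x w (fun i => (M i * M i)⁻¹) fun i y => (a i y * a i y)⁻¹ :=
    (ha.mul ha).inv_of_pos (fun i => mul_pos (hM i) (hM i)) (mul_pos hc hc) fun i => by
      rw [← abs_mul_abs_self (a i (x i))]
      have := hM i
      calc c * c * (M i * M i) = (c * M i) * (c * M i) := by ring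
        _ ≤ _ := mul_le_mul (hlow i) (hlow i) (by positivity) (abs_nonneg _)
  -- a⁻¹ = a (a a)⁻¹ reduces a real symbol of either sign to the positive case; the identity also
  -- holds at zeros of a, where both sides are 0.
  refine ((ha.mul h1).mono 1 (fun i => (inv_pos.2 (hM i)).le) fun i => ?_).congr fun i => ?_
  · have := (hM i).ne'
    field_simp
    rfl
  · refine Filter.Eventually.of_forall fun y => ?_
    dsimp only
    by_cases h : a i y = 0
    · simp [h]
    · field_simp

end Symb

end SymbolCalculus

/-! ### Elliptic symbols -/

section Elliptic

variable {ι V F G : Type*} [NormedAddCommGroup V] [NormedSpace ℝ V]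
  [NormedAddCommGroup F] [NormedSpace ℝ F] [NormedAddCommGroup G] [NormedSpace ℝ G]

/-- A symbol whose size at the base point is comparable to `M`. -/
structure Ell (n : ℕ) (x : ι → V) (w M : ι → ℝ) (f : ι → V → F) : Prop where
  symb : Symb n x w M f
  M_pos : ∀ i, 0 < M i
  lower : ∃ c : ℝ, 0 < c ∧ ∀ i, c * M i ≤ ‖f i (x i)‖

variable {n : ℕ} {x : ι → V} {w M M' : ι → ℝ}

namespace Ell

theorem mul {a b : ι → V → ℝ} (ha : Ell n x w M a) (hb : Ell n x w M' b) :
    Ell n x w (fun i => M i * M' i) fun i y => a i y * b i y := by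
  obtain ⟨c, hc, h1⟩ := ha.lower
  obtain ⟨d, hd, h2⟩ := hb.lower
  refine ⟨ha.symb.mul hb.symb, fun i => mul_pos (ha.M_pos i) (hb.M_pos i), c * d, by positivity,
    fun i => ?_⟩
  have := ha.M_pos i
  have := hb.M_pos i
  rw [norm_mul]
  calc c * d * (M i * M' i) = (c * M i) * (d * M' i) := by ring
    _ ≤ _ := mul_le_mul (h1 i) (h2 i) (by positivity) (norm_nonneg _)

theorem inv {a : ι → V → ℝ} (ha : Ell n x w M a) :
    Ell n x w (fun i => (M i)⁻¹) fun i y => (a i y)⁻¹ := by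
  obtain ⟨c, hc, h1⟩ := ha.lower
  obtain ⟨C, hC, h2⟩ := ha.symb.norm_le
  refine ⟨ha.symb.inv ha.M_pos hc h1, fun i => inv_pos.2 (ha.M_pos i), (C + 1)⁻¹, by positivity,
    fun i => ?_⟩
  have hM := ha.M_pos i
  have h0 : 0 < ‖a i (x i)‖ := (mul_pos hc hM).trans_le (h1 i)
  rw [norm_inv, ← mul_inv]
  refine inv_anti₀ h0 ((h2 i).trans ?_)
  gcongr
  linarith

theorem div {a b : ι → V → ℝ} (ha : Ell n x w M a) (hb : Ell n x w M' b) :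
    Ell n x w (fun i => M i / M' i) fun i y => a i y / b i y := by
  simpa only [div_eq_mul_inv] using ha.mul hb.inv

theorem of_pos_lower {a : ι → V → ℝ} (ha : Symb n x w M a) (hM : ∀ i, 0 < M i) {c : ℝ}
    (hc : 0 < c) (h : ∀ i, c * M i ≤ a i (x i)) : Ell n x w M a :=
  ⟨ha, hM, c, hc, fun i => (h i).trans (le_abs_self _)⟩

theorem resize {f : ι → V → F} (hf : Ell n x w M f) (C D : ℝ) (hM' : ∀ i, 0 < M' i)
    (h : ∀ i, M i ≤ C * M' i) (h' : ∀ i, M' i ≤ D * M i) : Ell n x w M' f := by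
  obtain ⟨c, hc, h1⟩ := hf.lower
  refine ⟨hf.symb.mono C (fun i => (hM' i).le) h, hM', c / (|D| + 1), by positivity, fun i => ?_⟩
  refine le_trans ?_ (h1 i)
  rw [div_mul_eq_mul_div, div_le_iff₀ (by positivity), mul_assoc]
  refine mul_le_mul_of_nonneg_left ((h' i).trans ?_) hc.le
  rw [mul_comm]
  refine mul_le_mul_of_nonneg_left ?_ (hf.M_pos i).le
  linarith [le_abs_self D]

end Ell

end Elliptic

/-! ### Inner, tensor and cross products of symbols. -/

theorem Symb.inner {ι V : Type*} [NormedAddCommGroup V] [NormedSpace ℝ V] {n : ℕ} {x : ι → V}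
    {w M M' : ι → ℝ} {u v : ι → V → E} (hu : Symb n x w M u) (hv : Symb n x w M' v) :
    Symb n x w (fun i => M i * M' i) fun i y => inner ℝ (u i y) (v i y) :=
  hu.bilinear (isBoundedBilinearMap_inner (𝕜 := ℝ) (E := E)).toContinuousLinearMap hv

/-- The Euclidean tensor product as a bilinear map. -/
def tensorL : E →L[ℝ] E →L[ℝ] T :=
  (LinearMap.mk₂ ℝ tensor
    (fun u u' v => by ext p; simp [tensor, add_mul])
    (fun c u v => by ext p; simp [tensor, mul_assoc])
    (fun u v v' => by ext p; simp [tensor, mul_add])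
    (fun c u v => by ext p; simp [tensor, mul_left_comm])).toContinuousBilinearMap

/-- The cross product as a bilinear map. -/
def crossL : E →L[ℝ] E →L[ℝ] E :=
  (LinearMap.mk₂ ℝ cross
    (fun u u' v => by ext p; simp [cross])
    (fun c u v => by ext p; simp [cross])
    (fun u v v' => by ext p; simp [cross])
    (fun c u v => by ext p; simp [cross])).toContinuousBilinearMap

theorem Symb.tensor {ι V : Type*} [NormedAddCommGroup V] [NormedSpace ℝ V] {n : ℕ} {x : ι → V}
    {w M M' : ι → ℝ} {u v : ι → V → E} (hu : Symb n x w M u) (hv : Symb n x w M' v) :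
    Symb n x w (fun i => M i * M' i) fun i y => tensor (u i y) (v i y) :=
  hu.bilinear tensorL hv

theorem Symb.cross {ι V : Type*} [NormedAddCommGroup V] [NormedSpace ℝ V] {n : ℕ} {x : ι → V}
    {w M M' : ι → ℝ} {u v : ι → V → E} (hu : Symb n x w M u) (hv : Symb n x w M' v) :
    Symb n x w (fun i => M i * M' i) fun i y => cross (u i y) (v i y) :=
  hu.bilinear crossL hv

/-! ### The dispersion relation -/

/-- `H'(|ξ|)/|ξ|`, so that `∇H(ξ) = hh ξ • ξ` for `ξ ≠ 0`. -/
def hh (ζ : E) : ℝ := (2 + 2 * ‖ζ‖ ^ 2) / (‖ζ‖ * jap ζ)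

theorem jap_pos (ζ : E) : 0 < jap ζ := Real.sqrt_pos.2 (by positivity)

theorem jap_sq (ζ : E) : jap ζ ^ 2 = 2 + ‖ζ‖ ^ 2 := Real.sq_sqrt (by positivity)

theorem H_nonneg (ζ : E) : 0 ≤ H ζ := mul_nonneg (norm_nonneg _) (jap_pos ζ).le

theorem hh_pos {ζ : E} (h : ζ ≠ 0) : 0 < hh ζ :=
  div_pos (by positivity) (mul_pos (norm_pos_iff.2 h) (jap_pos ζ))

theorem hasGradientAt_H {ζ : E} (h : ζ ≠ 0) : HasGradientAt H (hh ζ • ζ) ζ := by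
  have hn : HasFDerivAt (fun y : E => ‖y‖ ^ 2) (2 • (innerSL ℝ ζ)) ζ :=
    (hasStrictFDerivAt_norm_sq ζ).hasFDerivAt
  have hpos : 0 < ‖ζ‖ := norm_pos_iff.2 h
  have hJ := jap_pos ζ
  have h1 : HasFDerivAt (fun y : E => √(‖y‖ ^ 2))
      ((1 / (2 * √(‖ζ‖ ^ 2))) • (2 • (innerSL ℝ ζ))) ζ :=
    hn.sqrt (by positivity)
  have h2 : HasFDerivAt (fun y : E => √(2 + ‖y‖ ^ 2))
      ((1 / (2 * √(2 + ‖ζ‖ ^ 2))) • (2 • (innerSL ℝ ζ))) ζ :=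
    (hn.const_add 2).sqrt (by positivity)
  have h3 := h1.mul h2
  -- Writing both factors as square roots of functions of ‖y‖² allows differentiation away from the
  -- origin by the chain rule.
  have hH : H = fun y : E => √(‖y‖ ^ 2) * √(2 + ‖y‖ ^ 2) := by
    funext y
    rw [Real.sqrt_sq (norm_nonneg _)]
    rfl
  rw [hasGradientAt_iff_hasFDerivAt, hH]
  refine h3.congr_fderiv ?_
  ext v
  have e1 : √(2 + ‖ζ‖ ^ 2) = jap ζ := rfl
  simp only [Real.sqrt_sq (norm_nonneg ζ), e1, add_apply,
    smul_apply, innerSL_apply_apply, InnerProductSpace.toDual_apply_apply,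
    inner_smul_left, hh, smul_eq_mul, nsmul_eq_mul]
  have := jap_sq ζ
  simp only [RCLike.conj_to_real]
  field_simp
  push_cast
  linear_combination 2 * (inner ℝ ζ v) * this

theorem gradient_H {ζ : E} (h : ζ ≠ 0) : gradient H ζ = hh ζ • ζ := (hasGradientAt_H h).gradient

theorem hh_neg (ζ : E) : hh (-ζ) = hh ζ := by simp [hh, jap]

theorem H_sq (ζ : E) : H ζ ^ 2 = ‖ζ‖ ^ 2 * (2 + ‖ζ‖ ^ 2) := by rw [H, mul_pow, jap_sq]

/-- `H'(|ζ|)² = 4 (|ζ|² + 1/(2 + |ζ|²))`. -/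
theorem hh_mul_norm_sq {ζ : E} (h : ζ ≠ 0) :
    (hh ζ * ‖ζ‖) ^ 2 = 4 * (‖ζ‖ ^ 2 + 1 / (2 + ‖ζ‖ ^ 2)) := by
  have hpos : 0 < ‖ζ‖ := norm_pos_iff.2 h
  have hJ := jap_pos ζ
  have h2 := jap_sq ζ
  have : hh ζ * ‖ζ‖ = (2 + 2 * ‖ζ‖ ^ 2) / jap ζ := by
    rw [hh]; field_simp
  rw [this, div_pow, h2]
  field_simp
  ring

theorem hh_sq {ζ : E} (h : ζ ≠ 0) : hh ζ ^ 2 = 4 * (1 + 1 / H ζ ^ 2) := by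
  have hpos : 0 < ‖ζ‖ := norm_pos_iff.2 h
  have h1 := hh_mul_norm_sq h
  rw [H_sq]
  rw [mul_pow] at h1
  field_simp at h1 ⊢
  linear_combination h1

theorem gradXi_Φ {ξ₁ ξ₂ : E} (h : ξ₁ + ξ₂ ≠ 0) (h₁ : ξ₁ ≠ 0) :
    gradXi Φ ξ₁ ξ₂ = hh (ξ₁ + ξ₂) • (ξ₁ + ξ₂) - hh ξ₁ • ξ₁ := by
  refine HasGradientAt.gradient ?_
  have hs : HasFDerivAt (fun ξ : E => ξ - ξ₂) (ContinuousLinearMap.id ℝ E) (ξ₁ + ξ₂) :=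
    (hasFDerivAt_id _).sub_const _
  have h1 := (hasGradientAt_iff_hasFDerivAt.1 (hasGradientAt_H h))
  have h2 : HasFDerivAt H (InnerProductSpace.toDual ℝ E (hh ξ₁ • ξ₁)) (ξ₁ + ξ₂ - ξ₂) := by
    rw [add_sub_cancel_right]
    exact hasGradientAt_iff_hasFDerivAt.1 (hasGradientAt_H h₁)
  rw [hasGradientAt_iff_hasFDerivAt]
  have h3 := (h1.add_const (H ξ₂)).sub (h2.comp (f := fun ξ : E => ξ - ξ₂) (ξ₁ + ξ₂) hs)
  simp only [Φ, sub_add_cancel]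
  refine h3.congr_fderiv ?_
  rw [ContinuousLinearMap.comp_id, map_sub]

theorem gradXi₂_Φ {ξ₁ ξ₂ : E} (h₁ : ξ₁ ≠ 0) (h₂ : ξ₂ ≠ 0) :
    gradXi₂ Φ ξ₁ ξ₂ = hh ξ₂ • ξ₂ + hh ξ₁ • ξ₁ := by
  refine HasGradientAt.gradient ?_
  have hs : HasFDerivAt (fun η : E => ξ₁ + ξ₂ - η) (-ContinuousLinearMap.id ℝ E) ξ₂ :=
    (hasFDerivAt_id _).const_sub _
  have h1 := (hasGradientAt_iff_hasFDerivAt.1 (hasGradientAt_H h₂))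
  have h2 : HasFDerivAt H (InnerProductSpace.toDual ℝ E (hh ξ₁ • ξ₁)) (ξ₁ + ξ₂ - ξ₂) := by
    rw [add_sub_cancel_right]
    exact hasGradientAt_iff_hasFDerivAt.1 (hasGradientAt_H h₁)
  rw [hasGradientAt_iff_hasFDerivAt]
  have h3 := (h1.const_add (H (ξ₁ + ξ₂))).sub (h2.comp (f := fun η : E => ξ₁ + ξ₂ - η) ξ₂ hs)
  simp only [Φ, sub_add_cancel]
  refine h3.congr_fderiv ?_
  rw [ContinuousLinearMap.comp_neg, ContinuousLinearMap.comp_id, map_add, sub_neg_eq_add]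

/-! ### Symbols built from an elliptic vector field -/

section Vector

variable {ι V : Type*} [NormedAddCommGroup V] [NormedSpace ℝ V] {n : ℕ} {x : ι → V}
  {w N : ι → ℝ} {v : ι → V → E}

theorem Symb.norm_sq (hv : Symb n x w N v) :
    Symb n x w (fun i => N i ^ 2) fun i y => ‖v i y‖ ^ 2 := by
  simpa only [real_inner_self_eq_norm_sq, ← sq] using hv.inner hv

/-- |v| is the square root of |v|², and ellipticity keeps |v|² in the range where the square root is
smooth. -/
theorem Ell.norm (hv : Ell n x w N v) : Ell n x w N fun i y => ‖v i y‖ := by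
  obtain ⟨c, hc, h⟩ := hv.lower
  have h1 := hv.symb.norm_sq.sqrt (c := c ^ 2) (fun i => by have := hv.M_pos i; positivity)
    (by positivity) fun i => by
      rw [← mul_pow]
      exact pow_le_pow_left₀ (mul_nonneg hc.le (hv.M_pos i).le) (h i) 2
  simp only [Real.sqrt_sq (hv.M_pos _).le, Real.sqrt_sq (norm_nonneg _)] at h1
  exact .of_pos_lower h1 hv.M_pos hc h

theorem Ell.two_add_norm_sq (hv : Ell n x w N v) :
    Ell n x w (fun i => (1 + N i) ^ 2) fun i y => 2 + ‖v i y‖ ^ 2 := by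
  obtain ⟨c, hc, h⟩ := hv.lower
  have hN := hv.M_pos
  have h1 := hv.symb.norm_sq.mono (M' := fun i => (1 + N i) ^ 2) 1 (fun i => by positivity)
    fun i => by nlinarith [hN i]
  have h2 : Symb n x w (fun i => (1 + N i) ^ 2) fun _ _ => (2 : ℝ) :=
    Symb.of_const hv.symb.w_nonneg 2 (fun i => by positivity) fun i => by
      rw [Real.norm_of_nonneg zero_le_two]
      nlinarith [hN i]
  refine .of_pos_lower (h2.add h1) (fun i => by have := hN i; positivity) (c := min 1 (c ^ 2 / 2))
    (by positivity) fun i => ?_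
  have h3 : (c * N i) ^ 2 ≤ ‖v i (x i)‖ ^ 2 :=
    pow_le_pow_left₀ (mul_nonneg hc.le (hN i).le) (h i) 2
  have h4 : (1 + N i) ^ 2 ≤ 2 + 2 * N i ^ 2 := by nlinarith [sq_nonneg (1 - N i)]
  have hm : 0 ≤ min 1 (c ^ 2 / 2) := by positivity
  calc min 1 (c ^ 2 / 2) * (1 + N i) ^ 2 ≤ min 1 (c ^ 2 / 2) * (2 + 2 * N i ^ 2) := by gcongr
    _ = min 1 (c ^ 2 / 2) * 2 + min 1 (c ^ 2 / 2) * (2 * N i ^ 2) := by ring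
    _ ≤ 1 * 2 + c ^ 2 / 2 * (2 * N i ^ 2) := by
        gcongr
        exacts [min_le_left _ _, min_le_right _ _]
    _ ≤ _ := by nlinarith

theorem Ell.jap (hv : Ell n x w N v) : Ell n x w (fun i => 1 + N i) fun i y => jap (v i y) := by
  obtain ⟨c, hc, h⟩ := hv.two_add_norm_sq.lower
  have hN := hv.M_pos
  have h' : ∀ i, c * (1 + N i) ^ 2 ≤ 2 + ‖v i (x i)‖ ^ 2 := fun i => by
    have := h i
    rwa [Real.norm_of_nonneg (by positivity)] at this
  have h1 := hv.two_add_norm_sq.symb.sqrt hv.two_add_norm_sq.M_pos hc h'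
  have hs : ∀ i, √((1 + N i) ^ 2) = 1 + N i := fun i => Real.sqrt_sq (by linarith [hN i])
  simp only [hs] at h1
  refine .of_pos_lower h1 (fun i => by linarith [hN i]) (c := √c) (Real.sqrt_pos.2 hc) fun i => ?_
  rw [← hs i, ← Real.sqrt_mul hc.le]
  exact Real.sqrt_le_sqrt (h' i)

theorem Ell.H (hv : Ell n x w N v) :
    Ell n x w (fun i => N i * (1 + N i)) fun i y => H (v i y) :=
  hv.norm.mul hv.jap

theorem Ell.hh (hv : Ell n x w N v) :
    Ell n x w (fun i => (1 + N i) / N i) fun i y => hh (v i y) := by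
  have hN := hv.M_pos
  have h1 : Ell n x w (fun i => (1 + N i) ^ 2) fun i y => 2 + 2 * ‖v i y‖ ^ 2 := by
    have h2 : Symb n x w (fun i => (1 + N i) ^ 2) fun i y => ‖v i y‖ ^ 2 :=
      hv.symb.norm_sq.mono 1 (fun i => by positivity) fun i => by nlinarith [hN i]
    obtain ⟨c, hc, h⟩ := hv.two_add_norm_sq.lower
    refine .of_pos_lower ((hv.two_add_norm_sq.symb.add h2).congr fun i => ?_)
      hv.two_add_norm_sq.M_pos hc fun i => (h i).trans ?_
    · exact Filter.Eventually.of_forall fun y => by ring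
    · rw [Real.norm_of_nonneg (by positivity)]
      nlinarith [sq_nonneg ‖v i (x i)‖]
  refine (h1.div hv.H).resize 1 1 (fun i => by have := hN i; positivity) (fun i => ?_) fun i => ?_
  all_goals
    have := hN i
    have : 0 < 1 + N i := by linarith
    refine le_of_eq ?_
    field_simp

theorem Ell.gradH (hv : Ell n x w N v) :
    Symb n x w (fun i => 1 + N i) fun i y => CubicQuintic.hh (v i y) • v i y :=
  (hv.hh.symb.smul hv.symb).mono 1 (fun i => by linarith [hv.M_pos i]) fun i => by
    have := hv.M_pos i
    refine le_of_eq ?_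
    field_simp

theorem Ell.unit (hv : Ell n x w N v) : Symb n x w (fun _ => 1) fun i y => unit (v i y) :=
  (hv.norm.inv.symb.smul hv.symb).mono 1 (fun _ => zero_le_one) fun i => by
    rw [inv_mul_cancel₀ (hv.M_pos i).ne', one_mul]

end Vector

/-! ### Bounding the norm of smooth compactly supported symbols -/

section SobolevBounds

variable {F : Type*} [NormedAddCommGroup F] [NormedSpace ℝ F]

theorem integral_fderiv_smul_eq_neg {g : E → ℝ} {f : E → F} (hg : ContDiff ℝ 1 g)
    (hgc : HasCompactSupport g) (hf : ContDiff ℝ 1 f) (v : E) :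
    ∫ x, fderiv ℝ g x v • f x = -∫ x, g x • fderiv ℝ f x v := by
  have hg' : Continuous fun x => fderiv ℝ g x v :=
    (hg.continuous_fderiv one_ne_zero).clm_apply continuous_const
  have hf' : Continuous fun x => fderiv ℝ f x v :=
    (hf.continuous_fderiv one_ne_zero).clm_apply continuous_const
  have h := integral_smul_fderiv_eq_neg_fderiv_smul_of_integrable (μ := volume) (f := g) (g := f)
    (v := v)
    ((hg'.smul hf.continuous).integrable_of_hasCompactSupport ((hgc.fderiv_apply ℝ v).smul_right))
    ((hg.continuous.smul hf').integrable_of_hasCompactSupport hgc.smul_right)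
    ((hg.continuous.smul hf.continuous).integrable_of_hasCompactSupport hgc.smul_right)
    (fun x _ => hg.differentiable one_ne_zero x) (fun x _ => hf.differentiable one_ne_zero x)
  rw [h, neg_neg]

theorem isWeakDeriv_one {f : E → F} (hf : ContDiff ℝ ∞ f) :
    IsWeakDeriv 1 f fun α x => fderiv ℝ f x (e (α 0)) := by
  refine ⟨hf.continuous.locallyIntegrable, fun α => ⟨?_, fun g hg hgc => ?_⟩⟩
  · exact ((hf.continuous_fderiv (by simp)).clm_apply continuous_const).locallyIntegrable
  · simp only [iteratedFDeriv_one_apply]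
    rw [integral_fderiv_smul_eq_neg (hg.of_le (by simp)) hgc (hf.of_le (by simp))]
    simp

/-- Two integrations by parts move the outer derivative first, so the two directions appear on f in
reversed order; in this form no symmetry of second derivatives is needed. -/
theorem isWeakDeriv_two {f : E → F} (hf : ContDiff ℝ ∞ f) :
    IsWeakDeriv 2 f fun α x => fderiv ℝ (fderiv ℝ f) x (e (α 1)) (e (α 0)) := by
  have hd : ∀ v : E, ContDiff ℝ ∞ fun x => fderiv ℝ f x v := fun v =>
    (hf.fderiv_right (m := ∞) (by simp)).clm_apply contDiff_const
  have hdd : ∀ v v' x : E, fderiv ℝ (fun y => fderiv ℝ f y v) x v' =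
      fderiv ℝ (fderiv ℝ f) x v' v := fun v v' x => by
    rw [fderiv_clm_apply ((hf.fderiv_right (m := ∞) (by simp)).differentiable (by simp) x)
      (differentiableAt_const v)]
    simp
  refine ⟨hf.continuous.locallyIntegrable, fun α => ⟨?_, fun g hg hgc => ?_⟩⟩
  · have := ((hd (e (α 0))).continuous_fderiv (by simp)).clm_apply
      (continuous_const (y := e (α 1)))
    simp only [hdd] at this
    exact this.locallyIntegrable
  · have hgd : ContDiff ℝ ∞ fun x => fderiv ℝ g x (e (α 1)) :=
      (hg.fderiv_right (m := ∞) (by simp)).clm_apply contDiff_const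
    have h1 : ∀ x, iteratedFDeriv ℝ 2 g x (fun j => e (α j)) =
        fderiv ℝ (fun y => fderiv ℝ g y (e (α 1))) x (e (α 0)) := fun x => by
      rw [iteratedFDeriv_two_apply,
        fderiv_clm_apply ((hg.fderiv_right (m := ∞) (by simp)).differentiable (by simp) x)
        (differentiableAt_const _)]
      simp
    simp only [h1]
    rw [integral_fderiv_smul_eq_neg (hgd.of_le (by simp)) (hgc.fderiv_apply ℝ _)
      (hf.of_le (by simp)),
      integral_fderiv_smul_eq_neg (hg.of_le (by simp)) hgc ((hd _).of_le (by simp))]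
    simp [hdd]

theorem norm_e (k : Fin 3) : ‖e k‖ = 1 := by simp [e]

/-- There are 3^s ≤ 9 components of order s ≤ 2, each bounded by the operator norm of the s-th
derivative; this is the source of the factor 3. -/
theorem hdotNorm_le {s : ℕ} {f : E → F} {D : (Fin s → Fin 3) → E → F} (hD : IsWeakDeriv s f D)
    (hs : s ≤ 2) (hle : ∀ α x, ‖D α x‖ ≤ ‖iteratedFDeriv ℝ s f x‖) {B : ℝ} (hB : 0 ≤ B)
    (hint : ∫⁻ x, ‖iteratedFDeriv ℝ s f x‖ₑ ^ 2 ≤ ENNReal.ofReal (B ^ 2)) :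
    hdotNorm s f ≤ ENNReal.ofReal (3 * B) := by
  refine (iInf₂_le D hD).trans ?_
  have h1 : ∀ α, eLpNorm (D α) 2 volume ^ 2 ≤ ENNReal.ofReal (B ^ 2) := fun α => by
    refine le_trans ?_ hint
    have := eLpNorm_nnreal_pow_eq_lintegral (f := D α) (μ := (volume : Measure E)) (p := 2)
      two_ne_zero
    simp only [NNReal.coe_ofNat, ENNReal.coe_ofNat, ENNReal.rpow_ofNat] at this
    rw [this]
    refine lintegral_mono fun x => ?_
    gcongr
    exact enorm_le_iff_norm_le.2 (hle α x)
  have h2 : ∑ α, eLpNorm (D α) 2 volume ^ 2 ≤ ENNReal.ofReal ((3 * B) ^ 2) := by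
    calc ∑ α, eLpNorm (D α) 2 volume ^ 2 ≤ ∑ _α : Fin s → Fin 3, ENNReal.ofReal (B ^ 2) :=
          Finset.sum_le_sum fun α _ => h1 α
      _ = ENNReal.ofReal (3 ^ s * B ^ 2) := by
          rw [Finset.sum_const, nsmul_eq_mul, ENNReal.ofReal_mul (by positivity)]
          congr 1
          simp [ENNReal.ofReal_pow]
      _ ≤ _ := by
          refine ENNReal.ofReal_le_ofReal ?_
          rw [mul_pow]
          gcongr
          norm_num
  calc _ ≤ ENNReal.ofReal ((3 * B) ^ 2) ^ (1 / 2 : ℝ) := by gcongr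
    _ = ENNReal.ofReal (3 * B) := by
        rw [ENNReal.ofReal_rpow_of_nonneg (by positivity) (by norm_num), ← Real.sqrt_eq_rpow,
          Real.sqrt_sq (by positivity)]

theorem hdotNorm_one_le {f : E → F} (hf : ContDiff ℝ ∞ f) {B : ℝ} (hB : 0 ≤ B)
    (hint : ∫⁻ x, ‖iteratedFDeriv ℝ 1 f x‖ₑ ^ 2 ≤ ENNReal.ofReal (B ^ 2)) :
    hdotNorm 1 f ≤ ENNReal.ofReal (3 * B) := by
  refine hdotNorm_le (isWeakDeriv_one hf) one_le_two (fun α x => ?_) hB hint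
  have := (iteratedFDeriv ℝ 1 f x).le_opNorm fun _ => e (α 0)
  simpa [iteratedFDeriv_one_apply, norm_e] using this

theorem hdotNorm_two_le {f : E → F} (hf : ContDiff ℝ ∞ f) {B : ℝ} (hB : 0 ≤ B)
    (hint : ∫⁻ x, ‖iteratedFDeriv ℝ 2 f x‖ₑ ^ 2 ≤ ENNReal.ofReal (B ^ 2)) :
    hdotNorm 2 f ≤ ENNReal.ofReal (3 * B) := by
  refine hdotNorm_le (isWeakDeriv_two hf) le_rfl (fun α x => ?_) hB hint
  have := (iteratedFDeriv ℝ 2 f x).le_opNorm ![e (α 1), e (α 0)]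
  simpa [iteratedFDeriv_two_apply, norm_e, Fin.prod_univ_two] using this

/-- Only the ξ₂ branch of the minimum is used. The essential supremum makes ξ = 0, where the symbols
may be singular, irrelevant. -/
theorem symbNorm_le {b : E → E → F} {B₁ B₂ : ℝ} (h1 : 0 ≤ B₁) (h2 : 0 ≤ B₂)
    (hb : ∀ ξ : E, ξ ≠ 0 → ContDiff ℝ ∞ (fun η => b (ξ - η) η) ∧
      ∫⁻ x, ‖iteratedFDeriv ℝ 1 (fun η => b (ξ - η) η) x‖ₑ ^ 2 ≤ ENNReal.ofReal (B₁ ^ 2) ∧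
      ∫⁻ x, ‖iteratedFDeriv ℝ 2 (fun η => b (ξ - η) η) x‖ₑ ^ 2 ≤ ENNReal.ofReal (B₂ ^ 2)) :
    symbNorm b ≤ ENNReal.ofReal (3 * √(B₁ * B₂)) := by
  have hne : ∀ᵐ ξ : E, ξ ≠ 0 := by simp [ae_iff]
  have k1 : linftyHdot₂ 1 b ≤ ENNReal.ofReal (3 * B₁) := essSup_le_of_ae_le _ <| by
    filter_upwards [hne] with ξ hξ
    exact hdotNorm_one_le (hb ξ hξ).1 h1 (hb ξ hξ).2.1
  have k2 : linftyHdot₂ 2 b ≤ ENNReal.ofReal (3 * B₂) := essSup_le_of_ae_le _ <| by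
    filter_upwards [hne] with ξ hξ
    exact hdotNorm_two_le (hb ξ hξ).1 h2 (hb ξ hξ).2.2
  refine (min_le_right _ _).trans ?_
  calc _ ≤ ENNReal.ofReal (3 * B₁) ^ (1 / 2 : ℝ) * ENNReal.ofReal (3 * B₂) ^ (1 / 2 : ℝ) := by
        gcongr
    _ = ENNReal.ofReal (3 * √(B₁ * B₂)) := by
        rw [← ENNReal.mul_rpow_of_nonneg _ _ (by norm_num), ← ENNReal.ofReal_mul (by positivity),
          ENNReal.ofReal_rpow_of_nonneg (by positivity) (by norm_num), ← Real.sqrt_eq_rpow,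
          show 3 * B₁ * (3 * B₂) = 3 ^ 2 * (B₁ * B₂) by ring, Real.sqrt_mul (by positivity),
          Real.sqrt_sq (by positivity)]

theorem symbNorm_zero : symbNorm (0 : E → E → F) = 0 := by
  have h := symbNorm_le (b := (0 : E → E → F)) le_rfl le_rfl fun ξ _ => by
    refine ⟨contDiff_const, ?_, ?_⟩
    · rw [show (fun η => (0 : E → E → F) (ξ - η) η) = 0 from rfl]
      simp
    · rw [show (fun η => (0 : E → E → F) (ξ - η) η) = 0 from rfl]
      simp
  simpa using h

end SobolevBounds

/-! ### Volume of spherical caps -/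

/-- Let c be the cosine of the angle to u. From 1 - c² ≤ 2(1 + c) ≤ 2t the component orthogonal to u
is at most ρ√(2t), so the cap lies in a box of volume 2ρ · (2ρ√(2t))² = 16ρ³t. -/
theorem volume_cap_le {u : E} (hu : ‖u‖ = 1) {ρ t : ℝ} (hρ : 0 ≤ ρ) (ht : 0 ≤ t) :
    volume {x : E | ‖x‖ ≤ ρ ∧ 1 + inner ℝ u (unit x) ≤ t} ≤ ENNReal.ofReal (16 * ρ ^ 3 * t) := by
  obtain ⟨b, hb⟩ := Orthonormal.exists_orthonormalBasis_extension_of_card_eq (𝕜 := ℝ) (E := E)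
    (ι := Fin 3) (by simp) (v := fun _ => u) (s := {0}) (by
      rw [orthonormal_iff_ite]
      rintro ⟨i, hi⟩ ⟨j, hj⟩
      simp only [Set.mem_singleton_iff] at hi hj
      subst hi hj
      simp [hu])
  have hb0 : b 0 = u := hb 0 rfl
  let r : Fin 3 → ℝ := ![ρ, ρ * √(2 * t), ρ * √(2 * t)]
  have hmp : MeasurePreserving (fun x : E => (b.repr x).ofLp) :=
    (PiLp.volume_preserving_ofLp (Fin 3)).comp b.measurePreserving_repr
  have hsub : {x : E | ‖x‖ ≤ ρ ∧ 1 + inner ℝ u (unit x) ≤ t} ⊆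
      (fun x : E => (b.repr x).ofLp) ⁻¹' Set.Icc (-r) r := by
    rintro x ⟨hx, hxt⟩
    have hn : ‖x‖ ^ 2 = (b.repr x 0) ^ 2 + (b.repr x 1) ^ 2 + (b.repr x 2) ^ 2 := by
      rw [← b.repr.norm_map x, EuclideanSpace.norm_sq_eq, Fin.sum_univ_three]
      simp
    have h0 : b.repr x 0 = ‖x‖ * inner ℝ u (unit x) := by
      rw [b.repr_apply_apply, hb0, unit, inner_smul_right]
      by_cases h : x = 0
      · simp [h]
      · have := norm_ne_zero_iff.2 h
        field_simp
    have hν : 0 ≤ 1 + inner ℝ u (unit x) := by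
      have h1 := abs_real_inner_le_norm u (unit x)
      have h2 : ‖unit x‖ ≤ 1 := by
        rw [unit, norm_smul, norm_inv, norm_norm]
        exact inv_mul_le_one
      rw [hu, one_mul] at h1
      linarith [neg_le_of_abs_le (h1.trans h2)]
    have hx0 := norm_nonneg x
    have hρx : ‖x‖ ^ 2 ≤ ρ ^ 2 := pow_le_pow_left₀ hx0 hx 2
    have hrest : (b.repr x 1) ^ 2 + (b.repr x 2) ^ 2 ≤ ρ ^ 2 * (2 * t) := by
      have e1 : (b.repr x 1) ^ 2 + (b.repr x 2) ^ 2 =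
          ‖x‖ ^ 2 * (1 - inner ℝ u (unit x) ^ 2) := by
        rw [h0] at hn
        linear_combination -hn
      rw [e1]
      refine (mul_le_mul_of_nonneg_left ?_ (sq_nonneg ‖x‖)).trans
        (mul_le_mul_of_nonneg_right hρx (by positivity : 0 ≤ 2 * t))
      nlinarith [sq_nonneg (1 + inner ℝ u (unit x))]
    have habs : ∀ i, |b.repr x i| ≤ r i := by
      intro i
      fin_cases i
      · refine abs_le_of_sq_le_sq ?_ hρ
        change (b.repr x 0) ^ 2 ≤ ρ ^ 2
        nlinarith [sq_nonneg (b.repr x 1), sq_nonneg (b.repr x 2)]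
      · refine abs_le_of_sq_le_sq ?_ (mul_nonneg hρ (Real.sqrt_nonneg _))
        change (b.repr x 1) ^ 2 ≤ (ρ * √(2 * t)) ^ 2
        rw [mul_pow, Real.sq_sqrt (by positivity)]
        nlinarith [sq_nonneg (b.repr x 2)]
      · refine abs_le_of_sq_le_sq ?_ (mul_nonneg hρ (Real.sqrt_nonneg _))
        change (b.repr x 2) ^ 2 ≤ (ρ * √(2 * t)) ^ 2
        rw [mul_pow, Real.sq_sqrt (by positivity)]
        nlinarith [sq_nonneg (b.repr x 1)]
    exact ⟨fun i => neg_le_of_abs_le (habs i), fun i => le_of_abs_le (habs i)⟩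
  refine (measure_mono hsub).trans ?_
  rw [hmp.measure_preimage measurableSet_Icc.nullMeasurableSet, Real.volume_Icc_pi,
    Fin.prod_univ_three]
  have h2 : 0 ≤ 2 * t := by positivity
  simp only [r, Pi.neg_apply, sub_neg_eq_add]
  rw [← ENNReal.ofReal_mul (by simpa using hρ), ← ENNReal.ofReal_mul (by simp; positivity)]
  refine ENNReal.ofReal_le_ofReal (le_of_eq ?_)
  simp only [Matrix.cons_val_zero, Matrix.cons_val_one, Matrix.cons_val]
  linear_combination 8 * ρ ^ 3 * Real.sq_sqrt h2

/-- Decompose according to 1 + c + δ² ∼ 4ᵏδ². By the cap bound the k-th shell contributes at most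
64ρ³δ^{-2s}4^{-ks}; for s ≥ 1 this is summable, while s = 0 would diverge logarithmically. -/
theorem lintegral_cap_le {u : E} (hu : ‖u‖ = 1) {ρ δ : ℝ} (hρ : 0 < ρ) (hδ : 0 < δ) {s : ℕ}
    (hs : 1 ≤ s) :
    ∫⁻ x in Metric.closedBall (0 : E) ρ,
        ENNReal.ofReal (((1 + inner ℝ u (unit x) + δ ^ 2)⁻¹) ^ (s + 1)) ≤
      ENNReal.ofReal (128 * ρ ^ 3 * (δ⁻¹) ^ (2 * s)) := by
  let S : ℕ → Set E := fun k => {x : E | ‖x‖ ≤ ρ ∧ 1 + inner ℝ u (unit x) ≤ 4 ^ (k + 1) * δ ^ 2}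
  have hcont : ∀ k, MeasurableSet (S k) := by
    intro k
    have hm : Measurable (unit : E → E) := by
      unfold unit
      fun_prop
    have : Measurable fun x : E => 1 + inner ℝ u (unit x) := by fun_prop
    exact (measurableSet_le measurable_norm measurable_const).inter
      (measurableSet_le this measurable_const)
  let a : ℕ → ℝ≥0∞ := fun k => ENNReal.ofReal (((4 ^ k * δ ^ 2)⁻¹) ^ (s + 1))
  have hpt : ∀ x ∈ Metric.closedBall (0 : E) ρ,
      ENNReal.ofReal (((1 + inner ℝ u (unit x) + δ ^ 2)⁻¹) ^ (s + 1)) ≤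
        ∑' k, (S k).indicator (fun _ => a k) x := by
    intro x hx
    have hν : 0 ≤ 1 + inner ℝ u (unit x) := by
      have h1 := abs_real_inner_le_norm u (unit x)
      have h2 : ‖unit x‖ ≤ 1 := by
        rw [unit, norm_smul, norm_inv, norm_norm]
        exact inv_mul_le_one
      rw [hu, one_mul] at h1
      linarith [neg_le_of_abs_le (h1.trans h2)]
    set ν := 1 + inner ℝ u (unit x) with hνd
    have hδ2 : 0 < δ ^ 2 := by positivity
    obtain ⟨k, hk1, hk2⟩ := exists_nat_pow_near (x := (ν + δ ^ 2) / δ ^ 2) (y := (4 : ℝ))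
      ((one_le_div hδ2).2 (by linarith)) (by norm_num)
    rw [le_div_iff₀ hδ2] at hk1
    rw [div_lt_iff₀ hδ2] at hk2
    refine le_trans ?_ (ENNReal.le_tsum k)
    rw [Set.indicator_of_mem (show x ∈ S k from
      ⟨by simpa using hx, by rw [← hνd]; linarith⟩)]
    refine ENNReal.ofReal_le_ofReal ?_
    gcongr
  calc _ ≤ ∫⁻ x in Metric.closedBall (0 : E) ρ, ∑' k, (S k).indicator (fun _ => a k) x :=
        setLIntegral_mono' measurableSet_closedBall hpt
    _ ≤ ∫⁻ x, ∑' k, (S k).indicator (fun _ => a k) x := setLIntegral_le_lintegral _ _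
    _ = ∑' k, a k * volume (S k) := by
        rw [lintegral_tsum fun k => (measurable_const.indicator (hcont k)).aemeasurable]
        exact tsum_congr fun k => lintegral_indicator_const (hcont k) _
    _ ≤ ∑' k, ENNReal.ofReal (64 * ρ ^ 3 * (δ⁻¹) ^ (2 * s) * (1 / 2) ^ k) := by
        refine ENNReal.tsum_le_tsum fun k => ?_
        refine (mul_le_mul_right (volume_cap_le hu hρ.le (by positivity)) _).trans ?_
        rw [← ENNReal.ofReal_mul (by positivity)]
        refine ENNReal.ofReal_le_ofReal ?_
        have e1 : ((4 ^ k * δ ^ 2 : ℝ)⁻¹) ^ (s + 1) * (16 * ρ ^ 3 * (4 ^ (k + 1) * δ ^ 2)) =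
            64 * ρ ^ 3 * (δ⁻¹) ^ (2 * s) * ((4 ^ k)⁻¹) ^ s := by
          have hq : (4 ^ k * δ ^ 2 : ℝ)⁻¹ * (4 ^ k * δ ^ 2) = 1 := inv_mul_cancel₀ (by positivity)
          have e2 : ((4 ^ k * δ ^ 2 : ℝ)⁻¹) ^ s = ((4 ^ k)⁻¹) ^ s * (δ⁻¹) ^ (2 * s) := by
            rw [mul_inv, mul_pow, pow_mul, inv_pow δ]
          rw [pow_succ (4 : ℝ) k, pow_succ (_⁻¹), e2]
          linear_combination 64 * ρ ^ 3 * (((4 ^ k : ℝ)⁻¹) ^ s * (δ⁻¹) ^ (2 * s)) * hq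
        rw [e1]
        gcongr
        calc ((4 ^ k : ℝ)⁻¹) ^ s ≤ (4 ^ k : ℝ)⁻¹ :=
              pow_le_of_le_one (by positivity) (inv_le_one_of_one_le₀
                (one_le_pow₀ (by norm_num))) (by omega)
          _ = (1 / 4) ^ k := by rw [one_div, inv_pow]
          _ ≤ (1 / 2) ^ k := by gcongr; norm_num
    _ = ENNReal.ofReal (128 * ρ ^ 3 * (δ⁻¹) ^ (2 * s)) := by
        rw [← ENNReal.ofReal_tsum_of_nonneg (fun k => by positivity)
          (summable_geometric_two.mul_left _), tsum_mul_left, tsum_geometric_two]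
        congr 1
        ring

/-- The cosine of the angle between `ξ` and `η`. -/
def mu (ξ η : E) : ℝ := inner ℝ (unit ξ) (unit η)

/-! ### From pointwise symbol bounds to the norm of a symbol -/

section Uniform

variable {F : Type*} [NormedAddCommGroup F] [NormedSpace ℝ F] {B : Type*}

/-- Parameters `(β, ξ, ξ₂)` with `ξ ≠ 0` that satisfy `good`. -/
abbrev GoodPt (good : B → E → E → Prop) : Type _ :=
  {p : B × E × E // p.2.1 ≠ 0 ∧ good p.1 p.2.1 p.2.2}

/-- The slice `ξ₂ ↦ b (ξ - ξ₂, ξ₂)` of a symbol. -/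
def slice (b : E → E → F) (ξ η : E) : F := b (ξ - η) η

/-- Passes from bounds at base points to whole slices: every ξ₂ is either a good base point or has a
neighbourhood on which the slice vanishes. -/
theorem slice_contDiff_and_bound {good : B → E → E → Prop} {b : B → E → E → F}
    {w M : GoodPt good → ℝ}
    (hs : Symb 2 (fun p : GoodPt good => p.1.2.2) w M fun p => slice (b p.1.1) p.1.2.1)
    (hz : ∀ β ξ η, ξ ≠ 0 → ¬ good β ξ η → slice (b β) ξ =ᶠ[nhds η] 0) :
    (∀ β ξ, ξ ≠ 0 → ContDiff ℝ ∞ (slice (b β) ξ)) ∧ ∃ C : ℝ, 0 < C ∧ ∀ β ξ η, ξ ≠ 0 → ∀ k ≤ 2,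
      (¬ good β ξ η → iteratedFDeriv ℝ k (slice (b β) ξ) η = 0) ∧
      ∀ p : GoodPt good, p.1 = (β, ξ, η) →
        ‖iteratedFDeriv ℝ k (slice (b β) ξ) η‖ ≤ C * (M p * w p ^ k) := by
  obtain ⟨C, hC, hb⟩ := hs.bound
  refine ⟨fun β ξ hξ => contDiff_iff_contDiffAt.2 fun η => ?_, C + 1, by positivity,
    fun β ξ η hξ k hk => ⟨fun hg => ?_, fun p hp => ?_⟩⟩
  · by_cases hg : good β ξ η
    · exact hs.contDiffAt ⟨(β, ξ, η), hξ, hg⟩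
    · exact contDiffAt_const.congr_of_eventuallyEq (hz β ξ η hξ hg)
  · rw [((hz β ξ η hξ hg).iteratedFDeriv ℝ k).eq_of_nhds]
    rcases k with _ | k
    · ext; simp
    · exact congrFun (iteratedFDeriv_succ_const (𝕜 := ℝ) k (0 : F)) η
  · have h := hb p k hk
    have h0 : 0 ≤ M p * w p ^ k := mul_nonneg (hs.M_nonneg p) (pow_nonneg (hs.w_nonneg p) k)
    rw [hp] at h
    exact h.trans (mul_le_mul_of_nonneg_right (by linarith) h0)

/-- The k-th derivative has L² norm ≲ M R^{-k} R^{3/2}; in the geometric mean of k = 1 and k = 2 the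
powers of R cancel. -/
theorem symbNorm_le_of_ball {good : B → E → E → Prop} {b : B → E → E → F} {M R : B → ℝ}
    (hM : ∀ β, 0 ≤ M β) (hR : ∀ β, 0 < R β) {z : B → E → E} {C₀ : ℝ}
    (hs : Symb 2 (fun p : GoodPt good => p.1.2.2) (fun p => (R p.1.1)⁻¹) (fun p => M p.1.1)
      fun p => slice (b p.1.1) p.1.2.1)
    (hz : ∀ β ξ η, ξ ≠ 0 → ¬ good β ξ η → slice (b β) ξ =ᶠ[nhds η] 0)
    (hball : ∀ β ξ η, good β ξ η → ‖η - z β ξ‖ ≤ C₀ * R β) :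
    ∃ C : ℝ, 0 < C ∧ ∀ β, symbNorm (b β) ≤ ENNReal.ofReal (C * M β) := by
  obtain ⟨hcd, C, hC, hb⟩ := slice_contDiff_and_bound hs hz
  set V : ℝ := (volume (Metric.ball (0 : E) 1)).toReal with hV
  have hVt : volume (Metric.ball (0 : E) 1) = ENNReal.ofReal V :=
    (ENNReal.ofReal_toReal measure_ball_lt_top.ne).symm
  have hV0 : 0 ≤ V := ENNReal.toReal_nonneg
  set D := |C₀| with hD
  have hD0 : 0 ≤ D := abs_nonneg _
  refine ⟨3 * (C * √(D ^ 3 * V)) + 1, by positivity, fun β => ?_⟩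
  have hRβ := hR β
  have hMβ := hM β
  set K := √((D * R β) ^ 3 * V) with hK
  have hK2 : K ^ 2 = (D * R β) ^ 3 * V := Real.sq_sqrt (by positivity)
  have hint : ∀ ξ : E, ξ ≠ 0 → ∀ k ≤ 2,
      ∫⁻ x, ‖iteratedFDeriv ℝ k (slice (b β) ξ) x‖ₑ ^ 2 ≤
        ENNReal.ofReal ((C * (M β * (R β)⁻¹ ^ k) * K) ^ 2) := by
    intro ξ hξ k hk
    set a := C * (M β * (R β)⁻¹ ^ k) with ha
    have ha0 : 0 ≤ a := by positivity
    have hpt : ∀ x, ‖iteratedFDeriv ℝ k (slice (b β) ξ) x‖ₑ ^ 2 ≤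
        (Metric.closedBall (z β ξ) (D * R β)).indicator (fun _ => ENNReal.ofReal (a ^ 2)) x := by
      intro x
      by_cases hg : good β ξ x
      · rw [Set.indicator_of_mem]
        · rw [ENNReal.ofReal_pow ha0, ← ofReal_norm]
          gcongr
          exact (hb β ξ x hξ k hk).2 ⟨(β, ξ, x), hξ, hg⟩ rfl
        · rw [mem_closedBall_iff_norm]
          exact (hball β ξ x hg).trans (mul_le_mul_of_nonneg_right (le_abs_self _) hRβ.le)
      · rw [(hb β ξ x hξ k hk).1 hg]
        simp
    refine (lintegral_mono hpt).trans ?_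
    rw [lintegral_indicator_const measurableSet_closedBall,
      Measure.addHaar_closedBall _ _ (by positivity), hVt, ← ENNReal.ofReal_mul (by positivity),
      ← ENNReal.ofReal_mul (by positivity), mul_pow a K, hK2]
    simp
  refine (symbNorm_le (B₁ := C * (M β * (R β)⁻¹ ^ 1) * K) (B₂ := C * (M β * (R β)⁻¹ ^ 2) * K)
    (by positivity) (by positivity) fun ξ hξ => ⟨hcd β ξ hξ, hint ξ hξ 1 one_le_two,
      hint ξ hξ 2 le_rfl⟩).trans (ENNReal.ofReal_le_ofReal ?_)
  have e1 : C * (M β * (R β)⁻¹ ^ 1) * K * (C * (M β * (R β)⁻¹ ^ 2) * K) =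
      (C * M β) ^ 2 * (D ^ 3 * V) := by
    calc _ = (C * M β) ^ 2 * (R β)⁻¹ ^ 3 * K ^ 2 := by ring
      _ = _ := by
        rw [hK2]
        field_simp
  rw [e1, Real.sqrt_mul (by positivity), Real.sqrt_sq (by positivity)]
  nlinarith

/-- With ν = 1 + μ + N₁² the hypothesis gives |∂ᵏb|² ≲ M² N₂^{-2k} ν^{-(k+1)}, whose integral over
the ball is ≲ M² N₂^{3-2k} N₁^{-2k} by `lintegral_cap_le`. In the geometric mean of k = 1 and k = 2
the powers of N₂ cancel and N₁^{-3/2} remains. -/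
theorem symbNorm_le_of_cap {good : B → E → E → Prop} {b : B → E → E → F} {M N₁ N₂ : B → ℝ}
    (hM : ∀ β, 0 ≤ M β) (hN₁ : ∀ β, 0 < N₁ β) (hN₂ : ∀ β, 0 < N₂ β) {C₀ : ℝ}
    (hs : Symb 2 (fun p : GoodPt good => p.1.2.2)
      (fun p => (N₂ p.1.1 * √(1 + mu p.1.2.1 p.1.2.2 + N₁ p.1.1 ^ 2))⁻¹)
      (fun p => M p.1.1 * (√(1 + mu p.1.2.1 p.1.2.2 + N₁ p.1.1 ^ 2))⁻¹)
      fun p => slice (b p.1.1) p.1.2.1)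
    (hz : ∀ β ξ η, ξ ≠ 0 → ¬ good β ξ η → slice (b β) ξ =ᶠ[nhds η] 0)
    (hball : ∀ β ξ η, good β ξ η → ‖η‖ ≤ C₀ * N₂ β) :
    ∃ C : ℝ, 0 < C ∧ ∀ β, symbNorm (b β) ≤ ENNReal.ofReal (C * (M β * √((N₁ β)⁻¹ ^ 3))) := by
  obtain ⟨hcd, C, hC, hb⟩ := slice_contDiff_and_bound hs hz
  set D := |C₀| + 1 with hD
  have hD0 : 0 < D := by positivity
  refine ⟨3 * (C * √(128 * D ^ 3)) + 1, by positivity, fun β => ?_⟩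
  have h1 := hN₁ β
  have h2 := hN₂ β
  have hMβ := hM β
  set K := √(128 * (D * N₂ β) ^ 3) with hK
  have hK2 : K ^ 2 = 128 * (D * N₂ β) ^ 3 := Real.sq_sqrt (by positivity)
  have hint : ∀ ξ : E, ξ ≠ 0 → ∀ k ≤ 2, 1 ≤ k →
      ∫⁻ x, ‖iteratedFDeriv ℝ k (slice (b β) ξ) x‖ₑ ^ 2 ≤
        ENNReal.ofReal ((C * M β * (N₂ β)⁻¹ ^ k * (N₁ β)⁻¹ ^ k * K) ^ 2) := by
    intro ξ hξ k hk hk1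
    have hu : ‖unit ξ‖ = 1 := by
      rw [unit, norm_smul, norm_inv, norm_norm, inv_mul_cancel₀ (norm_ne_zero_iff.2 hξ)]
    set a := C * M β * (N₂ β)⁻¹ ^ k with ha
    have ha0 : 0 ≤ a := by positivity
    have hpt : ∀ x, ‖iteratedFDeriv ℝ k (slice (b β) ξ) x‖ₑ ^ 2 ≤
        (Metric.closedBall (0 : E) (D * N₂ β)).indicator (fun x => ENNReal.ofReal (a ^ 2) *
          ENNReal.ofReal (((1 + inner ℝ (unit ξ) (unit x) + N₁ β ^ 2)⁻¹) ^ (k + 1))) x := by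
      intro x
      by_cases hg : good β ξ x
      · rw [Set.indicator_of_mem]
        · rw [← ENNReal.ofReal_mul (by positivity), ← ofReal_norm,
            ← ENNReal.ofReal_pow (norm_nonneg _)]
          refine ENNReal.ofReal_le_ofReal ?_
          have h := (hb β ξ x hξ k hk).2 ⟨(β, ξ, x), hξ, hg⟩ rfl
          refine (pow_le_pow_left₀ (norm_nonneg _) h 2).trans_eq ?_
          have hmu : 0 ≤ 1 + mu ξ x + N₁ β ^ 2 := by
            have h1 := abs_real_inner_le_norm (unit ξ) (unit x)
            have h2 : ‖unit x‖ ≤ 1 := by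
              rw [unit, norm_smul, norm_inv, norm_norm]
              exact inv_mul_le_one
            rw [hu, one_mul] at h1
            have := neg_le_of_abs_le (h1.trans h2)
            rw [mu]
            nlinarith [sq_nonneg (N₁ β)]
          have key : ∀ l : ℝ, (C * (M β * l⁻¹ * (N₂ β * l)⁻¹ ^ k)) ^ 2 =
              a ^ 2 * ((l ^ 2)⁻¹) ^ (k + 1) := fun l => by
            rw [ha]
            simp only [mul_inv, mul_pow, ← inv_pow, ← pow_mul, pow_succ]
            ring
          refine (key _).trans ?_
          rw [Real.sq_sqrt hmu]
          rfl
        · rw [mem_closedBall_zero_iff]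
          refine (hball β ξ x hg).trans (mul_le_mul_of_nonneg_right ?_ h2.le)
          linarith [le_abs_self C₀]
      · rw [(hb β ξ x hξ k hk).1 hg]
        simp
    refine (lintegral_mono hpt).trans ?_
    rw [lintegral_indicator measurableSet_closedBall,
      lintegral_const_mul' _ _ ENNReal.ofReal_ne_top]
    refine (mul_le_mul_right (lintegral_cap_le hu (by positivity) h1 hk1) _).trans ?_
    rw [← ENNReal.ofReal_mul (by positivity)]
    refine ENNReal.ofReal_le_ofReal (le_of_eq ?_)
    rw [mul_pow _ K, hK2]
    ring
  refine (symbNorm_le (B₁ := C * M β * (N₂ β)⁻¹ ^ 1 * (N₁ β)⁻¹ ^ 1 * K)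
    (B₂ := C * M β * (N₂ β)⁻¹ ^ 2 * (N₁ β)⁻¹ ^ 2 * K)
    (by positivity) (by positivity) fun ξ hξ => ⟨hcd β ξ hξ, hint ξ hξ 1 one_le_two le_rfl,
      hint ξ hξ 2 le_rfl one_le_two⟩).trans (ENNReal.ofReal_le_ofReal ?_)
  have e1 : C * M β * (N₂ β)⁻¹ ^ 1 * (N₁ β)⁻¹ ^ 1 * K *
      (C * M β * (N₂ β)⁻¹ ^ 2 * (N₁ β)⁻¹ ^ 2 * K) =
      (C * M β) ^ 2 * (128 * D ^ 3 * (N₁ β)⁻¹ ^ 3) := by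
    calc _ = (C * M β) ^ 2 * (N₂ β)⁻¹ ^ 3 * (N₁ β)⁻¹ ^ 3 * K ^ 2 := by ring
      _ = _ := by
        rw [hK2]
        field_simp
  rw [e1, Real.sqrt_mul (by positivity), Real.sqrt_sq (by positivity),
    Real.sqrt_mul (by positivity)]
  have : 0 ≤ M β * √((N₁ β)⁻¹ ^ 3) := by positivity
  nlinarith

end Uniform

/-! ### Divergences of symbols -/

/-- The contraction `L ↦ ∑ₖ (L eₖ)_{ik}`. -/
def divL : (E →L[ℝ] T) →L[ℝ] E :=
  LinearMap.toContinuousLinearMap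
    { toFun := fun L => WithLp.toLp 2 fun i => ∑ k : Fin 3, L (e k) (i, k)
      map_add' := fun L L' => by ext i; simp [Finset.sum_add_distrib]
      map_smul' := fun c L => by ext i; simp [Finset.mul_sum] }

theorem slice_divXi₂ {b : E → E → T} {ξ η : E} (h : DifferentiableAt ℝ (slice b ξ) η) :
    slice (divXi₂ b) ξ η = divL (fderiv ℝ (slice b ξ) η) := by
  ext i
  simp only [slice, divXi₂, divL, sub_add_cancel, LinearMap.coe_toContinuousLinearMap',
    LinearMap.coe_mk, AddHom.coe_mk]
  refine Finset.sum_congr rfl fun k _ => ?_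
  have h1 := ((EuclideanSpace.proj (i, k) : T →L[ℝ] ℝ).hasFDerivAt.comp η h.hasFDerivAt).fderiv
  have h2 := congrArg (fun L : E →L[ℝ] ℝ => L (e k)) h1
  exact h2

theorem Symb.divXi₂ {ι : Type*} {n : ℕ} {x : ι → E} {w M : ι → ℝ} {b : ι → E → E → T} {ξ : ι → E}
    (h : Symb (n + 1) x w M fun i => slice (b i) (ξ i)) :
    Symb n x w (fun i => M i * w i) fun i => slice (CubicQuintic.divXi₂ (b i)) (ξ i) := by
  refine (h.fderiv.clm divL).congr fun i => ?_
  filter_upwards [((h.contDiffAt i).of_infty 1).eventually (by simp)] with η hη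
  exact slice_divXi₂ (hη.differentiableAt (by simp))

theorem slice_divXi₂_eventuallyEq_zero {b : E → E → T} {ξ η : E}
    (h : slice b ξ =ᶠ[nhds η] 0) : slice (divXi₂ b) ξ =ᶠ[nhds η] 0 := by
  filter_upwards [h.eventually_nhds] with y hy
  have hd : HasFDerivAt (slice b ξ) (0 : E →L[ℝ] T) y :=
    (hasFDerivAt_const (0 : T) y).congr_of_eventuallyEq hy
  rw [slice_divXi₂ hd.differentiableAt, hd.fderiv, map_zero]
  rfl

/-! ### Frequency configurations -/

theorem Symb.of_affine {ι V F : Type*} [NormedAddCommGroup V] [NormedSpace ℝ V]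
    [NormedAddCommGroup F] [NormedSpace ℝ F] {n : ℕ} {x : ι → V} {w M : ι → ℝ} {f : ι → V → F}
    {L : V →L[ℝ] F} (hL : ‖L‖ ≤ 1) (hf : ∀ i y, HasFDerivAt (f i) L y) (hw : ∀ i, 0 ≤ w i)
    (hM : ∀ i, 0 ≤ M i) {C : ℝ} (hC : 0 ≤ C) (h0 : ∀ i, ‖f i (x i)‖ ≤ C * M i)
    (h1 : ∀ i, 1 ≤ C * (M i * w i)) : Symb n x w M f := by
  have hfd : ∀ i, _root_.fderiv ℝ (f i) = fun _ => L := fun i => funext fun y => (hf i y).fderiv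
  refine ⟨hw, hM, fun i => ContDiff.contDiffAt ?_, C, hC, fun i k _ => ?_⟩
  · rw [contDiff_infty_iff_fderiv]
    exact ⟨fun y => (hf i y).differentiableAt, by rw [hfd]; exact contDiff_const⟩
  · rcases k with _ | _ | k
    · simpa using h0 i
    · rw [← norm_iteratedFDeriv_fderiv, hfd]
      simpa using hL.trans (h1 i)
    · rw [← norm_iteratedFDeriv_fderiv, hfd, iteratedFDeriv_succ_const]
      have := hw i
      have := hM i
      simp only [Pi.zero_apply, norm_zero]
      positivity

/-- Serves the choice between `A₁` and `A₂`, which may vary with the index of the family. -/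
theorem Symb.of_cases {ι V F : Type*} [NormedAddCommGroup V] [NormedSpace ℝ V]
    [NormedAddCommGroup F] [NormedSpace ℝ F] {n : ℕ} {x : ι → V} {w M : ι → ℝ}
    {f g h : ι → V → F} (hf : Symb n x w M f) (hg : Symb n x w M g)
    (hh : ∀ i, h i = f i ∨ h i = g i) : Symb n x w M h := by
  obtain ⟨C, hC, hb⟩ := hf.bound
  obtain ⟨D, hD, hb'⟩ := hg.bound
  refine ⟨hf.w_nonneg, hf.M_nonneg, fun i => ?_, C + D, by positivity, fun i k hk => ?_⟩
  · rcases hh i with h | h <;> rw [h]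
    exacts [hf.contDiffAt i, hg.contDiffAt i]
  · have h0 : 0 ≤ M i * w i ^ k := mul_nonneg (hf.M_nonneg i) (pow_nonneg (hf.w_nonneg i) k)
    rcases hh i with h | h <;> rw [h]
    · exact (hb i k hk).trans (mul_le_mul_of_nonneg_right (by linarith) h0)
    · exact (hb' i k hk).trans (mul_le_mul_of_nonneg_right (by linarith) h0)

/-- `ξ₁ = ξ - η` and `ξ₂ = η` have sizes comparable to `N₁` and `N₂`. -/
structure InRange (N₁ N₂ : ℝ) (ξ η : E) : Prop where
  low₁ : N₁ ≤ 4 * ‖ξ - η‖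
  up₁ : 5 * ‖ξ - η‖ ≤ 11 * N₁
  low₂ : N₂ ≤ 4 * ‖η‖
  up₂ : 5 * ‖η‖ ≤ 11 * N₂

theorem norm_total_le (ξ η : E) : ‖ξ‖ ≤ ‖ξ - η‖ + ‖η‖ := by
  simpa using norm_add_le (ξ - η) η

/-- Families of frequencies with `|ξ₁| ∼ N₁`, `|ξ₂| ∼ N₂`, together with an inverse length scale
`w ≳ 1 / min (N₁, N₂)`. -/
structure Conf {ι : Type*} (N₁ N₂ w : ι → ℝ) (ξ η : ι → E) : Prop where
  N₁_pos : ∀ i, 0 < N₁ i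
  N₂_pos : ∀ i, 0 < N₂ i
  w_pos : ∀ i, 0 < w i
  w₁ : ∀ i, 1 ≤ 128 * (N₁ i * w i)
  w₂ : ∀ i, 1 ≤ 128 * (N₂ i * w i)
  ξ_ne : ∀ i, ξ i ≠ 0
  range : ∀ i, InRange (N₁ i) (N₂ i) (ξ i) (η i)

/-! ### Supports of the dyadic cutoffs. -/

section Phi

variable {φ : E → ℝ}

theorem psi_eq_zero (hφ : IsBump φ) {ζ : E} (h : ‖ζ‖ ≤ 1 / 2 ∨ 11 / 10 < ‖ζ‖) : psi φ ζ = 0 := by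
  have h2 : ‖(2 : ℝ) • ζ‖ = 2 * ‖ζ‖ := by rw [norm_smul]; norm_num
  rcases h with h | h
  · rw [psi, hφ.eq_one ζ (by linarith), hφ.eq_one _ (by rw [h2]; linarith), sub_self]
  · rw [psi, hφ.eq_zero ζ h, hφ.eq_zero _ (by rw [h2]; linarith), sub_self]

/-- ψ lives in 1/2 ≤ |ζ| ≤ 11/10; the dilates ψ(2ζ) and ψ(ζ/2) extend this to 1/4 and 11/5, whence
the constants in `InRange`. -/
theorem psiTilde_eq_zero (hφ : IsBump φ) {ζ : E} (h : ‖ζ‖ ≤ 1 / 4 ∨ 11 / 5 < ‖ζ‖) :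
    psiTilde φ ζ = 0 := by
  have h2 : ‖(2 : ℝ) • ζ‖ = 2 * ‖ζ‖ := by rw [norm_smul]; norm_num
  have h3 : ‖(2 : ℝ)⁻¹ • ζ‖ = ‖ζ‖ / 2 := by rw [norm_smul]; norm_num; ring
  rw [psiTilde, psi_eq_zero hφ, psi_eq_zero hφ, psi_eq_zero hφ]
  · norm_num
  · rw [h3]
    exact h.imp (fun h => by linarith) fun h => by linarith
  · exact h.imp (fun h => by linarith) fun h => by linarith
  · rw [h2]
    exact h.imp (fun h => by linarith) fun h => by linarith

theorem psiTilde_contDiff (hφ : IsBump φ) : ContDiff ℝ ∞ (psiTilde φ) := by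
  have := hφ.smooth
  have h1 : ContDiff ℝ ∞ (psi φ) := by
    unfold psi
    fun_prop
  unfold psiTilde
  fun_prop

theorem psiTilde_smul_eq_zero (hφ : IsBump φ) {N : ℝ} (hN : 0 < N) {ζ : E}
    (h : ¬ (N ≤ 4 * ‖ζ‖ ∧ 5 * ‖ζ‖ ≤ 11 * N)) : psiTilde φ (N⁻¹ • ζ) = 0 := by
  refine psiTilde_eq_zero hφ ?_
  rw [norm_smul, norm_inv, Real.norm_of_nonneg hN.le, inv_mul_eq_div]
  rw [not_and_or, not_le, not_le] at h
  refine h.imp (fun h => ?_) fun h => ?_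
  · rw [div_le_iff₀ hN]; linarith
  · rw [lt_div_iff₀ hN]; linarith

theorem inRange_of_cutoff_ne_zero (hφ : IsBump φ) {N₁ N₂ : ℝ} (h₁ : 0 < N₁) (h₂ : 0 < N₂)
    {ξ η : E} (h : cutoff φ N₁ N₂ (ξ - η) η ≠ 0) : InRange N₁ N₂ ξ η := by
  rw [cutoff] at h
  have k1 := not_imp_comm.1 (psiTilde_smul_eq_zero hφ h₁) (left_ne_zero_of_mul h)
  have k2 := not_imp_comm.1 (psiTilde_smul_eq_zero hφ h₂) (right_ne_zero_of_mul h)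
  exact ⟨k1.1, k1.2, k2.1, k2.2⟩

/-- `InRange` is a closed condition in η, so outside it the cutoff vanishes on a whole
neighbourhood, together with all its derivatives. -/
theorem cutoff_eventuallyEq_zero (hφ : IsBump φ) {N₁ N₂ : ℝ} (h₁ : 0 < N₁) (h₂ : 0 < N₂)
    {ξ η : E} (h : ¬ InRange N₁ N₂ ξ η) : ∀ᶠ y in nhds η, cutoff φ N₁ N₂ (ξ - y) y = 0 := by
  have hcl : IsClosed {y : E | InRange N₁ N₂ ξ y} := by
    have : {y : E | InRange N₁ N₂ ξ y} = {y | N₁ ≤ 4 * ‖ξ - y‖} ∩ ({y | 5 * ‖ξ - y‖ ≤ 11 * N₁} ∩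
        ({y | N₂ ≤ 4 * ‖y‖} ∩ {y | 5 * ‖y‖ ≤ 11 * N₂})) := by
      ext y
      exact ⟨fun h => ⟨h.1, h.2, h.3, h.4⟩, fun h => ⟨h.1, h.2.1, h.2.2.1, h.2.2.2⟩⟩
    rw [this]
    refine (isClosed_le ?_ ?_).inter ((isClosed_le ?_ ?_).inter
      ((isClosed_le ?_ ?_).inter (isClosed_le ?_ ?_))) <;> fun_prop
  filter_upwards [hcl.isOpen_compl.mem_nhds h] with y hy
  by_contra hne
  exact hy (inRange_of_cutoff_ne_zero hφ h₁ h₂ hne)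

end Phi

/-! ### Symbol bounds for cutoffs, coefficients and multipliers in a configuration. -/

namespace Conf

variable {ι : Type*} {n : ℕ} {N₁ N₂ w : ι → ℝ} {ξ η : ι → E}

theorem ell₂ (c : Conf N₁ N₂ w ξ η) : Ell n η w N₂ fun _ y => y := by
  refine ⟨Symb.of_affine (L := ContinuousLinearMap.id ℝ E) ContinuousLinearMap.norm_id_le
    (fun _ y => hasFDerivAt_id y) (fun i => (c.w_pos i).le) (fun i => (c.N₂_pos i).le)
    (C := 128) (by norm_num) (fun i => ?_) c.w₂, c.N₂_pos, 1 / 4, by norm_num, fun i => ?_⟩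
  · linarith [(c.range i).up₂, c.N₂_pos i]
  · linarith [(c.range i).low₂]

theorem ell₁_of_scale (c : Conf N₁ N₂ w ξ η) {w' : ι → ℝ} (hw' : ∀ i, 0 ≤ w' i)
    (h : ∀ i, 1 ≤ 128 * (N₁ i * w' i)) : Ell n η w' N₁ fun i y => ξ i - y := by
  refine ⟨Symb.of_affine (L := -ContinuousLinearMap.id ℝ E)
    (by rw [norm_neg]; exact ContinuousLinearMap.norm_id_le)
    (fun i y => (hasFDerivAt_id y).const_sub _) hw'
    (fun i => (c.N₁_pos i).le) (C := 128) (by norm_num) (fun i => ?_) h, c.N₁_pos, 1 / 4,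
    by norm_num, fun i => ?_⟩
  · linarith [(c.range i).up₁, c.N₁_pos i]
  · linarith [(c.range i).low₁]

theorem ell₁ (c : Conf N₁ N₂ w ξ η) : Ell n η w N₁ fun i y => ξ i - y :=
  c.ell₁_of_scale (fun i => (c.w_pos i).le) c.w₁

theorem const_symb {F : Type*} [NormedAddCommGroup F] [NormedSpace ℝ F]
    (c : Conf N₁ N₂ w ξ η) {a : ι → F} {M : ι → ℝ} (C : ℝ)
    (hM : ∀ i, 0 ≤ M i) (ha : ∀ i, ‖a i‖ ≤ C * M i) : Symb n η w M fun i _ => a i :=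
  Symb.of_const (fun i => (c.w_pos i).le) C hM ha

theorem η_ne (c : Conf N₁ N₂ w ξ η) (i : ι) : η i ≠ 0 := by
  have := (c.range i).low₂
  have := c.N₂_pos i
  exact norm_pos_iff.1 (by linarith)

theorem ξ₁_ne (c : Conf N₁ N₂ w ξ η) (i : ι) : ξ i - η i ≠ 0 := by
  have := (c.range i).low₁
  have := c.N₁_pos i
  exact norm_pos_iff.1 (by linarith)

theorem eventually_ne (c : Conf N₁ N₂ w ξ η) (i : ι) :
    ∀ᶠ y in nhds (η i), y ≠ 0 ∧ ξ i - y ≠ 0 :=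
  (continuousAt_id.eventually_ne (c.η_ne i)).and
    ((continuousAt_const.sub continuousAt_id).eventually_ne (c.ξ₁_ne i))

theorem cutoff_symb (c : Conf N₁ N₂ w ξ η) {φ : E → ℝ} (hφ : IsBump φ) :
    Symb n η w (fun _ => 1) fun i y => cutoff φ (N₁ i) (N₂ i) (ξ i - y) y := by
  have key : ∀ {N : ι → ℝ} {v : ι → E → E}, Ell n η w N v → (∀ i, 5 * ‖v i (η i)‖ ≤ 11 * N i) →
      Symb n η w (fun _ => 1) fun i y => psiTilde φ ((N i)⁻¹ • v i y) := by
    intro N v hv hu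
    have h1 : Symb n η w (fun _ => 1) fun i y => (N i)⁻¹ • v i y :=
      (hv.symb.const_smul 1 (c := fun i => (N i)⁻¹) (m := fun i => (N i)⁻¹)
        (fun i => (inv_pos.2 (hv.M_pos i)).le)
        fun i => by rw [abs_of_pos (inv_pos.2 (hv.M_pos i)), one_mul]).mono 1
        (fun _ => zero_le_one) fun i => by rw [inv_mul_cancel₀ (hv.M_pos i).ne', one_mul]
    refine h1.comp isOpen_univ (psiTilde_contDiff hφ).contDiffOn
      (isCompact_closedBall (0 : E) 3) (Set.subset_univ _) fun i => ?_
    have := hv.M_pos i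
    rw [mem_closedBall_zero_iff, norm_smul, norm_inv, Real.norm_of_nonneg this.le,
      inv_mul_eq_div, div_le_iff₀ this]
    linarith [hu i]
  exact ((key c.ell₁ fun i => (c.range i).up₁).mul (key c.ell₂ fun i => (c.range i).up₂)).mono 1
    (fun _ => zero_le_one) fun i => by norm_num

theorem ell_denom (c : Conf N₁ N₂ w ξ η) :
    Ell n η w (fun i => (1 + N₁ i + N₂ i) ^ 2) fun i y => 2 + ‖ξ i - y‖ ^ 2 + ‖y‖ ^ 2 := by
  have h1 := c.N₁_pos
  have h2 := c.N₂_pos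
  refine .of_pos_lower ((c.ell₁.two_add_norm_sq.symb.mono 1 (fun i => by positivity)
    fun i => ?_).add (c.ell₂.symb.norm_sq.mono 1 (fun i => by positivity) fun i => ?_))
    (fun i => ?_) (c := 1 / 48) (by norm_num) fun i => ?_
  · nlinarith [h1 i, h2 i]
  · nlinarith [h1 i, h2 i]
  · have := h1 i; have := h2 i; positivity
  -- 48 = 3 · 16: (1 + N₁ + N₂)² ≤ 3(1 + N₁² + N₂²), and Nⱼ² ≤ 16|ξⱼ|².
  · have k1 : N₁ i ^ 2 ≤ (4 * ‖ξ i - η i‖) ^ 2 :=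
      pow_le_pow_left₀ (h1 i).le (c.range i).low₁ 2
    have k2 : N₂ i ^ 2 ≤ (4 * ‖η i‖) ^ 2 := pow_le_pow_left₀ (h2 i).le (c.range i).low₂ 2
    nlinarith [sq_nonneg (1 - N₁ i), sq_nonneg (1 - N₂ i), sq_nonneg (N₁ i - N₂ i)]

theorem A_symb (c : Conf N₁ N₂ w ξ η) {β : ℝ} {A : ι → E → E → ℝ}
    (hA : ∀ i, A i = A₁ β ∨ A i = A₂) :
    Symb n η w (fun _ => 1) fun i y => A i (ξ i - y) y := by
  have h1 := c.N₁_pos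
  have h2 := c.N₂_pos
  have k1 : Symb n η w (fun _ => 1) fun i y => A₁ β (ξ i - y) y := by
    refine (c.const_symb (a := fun _ => 4 + 4 * β) |4 + 4 * β| (fun _ => zero_le_one)
      fun i => by simp).add ?_
    have h3 : Symb n η w (fun i => N₁ i * N₂ i) fun i y => 2 * inner ℝ (ξ i - y) y :=
      ((c.ell₁.symb.inner c.ell₂.symb).const_smul (c := fun _ => 2) (m := fun _ => 1) 2
        (fun _ => zero_le_one) fun i => by norm_num).mono 1
        (fun i => mul_nonneg (h1 i).le (h2 i).le) fun i => by rw [one_mul]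
    refine (h3.mul c.ell_denom.inv.symb).mono 1 (fun _ => zero_le_one) fun i => ?_
    have := h1 i
    have := h2 i
    rw [← div_eq_mul_inv, one_mul, div_le_one (by positivity)]
    nlinarith
  have k2 : Symb n η w (fun _ => 1) fun i y => A₂ (ξ i - y) y := by
    have h3 : Symb n η w (fun i => (1 + N₁ i) * (1 + N₂ i)) fun i y =>
        2 * jap (ξ i - y) * jap y :=
      (((c.ell₁.jap.symb.const_smul (c := fun _ => 2) (m := fun _ => 1) 2
        (fun _ => zero_le_one) fun i => by norm_num)).mul c.ell₂.jap.symb).mono 1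
        (fun i => by have := h1 i; have := h2 i; positivity) fun i => by rw [one_mul, one_mul]
    have h4 := (h3.mul c.ell_denom.inv.symb).neg.mul (c.ell₁.unit.inner c.ell₂.unit)
    refine h4.mono 1 (fun _ => zero_le_one) fun i => ?_
    have := h1 i
    have := h2 i
    rw [← div_eq_mul_inv, one_mul, mul_one, div_le_one (by positivity)]
    nlinarith
  exact k1.of_cases k2 fun i => (hA i).imp (fun h => by simp only [h]) fun h => by simp only [h]

/-- The gradient of the phase in `ξ`, for fixed `ξ`. -/
theorem slice_gradXi (c : Conf N₁ N₂ w ξ η) (i : ι) :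
    ∀ᶠ y in nhds (η i), gradXi Φ (ξ i - y) y = hh (ξ i) • ξ i - hh (ξ i - y) • (ξ i - y) := by
  filter_upwards [c.eventually_ne i] with y hy
  rw [gradXi_Φ (by rw [sub_add_cancel]; exact c.ξ_ne i) hy.2, sub_add_cancel]

theorem slice_gradXi₂ (c : Conf N₁ N₂ w ξ η) (i : ι) :
    ∀ᶠ y in nhds (η i), gradXi₂ Φ (ξ i - y) y = hh y • y + hh (ξ i - y) • (ξ i - y) := by
  filter_upwards [c.eventually_ne i] with y hy
  rw [gradXi₂_Φ hy.2 hy.1]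

theorem bT_symb (c : Conf N₁ N₂ w ξ η) {κ : ι → E → E → ℝ} {L D M : ι → ℝ} {C : ℝ}
    (hκ : Symb n η w (fun _ => 1) fun i y => κ i (ξ i - y) y)
    (hΦ : Symb n η w L fun i y => (Φ (ξ i - y) y)⁻¹)
    (hG : Symb n η w D fun i y => hh (ξ i) • ξ i - hh (ξ i - y) • (ξ i - y))
    (hM : ∀ i, 0 ≤ M i) (h : ∀ i, U (ξ i) * (L i * D i) ≤ C * M i) :
    Symb n η w M fun i => slice (bT (κ i)) (ξ i) := by
  have hU : ∀ i, 0 ≤ U (ξ i) := fun i => div_nonneg (norm_nonneg _) (jap_pos _).le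
  have h1 := ((hκ.mul (c.const_symb (n := n) (a := fun i => U (ξ i)) (M := fun i => U (ξ i)) 1 hU
    fun i => by rw [Real.norm_of_nonneg (hU i), one_mul])).mul hΦ).smul hG
  refine (h1.mono C hM fun i => ?_).congr fun i => ?_
  · rw [one_mul, mul_assoc]
    exact h i
  · filter_upwards [c.slice_gradXi i] with y hy
    rw [slice, bT, hy, sub_add_cancel, div_eq_mul_inv]

/-- X/|X|² has size 1/L when |X| ∼ L, so the size to be controlled is U(ξ) D / L. -/
theorem bX_symb (c : Conf N₁ N₂ w ξ η) {κ : ι → E → E → ℝ} {L D M : ι → ℝ} {C : ℝ}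
    (hκ : Symb n η w (fun _ => 1) fun i y => κ i (ξ i - y) y)
    (hX : Ell n η w L fun i y => hh y • y + hh (ξ i - y) • (ξ i - y))
    (hG : Symb n η w D fun i y => hh (ξ i) • ξ i - hh (ξ i - y) • (ξ i - y))
    (hM : ∀ i, 0 ≤ M i) (h : ∀ i, U (ξ i) * D i ≤ C * (M i * L i)) :
    Symb n η w M fun i => slice (bX (κ i)) (ξ i) := by
  have hU : ∀ i, 0 ≤ U (ξ i) := fun i => div_nonneg (norm_nonneg _) (jap_pos _).le
  have hn : Ell n η w (fun i => L i ^ 2) fun i y => ‖hh y • y + hh (ξ i - y) • (ξ i - y)‖ ^ 2 := by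
    simpa only [← sq] using hX.norm.mul hX.norm
  have h1 := ((hκ.mul (c.const_symb (n := n) (a := fun i => U (ξ i)) (M := fun i => U (ξ i)) 1 hU
    fun i => by rw [Real.norm_of_nonneg (hU i), one_mul])).mul hn.inv.symb).smul
    (hG.tensor hX.symb)
  refine (h1.mono C hM fun i => ?_).congr fun i => ?_
  · have hL := hX.M_pos i
    have e1 : 1 * U (ξ i) * (L i ^ 2)⁻¹ * (D i * L i) = U (ξ i) * D i / L i := by
      field_simp
    rw [e1, div_le_iff₀ hL, mul_assoc]
    exact h i
  · filter_upwards [c.slice_gradXi i, c.slice_gradXi₂ i] with y hy hy2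
    rw [slice, bX, hy, hy2, sub_add_cancel, div_eq_mul_inv]

end Conf

theorem slice_bT_eq_zero {κ : E → E → ℝ} {ξ η : E} (h : ∀ᶠ y in nhds η, κ (ξ - y) y = 0) :
    slice (bT κ) ξ =ᶠ[nhds η] 0 := by
  filter_upwards [h] with y hy
  simp [slice, bT, hy]

theorem slice_bX_eq_zero {κ : E → E → ℝ} {ξ η : E} (h : ∀ᶠ y in nhds η, κ (ξ - y) y = 0) :
    slice (bX κ) ξ =ᶠ[nhds η] 0 := by
  filter_upwards [h] with y hy
  simp [slice, bX, hy]

/-! ### Algebra of the phase -/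

theorem inner_eq_mu {ξ η : E} (hξ : ξ ≠ 0) (hη : η ≠ 0) : inner ℝ ξ η = ‖ξ‖ * ‖η‖ * mu ξ η := by
  have h1 := norm_ne_zero_iff.2 hξ
  have h2 := norm_ne_zero_iff.2 hη
  rw [mu, unit, unit, inner_smul_left, inner_smul_right]
  simp only [RCLike.conj_to_real]
  field_simp

theorem norm_unit {ζ : E} (h : ζ ≠ 0) : ‖unit ζ‖ = 1 := by
  rw [unit, norm_smul, norm_inv, norm_norm, inv_mul_cancel₀ (norm_ne_zero_iff.2 h)]

theorem abs_mu_le {ξ η : E} (hξ : ξ ≠ 0) (hη : η ≠ 0) : |mu ξ η| ≤ 1 := by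
  have := abs_real_inner_le_norm (unit ξ) (unit η)
  rwa [norm_unit hξ, norm_unit hη, one_mul] at this

theorem neg_one_le_mu {ξ η : E} (hξ : ξ ≠ 0) (hη : η ≠ 0) : -1 ≤ mu ξ η :=
  neg_le_of_abs_le (abs_mu_le hξ hη)

theorem mu_le_one {ξ η : E} (hξ : ξ ≠ 0) (hη : η ≠ 0) : mu ξ η ≤ 1 :=
  le_of_abs_le (abs_mu_le hξ hη)

theorem norm_sub_sq_mu {ξ η : E} (hξ : ξ ≠ 0) (hη : η ≠ 0) :
    ‖ξ - η‖ ^ 2 = ‖ξ‖ ^ 2 + ‖η‖ ^ 2 - 2 * (‖ξ‖ * ‖η‖ * mu ξ η) := by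
  rw [norm_sub_sq_real, inner_eq_mu hξ hη]
  ring

/-- Up to a positive factor, the phase `Φ` equals `2 |ξ| |η|` times this function. -/
def phaseFactor (ξ η : E) : ℝ :=
  jap ξ * jap η - ‖ξ‖ * ‖η‖ + 2 * mu ξ η * (‖ξ‖ ^ 2 + ‖η‖ ^ 2 + 1) - 2 * (‖ξ‖ * ‖η‖) * mu ξ η ^ 2

/-- The left side is the difference of squares (H(ξ) + H(η))² - H(ξ-η)². Because H² is a polynomial
in |·|², the law of cosines eliminates |ξ-η|. -/
theorem Φ_mul_sum {ξ η : E} (hξ : ξ ≠ 0) (hη : η ≠ 0) :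
    Φ (ξ - η) η * (H ξ + H η + H (ξ - η)) = 2 * (‖ξ‖ * ‖η‖) * phaseFactor ξ η := by
  have h1 := H_sq ξ
  have h2 := H_sq η
  have h3 := H_sq (ξ - η)
  rw [norm_sub_sq_mu hξ hη] at h3
  have h4 : H ξ * H η = ‖ξ‖ * ‖η‖ * (jap ξ * jap η) := by rw [H, H]; ring
  rw [Φ, sub_add_cancel, phaseFactor]
  linear_combination h1 + h2 - h3 + 2 * h4

theorem Φ_eq {ξ η : E} (hξ : ξ ≠ 0) (hη : η ≠ 0) :
    Φ (ξ - η) η = 2 * (‖ξ‖ * ‖η‖) * phaseFactor ξ η * (H ξ + H η + H (ξ - η))⁻¹ := by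
  have : 0 < H ξ := mul_pos (norm_pos_iff.2 hξ) (jap_pos ξ)
  have := H_nonneg η
  have := H_nonneg (ξ - η)
  rw [← Φ_mul_sum hξ hη, mul_assoc, mul_inv_cancel₀ (by positivity), mul_one]

theorem norm_le_jap (ζ : E) : ‖ζ‖ ≤ jap ζ := by
  refine Real.le_sqrt_of_sq_le ?_
  linarith

/-- For 0 ≤ μ ≤ 1 one has μ² ≤ μ and ⟨ξ⟩⟨η⟩ ≥ |ξ||η|; the surplus is μ(|ξ| - |η|)² ≥ 0. -/
theorem phaseFactor_ge {ξ η : E} (hξ : ξ ≠ 0) (hη : η ≠ 0) (h : 0 ≤ mu ξ η) :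
    mu ξ η * (‖ξ‖ ^ 2 + ‖η‖ ^ 2 + 2) ≤ phaseFactor ξ η := by
  have h1 := mu_le_one hξ hη
  have h2 : ‖ξ‖ * ‖η‖ ≤ jap ξ * jap η :=
    mul_le_mul (norm_le_jap ξ) (norm_le_jap η) (norm_nonneg _) (jap_pos ξ).le
  have h3 : 0 ≤ ‖ξ‖ * ‖η‖ := by positivity
  have h4 : ‖ξ‖ * ‖η‖ * mu ξ η ^ 2 ≤ ‖ξ‖ * ‖η‖ * mu ξ η := by
    refine mul_le_mul_of_nonneg_left ?_ h3
    nlinarith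
  rw [phaseFactor]
  nlinarith [mul_nonneg h (sq_nonneg (‖ξ‖ - ‖η‖))]

/-- At μ = -1 the inequality ⟨ξ⟩⟨η⟩ ≤ 2 + (|ξ|² + |η|²)/2 bounds the factor by -(3/2)(|ξ| + |η|)².
The hypothesis says that the error from 1 + μ > 0 uses up at most a third of this. -/
theorem phaseFactor_le {ξ η : E}
    (h : (1 + mu ξ η) * (2 + 2 * (‖ξ‖ + ‖η‖) ^ 2) ≤ (‖ξ‖ + ‖η‖) ^ 2 / 2) :
    phaseFactor ξ η ≤ -(‖ξ‖ + ‖η‖) ^ 2 := by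
  have h3 : 0 ≤ ‖ξ‖ * ‖η‖ := by positivity
  have h2 : jap ξ * jap η ≤ 2 + (‖ξ‖ ^ 2 + ‖η‖ ^ 2) / 2 := by
    nlinarith [sq_nonneg (jap ξ - jap η), jap_sq ξ, jap_sq η]
  rw [phaseFactor]
  nlinarith [mul_nonneg h3 (sq_nonneg (1 + mu ξ η))]

/-- Expansion around μ = -1, with ⟨ξ⟩⟨η⟩ - 2 rationalised. Every term now carries a factor 1 + μ or
is at least quadratic in (|ξ|, |η|), so that the size λ² at low frequency can be read off. -/
theorem phaseFactor_eq (ξ η : E) : phaseFactor ξ η =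
    2 * (1 + mu ξ η) * (1 + (‖ξ‖ + ‖η‖) ^ 2) - 2 * (‖ξ‖ * ‖η‖) * (1 + mu ξ η) ^ 2 -
      (3 * (‖ξ‖ * ‖η‖) + 2 * (‖ξ‖ ^ 2 + ‖η‖ ^ 2) -
        (2 * ‖ξ‖ ^ 2 + 2 * ‖η‖ ^ 2 + ‖ξ‖ ^ 2 * ‖η‖ ^ 2) * (jap ξ * jap η + 2)⁻¹) := by
  have h1 : 0 < jap ξ * jap η + 2 := by
    have := mul_pos (jap_pos ξ) (jap_pos η)
    linarith
  have h2 : (2 * ‖ξ‖ ^ 2 + 2 * ‖η‖ ^ 2 + ‖ξ‖ ^ 2 * ‖η‖ ^ 2) * (jap ξ * jap η + 2)⁻¹ =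
      jap ξ * jap η - 2 := by
    rw [← div_eq_mul_inv, div_eq_iff h1.ne']
    linear_combination (-jap η ^ 2) * jap_sq ξ - (2 + ‖ξ‖ ^ 2) * jap_sq η
  rw [h2, phaseFactor]
  ring

/-! ### Sizes of gradients of the dispersion relation -/

/-- Splits the difference into a radial part, the change of H', and an angular part; the bracket
|u-v|² - (|u|-|v|)² equals 2(|u||v| - u·v). -/
theorem norm_gradH_sub_sq (u v : E) : ‖hh u • u - hh v • v‖ ^ 2 =
    (hh u * ‖u‖ - hh v * ‖v‖) ^ 2 + hh u * hh v * (‖u - v‖ ^ 2 - (‖u‖ - ‖v‖) ^ 2) := by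
  rw [norm_sub_sq_real, norm_sub_sq_real, norm_smul, norm_smul, inner_smul_left, inner_smul_right]
  simp only [RCLike.conj_to_real, mul_pow, Real.norm_eq_abs, sq_abs]
  ring

theorem two_mul_norm_le_hh {ζ : E} (h : ζ ≠ 0) : 2 * ‖ζ‖ ≤ hh ζ * ‖ζ‖ := by
  refine le_of_sq_le_sq ?_ (mul_nonneg (hh_pos h).le (norm_nonneg _))
  rw [hh_mul_norm_sq h, mul_pow]
  have : 0 ≤ 1 / (2 + ‖ζ‖ ^ 2) := by positivity
  linarith

theorem one_le_hh {ζ : E} (h : ζ ≠ 0) : 1 ≤ hh ζ * ‖ζ‖ := by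
  refine le_of_sq_le_sq ?_ (mul_nonneg (hh_pos h).le (norm_nonneg _))
  rw [hh_mul_norm_sq h]
  have : 1 / 4 ≤ ‖ζ‖ ^ 2 + 1 / (2 + ‖ζ‖ ^ 2) := by
    have h0 := sq_nonneg ‖ζ‖
    rw [← sub_nonneg]
    have : ‖ζ‖ ^ 2 + 1 / (2 + ‖ζ‖ ^ 2) - 1 / 4 =
        (‖ζ‖ ^ 2 * (7 / 4) + ‖ζ‖ ^ 2 * ‖ζ‖ ^ 2 + 1 / 2) / (2 + ‖ζ‖ ^ 2) := by
      field_simp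
      ring
    rw [this]
    positivity
  linarith

theorem hh_le {ζ : E} (h : ζ ≠ 0) : hh ζ * ‖ζ‖ ≤ 2 * (1 + ‖ζ‖) := by
  refine le_of_sq_le_sq ?_ (by positivity)
  rw [hh_mul_norm_sq h]
  have h1 : 1 / (2 + ‖ζ‖ ^ 2) ≤ 1 := by
    rw [div_le_one (by positivity)]
    nlinarith [sq_nonneg ‖ζ‖]
  nlinarith [norm_nonneg ζ]

theorem hh_sq_sub_sq {u v : E} (hu : u ≠ 0) (hv : v ≠ 0) :
    (hh u * ‖u‖) ^ 2 - (hh v * ‖v‖) ^ 2 =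
      4 * (‖u‖ ^ 2 - ‖v‖ ^ 2) * (1 - 1 / ((2 + ‖u‖ ^ 2) * (2 + ‖v‖ ^ 2))) := by
  rw [hh_mul_norm_sq hu, hh_mul_norm_sq hv]
  field_simp
  ring

theorem inv_denom_mem (u v : E) : 0 < 1 / ((2 + ‖u‖ ^ 2) * (2 + ‖v‖ ^ 2)) ∧
    1 / ((2 + ‖u‖ ^ 2) * (2 + ‖v‖ ^ 2)) ≤ 1 / 4 := by
  refine ⟨by positivity, ?_⟩
  refine one_div_le_one_div_of_le (by norm_num) ?_
  nlinarith [sq_nonneg ‖u‖, sq_nonneg ‖v‖, mul_nonneg (sq_nonneg ‖u‖) (sq_nonneg ‖v‖)]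

theorem abs_hh_sub_mul_add_le {u v : E} (hu : u ≠ 0) (hv : v ≠ 0) :
    |hh u * ‖u‖ - hh v * ‖v‖| * (hh u * ‖u‖ + hh v * ‖v‖) ≤ 4 * |‖u‖ ^ 2 - ‖v‖ ^ 2| := by
  have h0 : 0 ≤ hh u * ‖u‖ + hh v * ‖v‖ :=
    add_nonneg (mul_nonneg (hh_pos hu).le (norm_nonneg _))
      (mul_nonneg (hh_pos hv).le (norm_nonneg _))
  obtain ⟨h1, h2⟩ := inv_denom_mem u v
  calc |hh u * ‖u‖ - hh v * ‖v‖| * (hh u * ‖u‖ + hh v * ‖v‖)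
      = |(hh u * ‖u‖) ^ 2 - (hh v * ‖v‖) ^ 2| := by
        rw [sq_sub_sq, abs_mul, abs_of_nonneg h0, mul_comm]
    _ = 4 * |‖u‖ ^ 2 - ‖v‖ ^ 2| * |1 - 1 / ((2 + ‖u‖ ^ 2) * (2 + ‖v‖ ^ 2))| := by
        rw [hh_sq_sub_sq hu hv, abs_mul, abs_mul, abs_of_pos (by norm_num : (0 : ℝ) < 4)]
    _ ≤ 4 * |‖u‖ ^ 2 - ‖v‖ ^ 2| * 1 := by
        gcongr
        rw [abs_le]
        constructor <;> linarith
    _ = _ := mul_one _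

/-- H' is 2-Lipschitz: divide the difference of squares by H'(|u|) + H'(|v|) ≥ 2(|u| + |v|). -/
theorem abs_hh_sub_le {u v : E} (hu : u ≠ 0) (hv : v ≠ 0) :
    |hh u * ‖u‖ - hh v * ‖v‖| ≤ 2 * |‖u‖ - ‖v‖| := by
  have h1 := abs_hh_sub_mul_add_le hu hv
  have h2 := two_mul_norm_le_hh hu
  have h3 := two_mul_norm_le_hh hv
  have hu0 := norm_pos_iff.2 hu
  have hv0 := norm_pos_iff.2 hv
  have e1 : |‖u‖ ^ 2 - ‖v‖ ^ 2| = |‖u‖ - ‖v‖| * (‖u‖ + ‖v‖) := by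
    rw [sq_sub_sq, abs_mul, abs_of_pos (by positivity : 0 < ‖u‖ + ‖v‖), mul_comm]
  rw [e1] at h1
  have h4 : |hh u * ‖u‖ - hh v * ‖v‖| * (2 * (‖u‖ + ‖v‖)) ≤
      2 * |‖u‖ - ‖v‖| * (2 * (‖u‖ + ‖v‖)) := by
    refine le_trans (mul_le_mul_of_nonneg_left (by linarith) (abs_nonneg _)) (h1.trans_eq (by ring))
  exact le_of_mul_le_mul_right h4 (by positivity)

/-- The form suited to low frequencies, where H' is flat: dividing by H'(|u|) + H'(|v|) ≥ 2 instead
leaves a quadratic difference. -/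
theorem abs_hh_sub_le_sq {u v : E} (hu : u ≠ 0) (hv : v ≠ 0) :
    |hh u * ‖u‖ - hh v * ‖v‖| ≤ 2 * |‖u‖ ^ 2 - ‖v‖ ^ 2| := by
  have h1 := abs_hh_sub_mul_add_le hu hv
  have h2 := one_le_hh hu
  have h3 := one_le_hh hv
  have := abs_nonneg (hh u * ‖u‖ - hh v * ‖v‖)
  nlinarith

theorem hh_sub_ge {u v : E} (hu : u ≠ 0) (hv : v ≠ 0) (h : ‖v‖ ≤ ‖u‖) :
    3 * (‖u‖ ^ 2 - ‖v‖ ^ 2) ≤ (hh u * ‖u‖ - hh v * ‖v‖) * (hh u * ‖u‖ + hh v * ‖v‖) := by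
  obtain ⟨h1, h2⟩ := inv_denom_mem u v
  have h3 := hh_sq_sub_sq hu hv
  have h4 : 0 ≤ ‖u‖ ^ 2 - ‖v‖ ^ 2 := sub_nonneg.2 (pow_le_pow_left₀ (norm_nonneg _) h 2)
  nlinarith

/-- Heron-type identity for the triangle with sides `ξ`, `η`, `ξ - η`. -/
theorem triangle_defect {ξ η : E} (hξ : ξ ≠ 0) (hη : η ≠ 0) :
    (‖ξ‖ + ‖η‖ - ‖ξ - η‖) * (‖ξ‖ + ‖η‖ + ‖ξ - η‖) = 2 * (‖ξ‖ * ‖η‖) * (1 + mu ξ η) := by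
  have := norm_sub_sq_mu hξ hη
  linear_combination -this

theorem inner_perp_self {ξ η : E} (hη : η ≠ 0) : inner ℝ (perp ξ η) η = 0 := by
  have := norm_ne_zero_iff.2 hη
  rw [perp, inner_sub_left, inner_smul_left, unit, inner_smul_right, inner_smul_left,
    real_inner_self_eq_norm_sq]
  simp only [RCLike.conj_to_real]
  field_simp
  ring

theorem inner_perp {ξ η : E} (hξ : ξ ≠ 0) :
    inner ℝ (perp ξ η) ξ = ‖ξ‖ ^ 2 * (1 - mu ξ η ^ 2) := by
  have h1 : inner ℝ (unit η) ξ = ‖ξ‖ * mu ξ η := by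
    have := norm_ne_zero_iff.2 hξ
    rw [mu, real_inner_comm, unit, unit, inner_smul_left]
    simp only [RCLike.conj_to_real]
    field_simp
  rw [perp, inner_sub_left, inner_smul_left, real_inner_self_eq_norm_sq, real_inner_comm, h1]
  simp only [RCLike.conj_to_real]
  ring

/-- ∇H(ξ-η) is parallel to ξ-η, and the part along η is annihilated. Only the squared sine of the
angle of ξ and η remains, which is the angular non-resonance. -/
theorem inner_perp_gradH {ξ η : E} (hξ : ξ ≠ 0) (hη : η ≠ 0) :
    inner ℝ (perp ξ η) (hh (ξ - η) • (ξ - η)) =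
      hh (ξ - η) * (‖ξ‖ ^ 2 * (1 - mu ξ η ^ 2)) := by
  rw [inner_smul_right, inner_sub_right, inner_perp_self hη, inner_perp hξ, sub_zero]

theorem jap_le (ζ : E) : jap ζ ≤ 2 + ‖ζ‖ :=
  Real.sqrt_le_iff.2 ⟨by positivity, by nlinarith [norm_nonneg ζ]⟩

theorem le_jap (ζ : E) : (1 + ‖ζ‖) / 2 ≤ jap ζ :=
  Real.le_sqrt_of_sq_le (by nlinarith [sq_nonneg (1 - ‖ζ‖), sq_nonneg ‖ζ‖])

theorem one_le_jap (ζ : E) : 1 ≤ jap ζ :=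
  Real.le_sqrt_of_sq_le (by nlinarith [sq_nonneg ‖ζ‖])

theorem U_nonneg (ζ : E) : 0 ≤ U ζ := div_nonneg (norm_nonneg _) (jap_pos _).le

theorem U_le_one (ζ : E) : U ζ ≤ 1 := (div_le_one (jap_pos ζ)).2 (norm_le_jap ζ)

theorem U_le_norm (ζ : E) : U ζ ≤ ‖ζ‖ := div_le_self (norm_nonneg ζ) (one_le_jap ζ)

theorem H_le (ζ : E) : H ζ ≤ ‖ζ‖ * (2 + ‖ζ‖) :=
  mul_le_mul_of_nonneg_left (jap_le ζ) (norm_nonneg ζ)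

theorem norm_hh_smul (ζ : E) : ‖hh ζ • ζ‖ = hh ζ * ‖ζ‖ := by
  rw [norm_smul, Real.norm_of_nonneg]
  have := jap_pos ζ
  rw [hh]
  positivity

/-- ∇H is odd, so ∇_{ξ₂}Φ is a difference of ∇H at two points whose difference is ξ; this makes the
factor |ξ| in it accessible. -/
theorem gradH_sub_neg (ξ η : E) :
    hh η • η + hh (ξ - η) • (ξ - η) = hh η • η - hh (η - ξ) • (η - ξ) := by
  rw [← neg_sub ξ η, hh_neg, smul_neg, sub_neg_eq_add]

namespace Conf

variable {ι : Type*} {n : ℕ} {N₁ N₂ w : ι → ℝ} {ξ η : ι → E}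

/-- ∇H(ξ) does not depend on y, and each derivative of ∇H(ξ-y) costs only 1/N₁. Hence `Symb.shift`
applies, and cancellation in the difference has to be proved only for its value at the base point.
-/
theorem gradXi_symb (c : Conf N₁ N₂ w ξ η) {D : ι → ℝ} {C : ℝ} (hD : ∀ i, 0 ≤ D i)
    (hξ : ∀ i, ‖ξ i‖ ≤ 150 * N₁ i) (h1 : ∀ i, 1 + N₁ i ≤ C * (N₁ i * (D i * w i)))
    (h0 : ∀ i, ‖hh (ξ i) • ξ i - hh (ξ i - η i) • (ξ i - η i)‖ ≤ C * D i) :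
    Symb n η w D fun i y => hh (ξ i) • ξ i - hh (ξ i - y) • (ξ i - y) := by
  have hN := c.N₁_pos
  have hw := c.w_pos
  have k := (c.ell₁_of_scale (n := n) (w' := fun i => (N₁ i)⁻¹) (fun i => (inv_pos.2 (hN i)).le)
    fun i => by rw [mul_inv_cancel₀ (hN i).ne']; norm_num).gradH
  have k' : Symb n η (fun i => (N₁ i)⁻¹) (fun i => 1 + N₁ i) fun i _ => hh (ξ i) • ξ i :=
    Symb.of_const k.w_nonneg 300 k.M_nonneg fun i => by
      rw [norm_hh_smul]
      linarith [hh_le (c.ξ_ne i), hξ i]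
  refine (k'.sub k).shift (max C 128) (fun i => (hw i).le) hD (fun i => ?_) (fun i => ?_)
    fun i => ?_
  · rw [inv_le_iff_one_le_mul₀' (hN i)]
    have h2 : 0 ≤ N₁ i * w i := mul_nonneg (hN i).le (hw i).le
    calc 1 ≤ 128 * (N₁ i * w i) := c.w₁ i
      _ ≤ max C 128 * (N₁ i * w i) := mul_le_mul_of_nonneg_right (le_max_right _ _) h2
      _ = _ := by ring
  · rw [← div_eq_mul_inv, div_le_iff₀ (hN i)]
    have h2 : 0 ≤ N₁ i * (D i * w i) := mul_nonneg (hN i).le (mul_nonneg (hD i) (hw i).le)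
    calc 1 + N₁ i ≤ C * (N₁ i * (D i * w i)) := h1 i
      _ ≤ max C 128 * (N₁ i * (D i * w i)) := mul_le_mul_of_nonneg_right (le_max_left _ _) h2
      _ = _ := by ring
  · exact (h0 i).trans (mul_le_mul_of_nonneg_right (le_max_left _ _) (hD i))

theorem inv_Φ_symb (c : Conf N₁ N₂ w ξ η) {R S : ι → ℝ}
    (hP : Ell n η w R fun i y => phaseFactor (ξ i) y)
    (hS : Symb n η w S fun i y => H (ξ i) + H y + H (ξ i - y)) :
    Symb n η w (fun i => (‖ξ i‖ * N₂ i * R i)⁻¹ * S i) fun i y => (Φ (ξ i - y) y)⁻¹ := by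
  have hξ : ∀ i, 0 < ‖ξ i‖ := fun i => norm_pos_iff.2 (c.ξ_ne i)
  have h1 : Ell n η w (fun i => ‖ξ i‖) fun i _ => 2 * ‖ξ i‖ :=
    .of_pos_lower (c.const_symb 2 (fun i => (hξ i).le) fun i => by simp) hξ one_pos
      fun i => by linarith [hξ i]
  refine (((h1.mul c.ell₂.norm).mul hP).inv.symb.mul hS).congr fun i => ?_
  filter_upwards [c.eventually_ne i] with y hy
  rw [Φ_eq (c.ξ_ne i) hy.1, mul_inv, inv_inv, ← mul_assoc 2]

/-! ### The region `N₁ ≪ N₂` -/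

/-- Here |ξ₂| ≥ 7|ξ₁|, so H(ξ₁) ≤ H(ξ₂)/7 and Φ ≳ H(ξ₂) ∼ N₂(1 + N₂), while |∇_ξΦ| ≲ 1 + N₂. -/
theorem bT_symb_of_small₁ (c : Conf N₁ N₂ w ξ η) (h : ∀ i, 64 * N₁ i ≤ N₂ i) {κ : ι → E → E → ℝ}
    (hκ : Symb n η w (fun _ => 1) fun i y => κ i (ξ i - y) y) :
    Symb n η w (fun i => 1 / N₂ i) fun i => slice (bT (κ i)) (ξ i) := by
  have h1 := c.N₁_pos
  have h2 := c.N₂_pos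
  have hr : ∀ i, ‖ξ i‖ ≤ 5 * N₂ i := fun i => by
    linarith [norm_total_le (ξ i) (η i), (c.range i).up₁, (c.range i).up₂, h i, h1 i]
  have hr0 := fun i => norm_nonneg (ξ i)
  have hL : ∀ i, 0 < N₂ i * (1 + N₂ i) := fun i => by have := h2 i; positivity
  have hΦ : Symb n η w (fun i => N₂ i * (1 + N₂ i)) fun i y => Φ (ξ i - y) y := by
    have k1 : Symb n η w (fun i => N₂ i * (1 + N₂ i)) fun i _ => H (ξ i) :=
      c.const_symb 25 (fun i => (hL i).le) fun i => by
        rw [Real.norm_of_nonneg (H_nonneg _)]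
        nlinarith [H_le (ξ i), hr i, hr0 i, h2 i]
    have k2 : Symb n η w (fun i => N₂ i * (1 + N₂ i)) fun i y => H (ξ i - y) :=
      c.ell₁.H.symb.mono 1 (fun i => (hL i).le) fun i => by nlinarith [h i, h1 i, h2 i]
    refine ((k1.add c.ell₂.H.symb).sub k2).congr fun i => Filter.Eventually.of_forall fun y => ?_
    simp only [Φ, sub_add_cancel]
  refine c.bT_symb (L := fun i => (N₂ i * (1 + N₂ i))⁻¹) (D := fun i => 1 + N₂ i) (C := 1) hκ
    (hΦ.inv_of_pos hL (c := 1 / 64) (by norm_num) fun i => ?_) (.sub ?_ ?_)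
    (fun i => by have := h2 i; positivity) fun i => ?_
  · have ha : 7 * ‖ξ i - η i‖ ≤ ‖η i‖ := by
      linarith [(c.range i).up₁, (c.range i).low₂, h i, h1 i]
    have hj : jap (ξ i - η i) ≤ jap (η i) :=
      Real.sqrt_le_sqrt (by nlinarith [norm_nonneg (ξ i - η i)])
    have hH : 7 * H (ξ i - η i) ≤ H (η i) := by
      rw [H, H, ← mul_assoc]
      exact mul_le_mul ha hj (jap_pos _).le (norm_nonneg _)
    have hH2 : N₂ i / 4 * ((1 + N₂ i) / 8) ≤ H (η i) := by
      rw [H]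
      refine mul_le_mul ?_ ?_ ?_ (norm_nonneg _)
      · linarith [(c.range i).low₂]
      · linarith [(c.range i).low₂, le_jap (η i)]
      · linarith [h2 i]
    simp only [Φ, sub_add_cancel]
    nlinarith [H_nonneg (ξ i), H_nonneg (ξ i - η i)]
  · exact c.const_symb 10 (fun i => by linarith [h2 i]) fun i => by
      rw [norm_hh_smul]
      linarith [hh_le (c.ξ_ne i), hr i, h2 i]
  · exact c.ell₁.gradH.mono 1 (fun i => by linarith [h2 i]) fun i => by
      linarith [h i, h1 i, h2 i]
  · have := h2 i
    have e1 : (N₂ i * (1 + N₂ i))⁻¹ * (1 + N₂ i) = 1 / N₂ i := by field_simp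
    rw [e1]
    exact mul_le_mul_of_nonneg_right (U_le_one _) (by positivity)

/-! ### The region `N₂ ≪ N₁`, `N₁ ≳ 1` -/

/-- |∇_{ξ₂}Φ| ∼ N₁ since H'(|ξ₁|) dominates H'(|ξ₂|), and |∇_ξΦ| ≲ N₂ since ∇H is Lipschitz at the
frequencies ξ, ξ₁, both of size N₁ ≥ 1. -/
theorem bX_symb_of_small₂ (c : Conf N₁ N₂ w ξ η) (h : ∀ i, 64 * N₂ i ≤ N₁ i)
    (hN₁ : ∀ i, 1 ≤ N₁ i) {κ : ι → E → E → ℝ}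
    (hκ : Symb n η w (fun _ => 1) fun i y => κ i (ξ i - y) y) :
    Symb n η w (fun i => N₂ i / N₁ i) fun i => slice (bX (κ i)) (ξ i) := by
  have h1 := c.N₁_pos
  have h2 := c.N₂_pos
  have hw := c.w_pos
  have ha := fun i => (c.range i).low₁
  have ha' := fun i => (c.range i).up₁
  have hc := fun i => (c.range i).low₂
  have hc' := fun i => (c.range i).up₂
  refine c.bX_symb (L := N₁) (D := N₂) (C := 1) hκ ⟨.add ?_ ?_, h1, 1 / 64, by norm_num, ?_⟩
    (c.gradXi_symb (C := 256) (fun i => (h2 i).le) (fun i => ?_) (fun i => ?_) fun i => ?_)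
    (fun i => (div_pos (h2 i) (h1 i)).le) fun i => ?_
  · exact c.ell₂.gradH.mono 2 (fun i => (h1 i).le) fun i => by linarith [h i, hN₁ i]
  · exact c.ell₁.gradH.mono 2 (fun i => (h1 i).le) fun i => by linarith [h i, hN₁ i]
  · intro i
    have hca : ‖η i‖ ≤ ‖ξ i - η i‖ := by linarith [ha i, hc' i, h i, h2 i]
    have k1 := hh_sub_ge (c.ξ₁_ne i) (c.η_ne i) hca
    have k2 := hh_le (c.ξ₁_ne i)
    have k3 := hh_le (c.η_ne i)
    set X := hh (ξ i - η i) * ‖ξ i - η i‖ with hX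
    set Y := hh (η i) * ‖η i‖ with hY
    have hX0 : 0 ≤ X := mul_nonneg (hh_pos (c.ξ₁_ne i)).le (norm_nonneg _)
    have hY0 : 0 ≤ Y := mul_nonneg (hh_pos (c.η_ne i)).le (norm_nonneg _)
    have k4 : X - Y ≤ ‖hh (η i) • η i + hh (ξ i - η i) • (ξ i - η i)‖ := by
      have := norm_sub_le (hh (η i) • η i + hh (ξ i - η i) • (ξ i - η i)) (hh (η i) • η i)
      rw [add_sub_cancel_left, norm_hh_smul, norm_hh_smul] at this
      linarith
    refine le_trans ?_ k4
    have k5 : N₁ i ^ 2 / 17 ≤ ‖ξ i - η i‖ ^ 2 - ‖η i‖ ^ 2 := by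
      have e1 : (N₁ i / 4) ^ 2 ≤ ‖ξ i - η i‖ ^ 2 :=
        pow_le_pow_left₀ (by linarith [h1 i]) (by linarith [ha i]) 2
      have e2 : ‖η i‖ ^ 2 ≤ (N₁ i / 29) ^ 2 :=
        pow_le_pow_left₀ (norm_nonneg _) (by linarith [hc' i, h i, h1 i]) 2
      nlinarith [sq_nonneg (N₁ i)]
    have k6 : X + Y ≤ 9 * N₁ i := by linarith [ha' i, hc' i, h i, hN₁ i]
    by_contra hlt
    rw [not_le] at hlt
    have k7 : (X - Y) * (X + Y) ≤ 1 / 64 * N₁ i * (9 * N₁ i) :=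
      mul_le_mul hlt.le k6 (by positivity) (by linarith [h1 i])
    nlinarith [h1 i]
  · linarith [norm_total_le (ξ i) (η i), ha' i, hc' i, h i, h2 i]
  · have := c.w₂ i
    nlinarith [h1 i, hN₁ i]
  · have hr : N₁ i ≤ 8 * ‖ξ i‖ := by
      have := norm_sub_norm_le (ξ i - η i) (-η i)
      rw [norm_neg, sub_neg_eq_add, sub_add_cancel] at this
      linarith [ha i, hc' i, h i, h2 i]
    have hra : (‖ξ i‖ - ‖ξ i - η i‖) ^ 2 ≤ ‖η i‖ ^ 2 := by
      have := abs_norm_sub_norm_le (ξ i) (ξ i - η i)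
      rw [sub_sub_cancel] at this
      exact sq_le_sq' (by linarith [neg_le_of_abs_le this]) (le_of_abs_le this)
    have k1 : (hh (ξ i) * ‖ξ i‖ - hh (ξ i - η i) * ‖ξ i - η i‖) ^ 2 ≤ 4 * ‖η i‖ ^ 2 := by
      have := pow_le_pow_left₀ (abs_nonneg _) (abs_hh_sub_le (c.ξ_ne i) (c.ξ₁_ne i)) 2
      rw [sq_abs, mul_pow, sq_abs] at this
      linarith
    have b1 : hh (ξ i) ≤ 18 := by
      have := hh_le (c.ξ_ne i)
      have hp : 0 < ‖ξ i‖ := norm_pos_iff.2 (c.ξ_ne i)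
      refine le_of_mul_le_mul_right (this.trans ?_) hp
      linarith [hN₁ i]
    have b2 : hh (ξ i - η i) ≤ 10 := by
      have := hh_le (c.ξ₁_ne i)
      have hp : 0 < ‖ξ i - η i‖ := norm_pos_iff.2 (c.ξ₁_ne i)
      refine le_of_mul_le_mul_right (this.trans ?_) hp
      linarith [hN₁ i, ha i]
    have b3 : hh (ξ i) * hh (ξ i - η i) ≤ 18 * 10 :=
      mul_le_mul b1 b2 (hh_pos (c.ξ₁_ne i)).le (by norm_num)
    have k2 : ‖hh (ξ i) • ξ i - hh (ξ i - η i) • (ξ i - η i)‖ ^ 2 ≤ (256 * N₂ i) ^ 2 := by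
      rw [norm_gradH_sub_sq, sub_sub_cancel]
      have k3 : hh (ξ i) * hh (ξ i - η i) * (‖η i‖ ^ 2 - (‖ξ i‖ - ‖ξ i - η i‖) ^ 2) ≤
          18 * 10 * ‖η i‖ ^ 2 := by
        refine mul_le_mul b3 ?_ (by linarith) (by norm_num)
        linarith [sq_nonneg (‖ξ i‖ - ‖ξ i - η i‖)]
      have k4 : ‖η i‖ ^ 2 ≤ (3 * N₂ i) ^ 2 :=
        pow_le_pow_left₀ (norm_nonneg _) (by linarith [hc' i, h2 i]) 2
      nlinarith [h2 i]
    exact le_of_sq_le_sq k2 (by linarith [h2 i])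
  · have e1 : N₂ i / N₁ i * N₁ i = N₂ i := div_mul_cancel₀ _ (h1 i).ne'
    rw [e1]
    exact mul_le_mul_of_nonneg_right (U_le_one _) (h2 i).le

end Conf

theorem Symb.const_mul {ι V : Type*} [NormedAddCommGroup V] [NormedSpace ℝ V] {n : ℕ} {x : ι → V}
    {w M : ι → ℝ} {a : ι → V → ℝ} (ha : Symb n x w M a) (r : ℝ) :
    Symb n x w M fun i y => r * a i y :=
  ha.clm (ContinuousLinearMap.lsmul ℝ ℝ r : ℝ →L[ℝ] ℝ)

/-! ### Algebra of the angular multipliers. -/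

theorem inner_unit_smul_unit (ξ v : E) :
    (inner ℝ ξ (unit v)) • unit v = ((‖v‖ ^ 2)⁻¹ * inner ℝ ξ v) • v := by
  rw [unit, inner_smul_right, smul_smul]
  congr 1
  ring

/-- Each projection of ξ is only of order |ξ|. Over a common denominator every term of the
difference is at least quadratic in ξ, giving |ξ|²/N₂ when N₁ ∼ N₂; this gain matters when |ξ| ≪ N₂.
-/
theorem projection_sub_projection {ξ η : E} (h1 : ξ - η ≠ 0) (h2 : η ≠ 0) :
    (inner ℝ ξ (unit (ξ - η))) • unit (ξ - η) - (inner ℝ ξ (unit η)) • unit η =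
      ((‖ξ - η‖ ^ 2)⁻¹ * (‖η‖ ^ 2)⁻¹) • ((‖ξ‖ ^ 2 * ‖η‖ ^ 2) • (ξ - η) -
        (inner ℝ ξ η * ‖η‖ ^ 2) • ξ - (inner ℝ ξ η * ‖ξ‖ ^ 2) • η +
        (2 * (inner ℝ ξ η * inner ℝ ξ η)) • η) := by
  have hA : ‖ξ - η‖ ^ 2 ≠ 0 := pow_ne_zero 2 (norm_ne_zero_iff.2 h1)
  have hC : ‖η‖ ^ 2 ≠ 0 := pow_ne_zero 2 (norm_ne_zero_iff.2 h2)
  have hx : ‖ξ - η‖ ^ 2 = ‖ξ‖ ^ 2 - 2 * inner ℝ ξ η + ‖η‖ ^ 2 := norm_sub_sq_real ξ η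
  rw [inner_unit_smul_unit, inner_unit_smul_unit, inner_sub_right, real_inner_self_eq_norm_sq]
  generalize inner ℝ ξ η = x at *
  generalize ‖ξ - η‖ ^ 2 = A at *
  generalize ‖η‖ ^ 2 = C at *
  match_scalars
  · field_simp
  · field_simp
    rw [hx]
    ring

theorem slice_mAng_eq_zero {κ : E → E → ℝ} {ξ η : E} (h : ∀ᶠ y in nhds η, κ (ξ - y) y = 0) :
    ∀ᶠ y in nhds η, mAng κ (ξ - y) y = 0 := by
  filter_upwards [h] with y hy
  simp [mAng, hy]

theorem tensor_zero_left (v : E) : tensor 0 v = 0 := by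
  ext p
  simp [tensor]

namespace Conf

variable {ι : Type*} {n : ℕ} {N₁ N₂ w : ι → ℝ} {ξ η : ι → E}

theorem unit_ξ_symb (c : Conf N₁ N₂ w ξ η) : Symb n η w (fun _ => 1) fun i _ => unit (ξ i) :=
  c.const_symb 1 (fun _ => zero_le_one) fun i => by rw [norm_unit (c.ξ_ne i), one_mul]

theorem ξ_symb (c : Conf N₁ N₂ w ξ η) : Symb n η w (fun i => ‖ξ i‖) fun i _ => ξ i :=
  c.const_symb 1 (fun _ => norm_nonneg _) fun i => by rw [one_mul]

theorem norm_ξ_symb (c : Conf N₁ N₂ w ξ η) : Symb n η w (fun i => ‖ξ i‖) fun i _ => ‖ξ i‖ :=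
  c.const_symb 1 (fun _ => norm_nonneg _) fun i => by rw [one_mul, norm_norm]

theorem one_symb (c : Conf N₁ N₂ w ξ η) : Symb n η w (fun _ => 1) fun _ _ => (1 : ℝ) :=
  c.const_symb 1 (fun _ => zero_le_one) fun i => by norm_num

theorem mu_symb (c : Conf N₁ N₂ w ξ η) : Symb n η w (fun _ => 1) fun i y => mu (ξ i) y := by
  simpa only [mul_one] using! (c.unit_ξ_symb.inner c.ell₂.unit : Symb n η w _ _)

theorem perp_symb (c : Conf N₁ N₂ w ξ η) {N : ι → ℝ} {v : ι → E → E} (hv : Ell n η w N v) :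
    Symb n η w (fun i => ‖ξ i‖) fun i y => perp (ξ i) (v i y) := by
  refine c.ξ_symb.sub (((c.ξ_symb.inner hv.unit).smul hv.unit).mono 1
    (fun i => norm_nonneg _) fun i => ?_)
  rw [mul_one, mul_one, one_mul]

/-! ### The region `N₁ ∼ N₂ ≳ 1` -/

theorem norm_ξ_le_of_comparable (c : Conf N₁ N₂ w ξ η) (h12 : ∀ i, N₁ i ≤ 64 * N₂ i) (i : ι) :
    ‖ξ i‖ ≤ 143 * N₂ i := by
  linarith [norm_total_le (ξ i) (η i), (c.range i).up₁, (c.range i).up₂, h12 i]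

theorem gradXi_symb_of_comparable (c : Conf N₁ N₂ w ξ η) (h12 : ∀ i, N₁ i ≤ 64 * N₂ i)
    (hN₁ : ∀ i, 1 ≤ N₁ i) :
    Symb n η w N₂ fun i y => hh (ξ i) • ξ i - hh (ξ i - y) • (ξ i - y) := by
  have h2 := c.N₂_pos
  refine .sub (c.const_symb 500 (fun i => (h2 i).le) fun i => ?_)
    (c.ell₁.gradH.mono 128 (fun i => (h2 i).le) fun i => by linarith [h12 i, hN₁ i])
  rw [norm_hh_smul]
  linarith [hh_le (c.ξ_ne i), c.norm_ξ_le_of_comparable h12 i, h12 i, hN₁ i]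

theorem phaseFactor_symb_of_comparable (c : Conf N₁ N₂ w ξ η) (h12 : ∀ i, N₁ i ≤ 64 * N₂ i)
    (hN₁ : ∀ i, 1 ≤ N₁ i) :
    Symb n η w (fun i => N₂ i * N₂ i) fun i y => phaseFactor (ξ i) y := by
  have h2 := c.N₂_pos
  have hr := c.norm_ξ_le_of_comparable h12
  have hR : ∀ i, 0 ≤ N₂ i * N₂ i := fun i => mul_self_nonneg _
  have hone : ∀ i, 1 ≤ 64 * N₂ i := fun i => (hN₁ i).trans (h12 i)
  have kξ : Symb n η w N₂ fun i _ => ‖ξ i‖ := c.norm_ξ_symb.mono 143 (fun i => (h2 i).le) hr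
  have kη : Symb n η w N₂ fun _ y => ‖y‖ := c.ell₂.norm.symb
  have kj : Symb n η w N₂ fun i _ => jap (ξ i) := c.const_symb 300 (fun i => (h2 i).le) fun i => by
    rw [Real.norm_of_nonneg (jap_pos _).le]
    linarith [jap_le (ξ i), hr i, hone i]
  have kj' : Symb n η w N₂ fun _ y => jap y :=
    c.ell₂.jap.symb.mono 65 (fun i => (h2 i).le) fun i => by linarith [hone i]
  have k1 : Symb n η w (fun i => N₂ i * N₂ i) fun _ _ => (1 : ℝ) :=
    c.one_symb.mono (64 * 64) hR fun i => by nlinarith [hone i, h2 i]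
  have ks : Symb n η w (fun i => N₂ i * N₂ i) fun i y => ‖ξ i‖ ^ 2 + ‖y‖ ^ 2 + 1 := by
    simpa only [← sq] using ((kξ.mul kξ).add (kη.mul kη)).add (by simpa only [sq] using k1)
  have kx := kξ.mul kη
  refine (((kj.mul kj').sub kx).add (((c.mu_symb.const_mul 2).mul ks).mono 1 hR fun i => ?_)).sub
    (((kx.const_mul 2).mul (c.mu_symb.mul c.mu_symb)).mono 1 hR fun i => ?_) |>.congr
    fun i => Filter.Eventually.of_forall fun y => ?_
  · rw [one_mul]
  · rw [mul_one, mul_one, one_mul]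
  · simp only [phaseFactor]
    ring

/-- P ∼ N₂² and the sum of the three values of H is ≲ N₂², so 1/Φ ≲ 1/(|ξ|N₂). With |∇_ξΦ| ≲ N₂ the
size is U(ξ)/|ξ| ≤ 1. -/
theorem bT_symb_of_comparable (c : Conf N₁ N₂ w ξ η) (h12 : ∀ i, N₁ i ≤ 64 * N₂ i)
    (hN₁ : ∀ i, 1 ≤ N₁ i) {c₀ : ℝ} (hc₀ : 0 < c₀)
    (hP : ∀ i, c₀ * (N₂ i * N₂ i) ≤ |phaseFactor (ξ i) (η i)|) {κ : ι → E → E → ℝ}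
    (hκ : Symb n η w (fun _ => 1) fun i y => κ i (ξ i - y) y) :
    Symb n η w (fun _ => 1) fun i => slice (bT (κ i)) (ξ i) := by
  have h1 := c.N₁_pos
  have h2 := c.N₂_pos
  have hr := c.norm_ξ_le_of_comparable h12
  have hR : ∀ i, 0 < N₂ i * N₂ i := fun i => mul_pos (h2 i) (h2 i)
  have hone : ∀ i, 1 ≤ 64 * N₂ i := fun i => (hN₁ i).trans (h12 i)
  have hS : Symb n η w (fun i => N₂ i * N₂ i) fun i y => H (ξ i) + H y + H (ξ i - y) := by
    refine ((c.const_symb (143 * 300) (fun i => (hR i).le) fun i => ?_).add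
      (c.ell₂.H.symb.mono 65 (fun i => (hR i).le) fun i => ?_)).add
      (c.ell₁.H.symb.mono (64 * 128) (fun i => (hR i).le) fun i => ?_)
    · rw [Real.norm_of_nonneg (H_nonneg _)]
      calc H (ξ i) ≤ ‖ξ i‖ * (2 + ‖ξ i‖) := H_le _
        _ ≤ (143 * N₂ i) * (300 * N₂ i) :=
          mul_le_mul (hr i) (by linarith [hr i, hone i]) (by positivity) (by linarith [h2 i])
        _ = _ := by ring
    · nlinarith [hone i, h2 i]
    · nlinarith [hN₁ i, h12 i, h1 i, h2 i]
  refine c.bT_symb (C := 1) hκ (c.inv_Φ_symb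
    ⟨c.phaseFactor_symb_of_comparable h12 hN₁, hR, c₀, hc₀, hP⟩ hS)
    (c.gradXi_symb_of_comparable h12 hN₁) (fun _ => zero_le_one) fun i => ?_
  have hp : 0 < ‖ξ i‖ := norm_pos_iff.2 (c.ξ_ne i)
  have h2' := h2 i
  have e1 : (‖ξ i‖ * N₂ i * (N₂ i * N₂ i))⁻¹ * (N₂ i * N₂ i) * N₂ i = ‖ξ i‖⁻¹ := by
    field_simp
  rw [e1, one_mul, ← div_eq_mul_inv, div_le_one hp]
  exact U_le_norm _

/-- For N₁ ≥ 1 the factor `hh` at ξ₁ is of order 1, so the denominator is of order |ξ|²; U(ξ) and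
|∇_ξΦ| ≲ N₂ make up the numerator. -/
theorem mAng_symb (c : Conf N₁ N₂ w ξ η) (h12 : ∀ i, N₁ i ≤ 64 * N₂ i)
    (hN₁ : ∀ i, 1 ≤ N₁ i) {c₀ : ℝ} (hc₀ : 0 < c₀)
    (hmu : ∀ i, c₀ ≤ 1 - mu (ξ i) (η i) ^ 2) {κ : ι → E → E → ℝ}
    (hκ : Symb n η w (fun _ => 1) fun i y => κ i (ξ i - y) y) :
    Symb n η w (fun i => U (ξ i) * N₂ i / ‖ξ i‖ ^ 2) fun i y => mAng (κ i) (ξ i - y) y := by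
  have h1 := c.N₁_pos
  have h2 := c.N₂_pos
  have hp : ∀ i, 0 < ‖ξ i‖ := fun i => norm_pos_iff.2 (c.ξ_ne i)
  have kh : Ell n η w (fun _ => 1) fun i y => hh (ξ i - y) :=
    c.ell₁.hh.resize 2 1 (fun _ => one_pos)
      (fun i => by rw [div_le_iff₀ (h1 i)]; linarith [hN₁ i])
      fun i => by rw [one_mul, le_div_iff₀ (h1 i)]; linarith
  have kd : Ell n η w (fun i => ‖ξ i‖ ^ 2) fun i y => ‖ξ i‖ ^ 2 * (1 - mu (ξ i) y ^ 2) := by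
    refine .of_pos_lower ((c.const_symb (n := n) (a := fun i => ‖ξ i‖ ^ 2) 1
      (M := fun i => ‖ξ i‖ ^ 2) (fun i => by positivity) fun i => by simp).mul
      (c.one_symb.sub ((c.mu_symb.mul c.mu_symb).mono (M' := fun _ => 1) 1
        (fun _ => zero_le_one) fun i => by norm_num)) |>.mono 1 (fun i => by positivity)
        (fun i => by rw [mul_one, one_mul]) |>.congr fun i =>
        Filter.Eventually.of_forall fun y => by ring) (fun i => by have := hp i; positivity) hc₀
        fun i => ?_
    rw [mul_comm]
    exact mul_le_mul_of_nonneg_left (hmu i) (by positivity)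
  have kinv := (kh.mul kd).inv
  have k := ((hκ.mul (c.const_symb (n := n) (a := fun i => U (ξ i)) (M := fun i => U (ξ i)) 1
    (fun i => U_nonneg _) fun i => by
      rw [Real.norm_of_nonneg (U_nonneg _), one_mul])).mul kinv.symb).smul
    (c.gradXi_symb_of_comparable h12 hN₁)
  refine (k.mono 1 (fun i => ?_) fun i => ?_).congr fun i => ?_
  · have := h2 i
    have := U_nonneg (ξ i)
    positivity
  · refine le_of_eq ?_
    have := (hp i).ne'
    field_simp
  · filter_upwards [c.slice_gradXi i, c.eventually_ne i] with y hy hne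
    rw [mAng, hy, sub_add_cancel, gradient_H hne.2, inner_perp_gradH (c.ξ_ne i) hne.1,
      div_eq_mul_inv]

/-- The quantities paired with m are of size |ξ|/N or |ξ|²/N, the former also for ξ^{⊥₂} after a
divergence. The bounds U(ξ) ≤ |ξ| and U(ξ) ≤ 1 then suffice. -/
theorem size_div_le_one (ζ : E) (h : ζ ≠ 0) {N : ℝ} (hN : 0 < N) :
    U ζ * N / ‖ζ‖ ^ 2 * (‖ζ‖ / N) ≤ 1 ∧ U ζ * N / ‖ζ‖ ^ 2 * (‖ζ‖ ^ 2 / N) ≤ 1 := by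
  have hp : 0 < ‖ζ‖ := norm_pos_iff.2 h
  have e1 : U ζ * N / ‖ζ‖ ^ 2 * (‖ζ‖ / N) = U ζ / ‖ζ‖ := by
    field_simp
  have e2 : U ζ * N / ‖ζ‖ ^ 2 * (‖ζ‖ ^ 2 / N) = U ζ := by
    field_simp
  rw [e1, e2, div_le_one hp]
  exact ⟨U_le_norm ζ, U_le_one ζ⟩

theorem bAng_symb (c : Conf N₁ N₂ w ξ η) (h12 : ∀ i, N₁ i ≤ 64 * N₂ i)
    (hN₁ : ∀ i, 1 ≤ N₁ i) {c₀ : ℝ} (hc₀ : 0 < c₀)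
    (hmu : ∀ i, c₀ ≤ 1 - mu (ξ i) (η i) ^ 2) {κ : ι → E → E → ℝ} (hw : ∀ i, N₂ i * w i ≤ 1)
    (hκ : Symb (n + 1) η w (fun _ => 1) fun i y => κ i (ξ i - y) y) :
    Symb n η w (fun _ => 1) fun i => slice (bAng (κ i)) (ξ i) := by
  have h2 := c.N₂_pos
  have hW := c.w_pos
  have k := ((c.mAng_symb h12 hN₁ hc₀ hmu hκ).tensor (c.perp_symb c.ell₂)).mono
    (M' := fun i => N₂ i) 1 (fun i => (h2 i).le) fun i => by
      have h3 := (size_div_le_one (ξ i) (c.ξ_ne i) (h2 i)).1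
      rwa [← mul_div_assoc, div_le_iff₀ (h2 i)] at h3
  have k2 : Symb (n + 1) η w N₂ fun i => slice
      (fun ξ₁ ξ₂ => tensor (mAng (κ i) ξ₁ ξ₂) (perp (ξ₁ + ξ₂) ξ₂)) (ξ i) := by
    refine k.congr fun i => Filter.Eventually.of_forall fun y => ?_
    simp only [slice, sub_add_cancel]
  exact k2.divXi₂.mono 1 (fun _ => zero_le_one) fun i => by linarith [hw i]

theorem bAng₁_symb (c : Conf N₁ N₂ w ξ η) (h12 : ∀ i, N₁ i ≤ 64 * N₂ i)
    (h21 : ∀ i, N₂ i ≤ 64 * N₁ i)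
    (hN₁ : ∀ i, 1 ≤ N₁ i) {c₀ : ℝ} (hc₀ : 0 < c₀)
    (hmu : ∀ i, c₀ ≤ 1 - mu (ξ i) (η i) ^ 2) {κ : ι → E → E → ℝ}
    (hκ : Symb n η w (fun _ => 1) fun i y => κ i (ξ i - y) y) :
    Symb n η w (fun _ => 1) fun i => slice (bAng₁ (κ i)) (ξ i) := by
  have h2 := c.N₂_pos
  have e₁ : Ell n η w N₂ fun i y => ξ i - y := c.ell₁.resize 64 64 h2 h12 h21
  have k := (c.mAng_symb h12 hN₁ hc₀ hmu hκ).tensor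
    ((e₁.norm.mul e₁.norm).inv.symb.smul (e₁.symb.cross (c.perp_symb e₁)))
  refine (k.mono 1 (fun _ => zero_le_one) fun i => ?_).congr
    fun i => Filter.Eventually.of_forall fun y => ?_
  · refine le_trans (le_of_eq ?_) ((size_div_le_one (ξ i) (c.ξ_ne i) (h2 i)).1.trans_eq
      (one_mul 1).symm)
    have := (h2 i).ne'
    field_simp
  · simp only [slice, bAng₁, sub_add_cancel, sq]

theorem bAng₂_symb (c : Conf N₁ N₂ w ξ η) (h12 : ∀ i, N₁ i ≤ 64 * N₂ i)
    (hN₁ : ∀ i, 1 ≤ N₁ i) {c₀ : ℝ} (hc₀ : 0 < c₀)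
    (hmu : ∀ i, c₀ ≤ 1 - mu (ξ i) (η i) ^ 2) {κ : ι → E → E → ℝ}
    (hκ : Symb n η w (fun _ => 1) fun i y => κ i (ξ i - y) y) :
    Symb n η w (fun _ => 1) fun i => slice (bAng₂ (κ i)) (ξ i) := by
  have h2 := c.N₂_pos
  have e₂ : Ell n η w N₂ fun _ y => y := c.ell₂
  have k := (c.mAng_symb h12 hN₁ hc₀ hmu hκ).tensor
    ((e₂.norm.mul e₂.norm).inv.symb.smul (e₂.symb.cross (c.perp_symb e₂)))
  refine (k.mono 1 (fun _ => zero_le_one) fun i => ?_).congr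
    fun i => Filter.Eventually.of_forall fun y => ?_
  · refine le_trans (le_of_eq ?_) ((size_div_le_one (ξ i) (c.ξ_ne i) (h2 i)).1.trans_eq
      (one_mul 1).symm)
    have := (h2 i).ne'
    field_simp
  · simp only [slice, bAng₂, sub_add_cancel, sq]

theorem bAngTilde_symb (c : Conf N₁ N₂ w ξ η) (h12 : ∀ i, N₁ i ≤ 64 * N₂ i)
    (h21 : ∀ i, N₂ i ≤ 64 * N₁ i)
    (hN₁ : ∀ i, 1 ≤ N₁ i) {c₀ : ℝ} (hc₀ : 0 < c₀)
    (hmu : ∀ i, c₀ ≤ 1 - mu (ξ i) (η i) ^ 2) {κ : ι → E → E → ℝ}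
    (hκ : Symb n η w (fun _ => 1) fun i y => κ i (ξ i - y) y) :
    Symb n η w (fun _ => 1) fun i => slice (bAngTilde (κ i)) (ξ i) := by
  have h2 := c.N₂_pos
  have hr := c.norm_ξ_le_of_comparable h12
  have e₁ : Ell n η w N₂ fun i y => ξ i - y := c.ell₁.resize 64 64 h2 h12 h21
  have e₂ : Ell n η w N₂ fun _ y => y := c.ell₂
  have kx : Symb n η w (fun i => ‖ξ i‖ * N₂ i) fun i y => inner ℝ (ξ i) y :=
    c.ξ_symb.inner e₂.symb
  have hJ : ∀ i, 0 ≤ ‖ξ i‖ ^ 2 * N₂ i ^ 3 := fun i => by have := h2 i; positivity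
  have kξ2 : Symb n η w (fun i => ‖ξ i‖ * ‖ξ i‖) fun i _ => ‖ξ i‖ * ‖ξ i‖ :=
    c.norm_ξ_symb.mul c.norm_ξ_symb
  have t1 := ((kξ2.mul (e₂.norm.symb.mul e₂.norm.symb)).smul e₁.symb).mono 1 hJ
    fun i => le_of_eq (by ring)
  have t2 := ((kx.mul (e₂.norm.symb.mul e₂.norm.symb)).smul c.ξ_symb).mono 1 hJ
    fun i => le_of_eq (by ring)
  have t3 := ((kx.mul kξ2).smul e₂.symb).mono 143 hJ fun i => by
    have h3 := mul_le_mul_of_nonneg_left (hr i)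
      (by have := h2 i; positivity : 0 ≤ ‖ξ i‖ ^ 2 * N₂ i ^ 2)
    calc ‖ξ i‖ * N₂ i * (‖ξ i‖ * ‖ξ i‖) * N₂ i = ‖ξ i‖ ^ 2 * N₂ i ^ 2 * ‖ξ i‖ := by ring
      _ ≤ _ := h3
      _ = _ := by ring
  have t4 := (((kx.mul kx).const_mul 2).smul e₂.symb).mono 1 hJ fun i => le_of_eq (by ring)
  have kb := ((e₁.norm.mul e₁.norm).inv.symb.mul (e₂.norm.mul e₂.norm).inv.symb).smul
    (((t1.sub t2).sub t3).add t4)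
  have k := (c.mAng_symb h12 hN₁ hc₀ hmu hκ).tensor kb
  refine (k.mono 1 (fun _ => zero_le_one) fun i => ?_).congr fun i => ?_
  · refine le_trans (le_of_eq ?_) ((size_div_le_one (ξ i) (c.ξ_ne i) (h2 i)).2.trans_eq
      (one_mul 1).symm)
    have := (h2 i).ne'
    field_simp
  · filter_upwards [c.eventually_ne i] with y hy
    simp only [slice, bAngTilde, sub_add_cancel, projection_sub_projection hy.2 hy.1, sq]

end Conf

/-! ### The region `N₂ ≲ N₁ ≲ 1` -/

/-- Rationalise and use hh² = 4(1 + 1/H²). The difference of the values of H² contains |u-v|² - |v|²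
= |u|² - 2u·v, which exposes a factor |u|. -/
theorem hh_sub_hh {u v : E} (hv : v ≠ 0) (h : u - v ≠ 0) :
    hh v - hh (u - v) = 4 * (‖u‖ * ‖u‖ - 2 * inner ℝ u v) * (2 + ‖u - v‖ ^ 2 + ‖v‖ ^ 2) *
      (H (u - v) * H (u - v) * (H v * H v) * (hh v + hh (u - v)))⁻¹ := by
  have h1 := hh_sq hv
  have h2 := hh_sq h
  have h3 := H_sq v
  have h4 := H_sq (u - v)
  have h5 := hh_pos hv
  have h6 := hh_pos h
  have h7 : 0 < H v := mul_pos (norm_pos_iff.2 hv) (jap_pos v)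
  have h8 : 0 < H (u - v) := mul_pos (norm_pos_iff.2 h) (jap_pos _)
  have h9 : ‖u‖ * ‖u‖ - 2 * inner ℝ u v = ‖u - v‖ ^ 2 - ‖v‖ ^ 2 := by
    rw [norm_sub_sq_real]
    ring
  rw [h9, ← div_eq_mul_inv, eq_div_iff (by positivity)]
  have e1 : hh v ^ 2 * H v ^ 2 = 4 * (H v ^ 2 + 1) := by
    rw [h1]
    field_simp
  have e2 : hh (u - v) ^ 2 * H (u - v) ^ 2 = 4 * (H (u - v) ^ 2 + 1) := by
    rw [h2]
    field_simp
  linear_combination H (u - v) ^ 2 * e1 - H v ^ 2 * e2 + 4 * h4 - 4 * h3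

section Sizes

variable {N₁ N₂ l : ℝ} {ξ η : E}

/-- With r = |u|, s = |v|, a = |u-v|, the angular bracket factors as (s-r+a)(r+s-a). The second
factor is governed by `triangle_defect`, the first is at most 2s. -/
theorem defect_bound {u v : E} (hu : u ≠ 0) (hv : v ≠ 0) (huv : u - v ≠ 0) {B : ℝ}
    (hB : hh u * ‖u‖ * (hh (u - v) * ‖u - v‖) ≤ B) :
    hh u * hh (u - v) * (‖v‖ ^ 2 - (‖u‖ - ‖u - v‖) ^ 2) * ‖u - v‖ ^ 2 ≤
      4 * B * (‖v‖ ^ 2 * (1 + mu u v)) := by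
  have n1 := norm_total_le u v
  have n3 : ‖v‖ ≤ ‖u‖ + ‖u - v‖ := by
    have := norm_sub_le u (u - v)
    rwa [sub_sub_cancel] at this
  have n2 : ‖u - v‖ ≤ ‖u‖ + ‖v‖ := norm_sub_le _ _
  have tri := triangle_defect hu hv
  have hν : 0 ≤ 1 + mu u v := by linarith [neg_one_le_mu hu hv]
  have p1 := hh_pos hu
  have p2 := hh_pos huv
  have a1 := norm_pos_iff.2 hu
  have a2 := norm_pos_iff.2 hv
  have a3 := norm_pos_iff.2 huv
  generalize hh u = P at *
  generalize hh (u - v) = Q at *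
  generalize mu u v = m at *
  generalize ‖u - v‖ = a at *
  generalize ‖u‖ = r at *
  generalize ‖v‖ = s at *
  have hD : 0 ≤ P * Q * (s ^ 2 - (r - a) ^ 2) := by
    have : s ^ 2 - (r - a) ^ 2 = (s - r + a) * (s + r - a) := by ring
    rw [this]
    have := mul_nonneg (by linarith : 0 ≤ s - r + a) (by linarith : 0 ≤ s + r - a)
    positivity
  calc P * Q * (s ^ 2 - (r - a) ^ 2) * a ^ 2 ≤
      P * Q * (s ^ 2 - (r - a) ^ 2) * ((r + s + a) * a) := by
        refine mul_le_mul_of_nonneg_left ?_ hD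
        nlinarith
    _ = P * Q * a * (s - r + a) * ((r + s - a) * (r + s + a)) := by ring
    _ = P * Q * a * (s - r + a) * (2 * (r * s) * (1 + m)) := by rw [tri]
    _ ≤ P * Q * a * (2 * s) * (2 * (r * s) * (1 + m)) := by
        refine mul_le_mul_of_nonneg_right ?_ (by positivity)
        exact mul_le_mul_of_nonneg_left (by linarith) (by positivity)
    _ = 4 * (P * r * (Q * a)) * (s ^ 2 * (1 + m)) := by ring
    _ ≤ 4 * B * (s ^ 2 * (1 + m)) := mul_le_mul_of_nonneg_right (by linarith) (by positivity)

/-- The radial part of ∇_ξΦ is ≲ N₁N₂ because H' is flat near 0, and the angular part is ≲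
N₂√(1+μ)/N₁ by `defect_bound`. Both are ≲ N₂l/N₁. -/
theorem norm_sub_le_of_triangle (h1 : 0 < N₁) (hN : N₁ ≤ 1) (h2 : 0 < N₂) (h21 : N₂ ≤ 64 * N₁)
    (hl : 0 < l) (hls : l ^ 2 = 1 + mu ξ η + N₁ ^ 2) (hξ : ξ ≠ 0) (h : InRange N₁ N₂ ξ η) :
    ‖hh ξ • ξ - hh (ξ - η) • (ξ - η)‖ ≤ 3000 * (N₂ * l / N₁) := by
  obtain ⟨k1, k2, k3, k4⟩ := h
  have hη : η ≠ 0 := norm_pos_iff.1 (by linarith)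
  have hξη : ξ - η ≠ 0 := norm_pos_iff.1 (by linarith)
  have n1 := norm_total_le ξ η
  have hν : 0 ≤ 1 + mu ξ η := by linarith [neg_one_le_mu hξ hη]
  have hNl : N₁ ≤ l := le_of_sq_le_sq (by linarith) hl.le
  have hd := abs_hh_sub_le_sq hξ hξη
  have hB : hh ξ * ‖ξ‖ * (hh (ξ - η) * ‖ξ - η‖) ≤ 288 * 7 := by
    have := (hh_pos hξη).le
    exact mul_le_mul (by linarith [hh_le hξ]) (by linarith [hh_le hξη]) (by positivity)
      (by norm_num)
  have hdef := defect_bound hξ hη hξη hB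
  have hZ : 0 ≤ N₂ * l / N₁ := by positivity
  refine le_of_sq_le_sq ?_ (by positivity)
  have hsq := norm_gradH_sub_sq ξ (ξ - η)
  rw [sub_sub_cancel] at hsq
  rw [hsq]
  have hra : |‖ξ‖ - ‖ξ - η‖| ≤ ‖η‖ := by
    have := abs_norm_sub_norm_le ξ (ξ - η)
    rwa [sub_sub_cancel] at this
  have t1 : |hh ξ * ‖ξ‖ - hh (ξ - η) * ‖ξ - η‖| ≤ 700 * (N₂ * l / N₁) := by
    have e : |‖ξ‖ ^ 2 - ‖ξ - η‖ ^ 2| = |‖ξ‖ - ‖ξ - η‖| * (‖ξ‖ + ‖ξ - η‖) := by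
      rw [sq_sub_sq, abs_mul, abs_of_nonneg (by positivity : 0 ≤ ‖ξ‖ + ‖ξ - η‖), mul_comm]
    have e2 : |‖ξ‖ - ‖ξ - η‖| * (‖ξ‖ + ‖ξ - η‖) ≤ (11 / 5 * N₂) * (146 * N₁) :=
      mul_le_mul (by linarith) (by linarith) (by positivity) (by positivity)
    have e3 : N₂ * N₁ ≤ N₂ * l / N₁ := by
      rw [le_div_iff₀ h1, mul_assoc]
      refine mul_le_mul_of_nonneg_left ?_ h2.le
      nlinarith
    rw [e] at hd
    linarith
  have t2 : hh ξ * hh (ξ - η) * (‖η‖ ^ 2 - (‖ξ‖ - ‖ξ - η‖) ^ 2) ≤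
      1000000 * (N₂ * l / N₁) ^ 2 := by
    have e1 : N₁ ^ 2 / 16 ≤ ‖ξ - η‖ ^ 2 := by nlinarith
    have e2 : ‖η‖ ^ 2 * (1 + mu ξ η) ≤ (11 / 5 * N₂) ^ 2 * l ^ 2 :=
      mul_le_mul (pow_le_pow_left₀ (norm_nonneg _) (by linarith) 2)
        (by linarith [sq_nonneg N₁]) hν (by positivity)
    have e0 : 0 ≤ hh ξ * hh (ξ - η) * (‖η‖ ^ 2 - (‖ξ‖ - ‖ξ - η‖) ^ 2) := by
      have := hh_pos hξ
      have := hh_pos hξη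
      have : (‖ξ‖ - ‖ξ - η‖) ^ 2 ≤ ‖η‖ ^ 2 := by
        rw [← sq_abs]
        exact pow_le_pow_left₀ (abs_nonneg _) hra 2
      have := sub_nonneg.2 this
      positivity
    have e3 := (mul_le_mul_of_nonneg_left e1 e0).trans hdef
    rw [div_pow, mul_pow, ← mul_div_assoc, le_div_iff₀ (by positivity)]
    have : 0 ≤ N₂ ^ 2 * l ^ 2 := by positivity
    nlinarith
  have t3 := pow_le_pow_left₀ (abs_nonneg _) t1 2
  rw [sq_abs] at t3
  nlinarith

/-- By oddness of ∇H the preceding argument applies to the points η and η-ξ, with |ξ| in place of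
|η| as their distance. -/
theorem norm_add_le_of_triangle (h1 : 0 < N₁) (hN : N₁ ≤ 1) (h2 : 0 < N₂)
    (h21 : N₂ ≤ 64 * N₁) (hl : 0 < l) (hls : l ^ 2 = 1 + mu ξ η + N₁ ^ 2) (hξ : ξ ≠ 0)
    (h : InRange N₁ N₂ ξ η) :
    ‖hh η • η + hh (ξ - η) • (ξ - η)‖ ≤ 1000 * (‖ξ‖ * l / N₁) := by
  obtain ⟨k1, k2, k3, k4⟩ := h
  have hη : η ≠ 0 := norm_pos_iff.1 (by linarith)
  have hξη : ξ - η ≠ 0 := norm_pos_iff.1 (by linarith)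
  have hηξ : η - ξ ≠ 0 := by rwa [← neg_sub, neg_ne_zero]
  have n1 := norm_total_le ξ η
  have hν : 0 ≤ 1 + mu ξ η := by linarith [neg_one_le_mu hξ hη]
  have hNl : N₁ ≤ l := le_of_sq_le_sq (by linarith) hl.le
  have hd := abs_hh_sub_le_sq hη hηξ
  have hr : 0 < ‖ξ‖ := norm_pos_iff.2 hξ
  have hB : hh η * ‖η‖ * (hh (η - ξ) * ‖η - ξ‖) ≤ 284 * 7 := by
    have := (hh_pos hηξ).le
    exact mul_le_mul (by linarith [hh_le hη])
      (by linarith [hh_le hηξ, norm_sub_rev ξ η]) (by positivity) (by norm_num)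
  have hdef := defect_bound hη hξ hηξ hB
  have hcomm : mu η ξ = mu ξ η := real_inner_comm _ _
  rw [hcomm] at hdef
  have hsq := norm_gradH_sub_sq η (η - ξ)
  rw [sub_sub_cancel] at hsq
  have hZ : 0 ≤ ‖ξ‖ * l / N₁ := by positivity
  have hra : |‖η‖ - ‖η - ξ‖| ≤ ‖ξ‖ := by
    have := abs_norm_sub_norm_le η (η - ξ)
    rwa [sub_sub_cancel] at this
  rw [gradH_sub_neg]
  rw [norm_sub_rev ξ η] at k1 k2 n1
  have p1 := hh_pos hη
  have p2 := hh_pos hηξ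
  refine le_of_sq_le_sq ?_ (by positivity)
  rw [hsq]
  have t1 : |hh η * ‖η‖ - hh (η - ξ) * ‖η - ξ‖| ≤ 300 * (‖ξ‖ * l / N₁) := by
    have e : |‖η‖ ^ 2 - ‖η - ξ‖ ^ 2| = |‖η‖ - ‖η - ξ‖| * (‖η‖ + ‖η - ξ‖) := by
      rw [sq_sub_sq, abs_mul, abs_of_nonneg (by positivity : 0 ≤ ‖η‖ + ‖η - ξ‖), mul_comm]
    have e2 : |‖η‖ - ‖η - ξ‖| * (‖η‖ + ‖η - ξ‖) ≤ ‖ξ‖ * (144 * N₁) :=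
      mul_le_mul hra (by linarith) (by positivity) (by positivity)
    have e3 : ‖ξ‖ * N₁ ≤ ‖ξ‖ * l / N₁ := by
      rw [le_div_iff₀ h1, mul_assoc]
      refine mul_le_mul_of_nonneg_left ?_ hr.le
      nlinarith
    rw [e] at hd
    linarith
  have t2 : hh η * hh (η - ξ) * (‖ξ‖ ^ 2 - (‖η‖ - ‖η - ξ‖) ^ 2) ≤
      500000 * (‖ξ‖ * l / N₁) ^ 2 := by
    have e1 : N₁ ^ 2 / 16 ≤ ‖η - ξ‖ ^ 2 := by nlinarith
    have e2 : ‖ξ‖ ^ 2 * (1 + mu ξ η) ≤ ‖ξ‖ ^ 2 * l ^ 2 :=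
      mul_le_mul_of_nonneg_left (by linarith [sq_nonneg N₁]) (by positivity)
    have e0 : 0 ≤ hh η * hh (η - ξ) * (‖ξ‖ ^ 2 - (‖η‖ - ‖η - ξ‖) ^ 2) := by
      have : (‖η‖ - ‖η - ξ‖) ^ 2 ≤ ‖ξ‖ ^ 2 := by
        rw [← sq_abs]
        exact pow_le_pow_left₀ (abs_nonneg _) hra 2
      have := sub_nonneg.2 this
      positivity
    have e3 := (mul_le_mul_of_nonneg_left e1 e0).trans hdef
    rw [div_pow, mul_pow, ← mul_div_assoc, le_div_iff₀ (by positivity)]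
    have : 0 ≤ ‖ξ‖ ^ 2 * l ^ 2 := by positivity
    nlinarith
  have t3 := pow_le_pow_left₀ (abs_nonneg _) t1 2
  rw [sq_abs] at t3
  nlinarith
-- The radial part is discarded. The angular part is bounded below by H' ≥ 1 and the triangle
-- identity, and `hnu` replaces 1 + μ by l² up to a constant.
theorem le_norm_add_of_triangle (h1 : 0 < N₁) (h2 : 0 < N₂)
    (h21 : N₂ ≤ 64 * N₁) (hl : 0 < l) (hξ : ξ ≠ 0)
    (h : InRange N₁ N₂ ξ η)
    (hmu : mu ξ η ≤ 1 / 2) (hnu : l ^ 2 ≤ 2 * 10 ^ 7 * (1 + mu ξ η)) :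
    1 / 10 ^ 6 * (‖ξ‖ * l / N₁) ≤ ‖hh η • η + hh (ξ - η) • (ξ - η)‖ := by
  obtain ⟨k1, k2, k3, k4⟩ := h
  have hη : η ≠ 0 := norm_pos_iff.1 (by linarith)
  have hξη : ξ - η ≠ 0 := norm_pos_iff.1 (by linarith)
  have hηξ : η - ξ ≠ 0 := by rwa [← neg_sub, neg_ne_zero]
  have n1 := norm_total_le ξ η
  have hν : 0 ≤ 1 + mu ξ η := by linarith [neg_one_le_mu hξ hη]
  have hr : 0 < ‖ξ‖ := norm_pos_iff.2 hξ
  have hB' : 1 ≤ hh η * ‖η‖ * (hh (η - ξ) * ‖η - ξ‖) := by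
    have := one_le_hh hη
    have := one_le_hh hηξ
    nlinarith
  have hsq := norm_gradH_sub_sq η (η - ξ)
  rw [sub_sub_cancel] at hsq
  have hZ : 0 ≤ ‖ξ‖ * l / N₁ := by positivity
  have hra : |‖η‖ - ‖η - ξ‖| ≤ ‖ξ‖ := by
    have := abs_norm_sub_norm_le η (η - ξ)
    rwa [sub_sub_cancel] at this
  rw [gradH_sub_neg]
  have tri := triangle_defect hξ hη
  have hlaw := norm_sub_sq_mu hξ hη
  rw [norm_sub_rev ξ η] at k1 k2 n1 tri hlaw
  have p1 := hh_pos hη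
  have p2 := hh_pos hηξ
  refine le_of_sq_le_sq ?_ (norm_nonneg _)
  rw [hsq]
  have hs0 : 0 < ‖η‖ := norm_pos_iff.2 hη
  have ha0 : 0 < ‖η - ξ‖ := norm_pos_iff.2 hηξ
  have n2 : ‖η - ξ‖ ≤ ‖η‖ + ‖ξ‖ := norm_sub_le _ _
  generalize hh η = P at *
  generalize hh (η - ξ) = Q at *
  generalize mu ξ η = m at *
  generalize ‖η - ξ‖ = a at *
  generalize ‖ξ‖ = r at *
  generalize ‖η‖ = s at *
  -- This uses μ ≤ 1/2: if a < s - r/2, squaring contradicts a² ≥ r² + s² - rs.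
  have hge : r / 2 ≤ r - s + a := by
    by_contra hlt
    have h3 : a < s - r / 2 := by linarith
    have h4 : a ^ 2 < (s - r / 2) ^ 2 := pow_lt_pow_left₀ h3 ha0.le (by norm_num)
    nlinarith [mul_le_mul_of_nonneg_left hmu (mul_pos hr hs0).le]
  have key : r ^ 2 * (1 + m) ≤ P * Q * (r ^ 2 - (s - a) ^ 2) * (a * (r + s + a)) := by
    calc r ^ 2 * (1 + m) ≤ (P * s * (Q * a)) * (r ^ 2 * (1 + m)) :=
          le_mul_of_one_le_left (by positivity) hB'
      _ = P * Q * a * (r / 2) * (2 * (r * s) * (1 + m)) := by ring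
      _ ≤ P * Q * a * (r - s + a) * (2 * (r * s) * (1 + m)) := by
          refine mul_le_mul_of_nonneg_right ?_ (by positivity)
          exact mul_le_mul_of_nonneg_left hge (by positivity)
      _ = P * Q * a * (r - s + a) * ((r + s - a) * (r + s + a)) := by rw [tri]
      _ = _ := by ring
  have hup : a * (r + s + a) ≤ 640 * N₁ ^ 2 := by
    have : a * (r + s + a) ≤ (11 / 5 * N₁) * (287 * N₁) :=
      mul_le_mul (by linarith) (by linarith) (by positivity) (by positivity)
    nlinarith
  have hD : 0 ≤ P * Q * (r ^ 2 - (s - a) ^ 2) := by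
    have : r ^ 2 - (s - a) ^ 2 = (r - s + a) * (r + s - a) := by ring
    rw [this]
    have := mul_nonneg (by linarith : 0 ≤ r - s + a) (by linarith : 0 ≤ r + s - a)
    positivity
  have k5 := key.trans (mul_le_mul_of_nonneg_left hup hD)
  have k6 : (1 / 10 ^ 6 * (r * l / N₁)) ^ 2 ≤ P * Q * (r ^ 2 - (s - a) ^ 2) := by
    rw [mul_pow, div_pow (r * l), mul_pow, ← mul_div_assoc, div_le_iff₀ (by positivity)]
    have := mul_le_mul_of_nonneg_left hnu (sq_nonneg r)
    have : 0 ≤ r ^ 2 * (1 + m) := by positivity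
    linarith
  linarith [sq_nonneg (P * s - Q * a)]

/-- For μ ≥ 1/4 the factor is at least 1/2. Otherwise N₁/4 ≤ |ξ| + |η| ≤ 284, and 10⁷ is large
enough, as 32(2 + 2·284²) < 10⁷ - 1, for `phaseFactor_le` to apply. -/
theorem le_abs_phaseFactor (h1 : 0 < N₁) (hN : N₁ ≤ 1) (h21 : N₂ ≤ 64 * N₁)
    (hξ : ξ ≠ 0) (hη : η ≠ 0) (h : InRange N₁ N₂ ξ η)
    (hm : 1 / 4 ≤ mu ξ η ∨ (10 ^ 7 - 1) * (1 + mu ξ η) ≤ N₁ ^ 2) :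
    1 / 32 * (1 + mu ξ η + N₁ ^ 2) ≤ |phaseFactor ξ η| := by
  have hN2 : N₁ ^ 2 ≤ 1 := by nlinarith
  rcases hm with hm | hm
  · refine le_trans ?_ (le_abs_self _)
    refine le_trans ?_ (phaseFactor_ge hξ hη (by linarith))
    have := mu_le_one hξ hη
    nlinarith [sq_nonneg ‖ξ‖, sq_nonneg ‖η‖]
  · obtain ⟨k1, k2, k3, k4⟩ := h
    have n1 := norm_total_le ξ η
    have n2 : ‖ξ - η‖ ≤ ‖ξ‖ + ‖η‖ := norm_sub_le _ _
    have hν : 0 ≤ 1 + mu ξ η := by linarith [neg_one_le_mu hξ hη]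
    have e1 : (N₁ / 4) ^ 2 ≤ (‖ξ‖ + ‖η‖) ^ 2 := pow_le_pow_left₀ (by positivity) (by linarith) 2
    have e2 : (‖ξ‖ + ‖η‖) ^ 2 ≤ 284 ^ 2 := pow_le_pow_left₀ (by positivity) (by linarith) 2
    have k := phaseFactor_le (ξ := ξ) (η := η) (by
      have : (1 + mu ξ η) * (2 + 2 * (‖ξ‖ + ‖η‖) ^ 2) ≤ (1 + mu ξ η) * (2 + 2 * 284 ^ 2) :=
        mul_le_mul_of_nonneg_left (by linarith) hν
      nlinarith)
    rw [abs_of_nonpos (by nlinarith)]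
    nlinarith

end Sizes

/-- Low frequency families with `N₂ ≲ N₁ ≲ 1`; the number `lam` is comparable to the maximum of
`N₁` and of the angle between `ξ` and `-ξ₂`. -/
structure LowConf {ι : Type*} (N₁ N₂ lam : ι → ℝ) (ξ η : ι → E) : Prop where
  N₁_pos : ∀ i, 0 < N₁ i
  N₂_pos : ∀ i, 0 < N₂ i
  lam_pos : ∀ i, 0 < lam i
  N₁_le : ∀ i, N₁ i ≤ 1
  N₂_le : ∀ i, N₂ i ≤ 64 * N₁ i
  lam_sq : ∀ i, lam i ^ 2 = 1 + mu (ξ i) (η i) + N₁ i ^ 2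
  ξ_ne : ∀ i, ξ i ≠ 0
  range : ∀ i, InRange (N₁ i) (N₂ i) (ξ i) (η i)

namespace LowConf

variable {ι : Type*} {n : ℕ} {N₁ N₂ lam : ι → ℝ} {ξ η : ι → E}

theorem η_ne (c : LowConf N₁ N₂ lam ξ η) (i : ι) : η i ≠ 0 := by
  have := (c.range i).low₂
  have := c.N₂_pos i
  exact norm_pos_iff.1 (by linarith)

theorem nu_nonneg (c : LowConf N₁ N₂ lam ξ η) (i : ι) : 0 ≤ 1 + mu (ξ i) (η i) := by
  linarith [neg_one_le_mu (c.ξ_ne i) (c.η_ne i)]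

theorem N₁_le_lam (c : LowConf N₁ N₂ lam ξ η) (i : ι) : N₁ i ≤ lam i :=
  le_of_sq_le_sq (by linarith [c.lam_sq i, c.nu_nonneg i]) (c.lam_pos i).le

theorem lam_le (c : LowConf N₁ N₂ lam ξ η) (i : ι) : lam i ≤ 2 := by
  refine le_of_sq_le_sq ?_ zero_le_two
  have := mu_le_one (c.ξ_ne i) (c.η_ne i)
  nlinarith [c.lam_sq i, c.N₁_le i, c.N₁_pos i]

theorem conf₀ (c : LowConf N₁ N₂ lam ξ η) : Conf N₁ N₂ (fun i => (N₂ i)⁻¹) ξ η := by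
  refine ⟨c.N₁_pos, c.N₂_pos, fun i => inv_pos.2 (c.N₂_pos i), fun i => ?_, fun i => ?_, c.ξ_ne,
    c.range⟩
  · rw [← div_eq_mul_inv, ← mul_div_assoc, le_div_iff₀ (c.N₂_pos i)]
    linarith [c.N₂_le i, c.N₂_pos i]
  · rw [mul_inv_cancel₀ (c.N₂_pos i).ne']
    norm_num

theorem conf (c : LowConf N₁ N₂ lam ξ η) : Conf N₁ N₂ (fun i => (N₂ i * lam i)⁻¹) ξ η := by
  have h := fun i => mul_pos (c.N₂_pos i) (c.lam_pos i)
  refine ⟨c.N₁_pos, c.N₂_pos, fun i => inv_pos.2 (h i), fun i => ?_, fun i => ?_, c.ξ_ne,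
    c.range⟩
  -- The constant 128 in `Conf` is the product of N₂/N₁ ≤ 64 and λ ≤ 2.
  · rw [← div_eq_mul_inv, ← mul_div_assoc, le_div_iff₀ (h i)]
    nlinarith [c.N₂_le i, c.lam_le i, c.N₂_pos i, c.N₁_pos i, c.lam_pos i]
  · rw [← div_eq_mul_inv, ← mul_div_assoc, le_div_iff₀ (h i)]
    nlinarith [c.lam_le i, c.N₂_pos i]

theorem norm_ξ_le (c : LowConf N₁ N₂ lam ξ η) (i : ι) : ‖ξ i‖ ≤ 143 * N₁ i := by
  linarith [norm_total_le (ξ i) (η i), (c.range i).up₁, (c.range i).up₂, c.N₂_le i]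

/-- Refining the scale from N₂ to N₂λ permits a size smaller by a factor λ, provided the value at
the base point is that small. -/
theorem shift (c : LowConf N₁ N₂ lam ξ η) {F : Type*} [NormedAddCommGroup F] [NormedSpace ℝ F]
    {f : ι → E → F} {M M' : ι → ℝ} (hf : Symb n η (fun i => (N₂ i)⁻¹) M f) {C : ℝ} (hC : 2 ≤ C)
    (hM' : ∀ i, 0 ≤ M' i) (h1 : ∀ i, M i * lam i ≤ C * M' i) (h2 : ∀ i, ‖f i (η i)‖ ≤ C * M' i) :
    Symb n η (fun i => (N₂ i * lam i)⁻¹) M' f := by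
  have hN := c.N₂_pos
  have hl := c.lam_pos
  refine hf.shift C (fun i => (c.conf.w_pos i).le) hM' (fun i => ?_) (fun i => ?_) h2
  · have := hN i
    have := hl i
    rw [← div_eq_mul_inv, le_div_iff₀ (by positivity), inv_mul_cancel_left₀ (hN i).ne']
    exact (c.lam_le i).trans hC
  · have hNi := hN i
    have hli := hl i
    have e1 : M i * (N₂ i)⁻¹ = M i * lam i * (N₂ i * lam i)⁻¹ := by field_simp
    rw [e1, ← mul_assoc]
    exact mul_le_mul_of_nonneg_right (h1 i) (by positivity)

/-- 1 + μ is half the square of |ξ/|ξ| + y/|y||. This vector is smooth at scale N₂ and has length ≲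
λ at the base point, so by `shift` it is a symbol of size λ at scale N₂λ. -/
theorem nu_symb (c : LowConf N₁ N₂ lam ξ η) :
    Symb n η (fun i => (N₂ i * lam i)⁻¹) (fun i => lam i * lam i) fun i y => 1 + mu (ξ i) y := by
  have key : ∀ {u v : E}, u ≠ 0 → v ≠ 0 → ‖unit u + unit v‖ ^ 2 = 2 * (1 + mu u v) := by
    intro u v hu hv
    rw [norm_add_sq_real, norm_unit hu, norm_unit hv, mu]
    ring
  have k := c.shift (n := n) (C := 2) (M' := lam) (c.conf₀.unit_ξ_symb.add c.conf₀.ell₂.unit)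
    le_rfl (fun i => (c.lam_pos i).le) (fun i => by linarith [c.lam_pos i]) fun i => by
      refine le_of_sq_le_sq ?_ (by linarith [c.lam_pos i])
      rw [key (c.ξ_ne i) (c.η_ne i)]
      nlinarith [c.lam_sq i, c.nu_nonneg i, sq_nonneg (N₁ i)]
  refine ((k.inner k).const_mul (1 / 2)).congr fun i => ?_
  filter_upwards [c.conf.eventually_ne i] with y hy
  rw [real_inner_self_eq_norm_sq, key (c.ξ_ne i) hy.1]
  ring

theorem const_symb {F : Type*} [NormedAddCommGroup F] [NormedSpace ℝ F]
    (c : LowConf N₁ N₂ lam ξ η) {a : ι → F} {M : ι → ℝ} (C : ℝ)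
    (hM : ∀ i, 0 ≤ M i) (ha : ∀ i, ‖a i‖ ≤ C * M i) :
    Symb n η (fun i => (N₂ i * lam i)⁻¹) M fun i _ => a i :=
  c.conf.const_symb C hM ha

/-- In the expansion `phaseFactor_eq` each term contains 1 + μ, of size λ², or two factors of size
N₁ ≤ λ. -/
theorem phaseFactor_symb (c : LowConf N₁ N₂ lam ξ η) :
    Symb n η (fun i => (N₂ i * lam i)⁻¹) (fun i => lam i * lam i) fun i y =>
      phaseFactor (ξ i) y := by
  have h1 := c.N₁_pos
  have h2 := c.N₂_pos
  have hl := c.lam_pos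
  have hR : ∀ i, 0 ≤ lam i * lam i := fun i => mul_self_nonneg _
  have kξ := c.conf.norm_ξ_symb (n := n) |>.mono 143 (fun i => (h1 i).le) c.norm_ξ_le
  have kη := c.conf.ell₂.norm.symb (n := n) |>.mono 64 (fun i => (h1 i).le) c.N₂_le
  have kξ' := kξ.mono (M' := fun _ => 1) 1 (fun _ => zero_le_one) fun i => by linarith [c.N₁_le i]
  have kη' := kη.mono (M' := fun _ => 1) 1 (fun _ => zero_le_one) fun i => by linarith [c.N₁_le i]
  have hNl : ∀ i, N₁ i * N₁ i ≤ 1 * (lam i * lam i) := fun i => by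
    rw [one_mul]
    exact mul_self_le_mul_self (h1 i).le (c.N₁_le_lam i)
  have kξξ := (kξ.mul kξ).mono 1 hR hNl
  have kηη := (kη.mul kη).mono 1 hR hNl
  have kξη := (kξ.mul kη).mono 1 hR hNl
  have k1 := c.conf.one_symb (n := n)
  have ks := kξ'.add kη'
  have t1 := (c.nu_symb.const_mul 2).mul (k1.add ((ks.mul ks).mono (M' := fun _ => 1) 1
    (fun _ => zero_le_one) fun i => by norm_num)) |>.mono 1 hR fun i => by rw [mul_one, one_mul]
  have t2 := ((kξ'.mul kη').const_mul 2).mul (c.nu_symb.mul c.nu_symb) |>.mono 4 hR fun i => by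
    rw [mul_one, one_mul]
    refine mul_le_mul_of_nonneg_right ?_ (hR i)
    nlinarith [c.lam_le i, hl i]
  have kj : Symb n η (fun i => (N₂ i * lam i)⁻¹) (fun _ => 1) fun i y =>
      jap (ξ i) * jap y + 2 := by
    refine .add (((c.const_symb (a := fun i => jap (ξ i)) (M := fun _ => 1) 145
      (fun _ => zero_le_one) fun i => ?_).mul c.conf.ell₂.jap.symb).mono 65
      (fun _ => zero_le_one) fun i => ?_) (c.const_symb 2 (fun _ => zero_le_one) fun i => ?_)
    · rw [Real.norm_of_nonneg (jap_pos _).le]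
      linarith [jap_le (ξ i), c.norm_ξ_le i, c.N₁_le i]
    · linarith [c.N₂_le i, c.N₁_le i]
    · norm_num
  have kji := kj.inv_of_pos (fun _ => one_pos) (c := 1) one_pos fun i => by
    have := mul_pos (jap_pos (ξ i)) (jap_pos (η i))
    linarith
  have t3 := (((kξξ.const_mul 2).add (kηη.const_mul 2)).add ((kξξ.mul (kη'.mul kη')).mono 1 hR
    fun i => by rw [mul_one, mul_one, one_mul])).mul kji |>.mono 1 hR
    fun i => by rw [inv_one, mul_one, one_mul]
  refine ((t1.sub t2).sub (((kξη.const_mul 3).add ((kξξ.add kηη).const_mul 2)).sub t3)).congr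
    fun i => Filter.Eventually.of_forall fun y => ?_
  simp only [phaseFactor_eq]
  ring

theorem gradXi_symb (c : LowConf N₁ N₂ lam ξ η) :
    Symb n η (fun i => (N₂ i * lam i)⁻¹) (fun i => N₂ i * lam i / N₁ i) fun i y =>
      hh (ξ i) • ξ i - hh (ξ i - y) • (ξ i - y) := by
  refine c.conf.gradXi_symb (C := 3000) (fun i => ?_) (fun i => ?_) (fun i => ?_) fun i => ?_
  · have := c.N₁_pos i; have := c.N₂_pos i; have := c.lam_pos i; positivity
  · linarith [c.norm_ξ_le i, c.N₁_pos i]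
  · have h1 := c.N₁_pos i
    have h2 := c.N₂_pos i
    have h3 := c.lam_pos i
    have e1 : N₁ i * (N₂ i * lam i / N₁ i * (N₂ i * lam i)⁻¹) = 1 := by field_simp
    rw [e1]
    linarith [c.N₁_le i]
  · exact norm_sub_le_of_triangle (c.N₁_pos i) (c.N₁_le i) (c.N₂_pos i) (c.N₂_le i)
      (c.lam_pos i) (c.lam_sq i) (c.ξ_ne i) (c.range i)

/-- The gradient of the phase in `ξ₂` is of size `|ξ| lam / N₁`. -/
theorem gradXi₂_ell (c : LowConf N₁ N₂ lam ξ η) (hmu : ∀ i, mu (ξ i) (η i) ≤ 1 / 2)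
    (hnu : ∀ i, lam i ^ 2 ≤ 2 * 10 ^ 7 * (1 + mu (ξ i) (η i))) :
    Ell n η (fun i => (N₂ i * lam i)⁻¹) (fun i => ‖ξ i‖ * lam i / N₁ i) fun i y =>
      hh y • y + hh (ξ i - y) • (ξ i - y) := by
  have h1 := c.N₁_pos
  have h2 := c.N₂_pos
  have hl := c.lam_pos
  have hr0 : ∀ i, 0 < ‖ξ i‖ := fun i => norm_pos_iff.2 (c.ξ_ne i)
  have hM : ∀ i, 0 < ‖ξ i‖ * lam i / N₁ i := fun i => by
    have := h1 i; have := hl i; have := hr0 i; positivity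
  refine ⟨c.shift (M := fun i => ‖ξ i‖ / N₁ i) (C := 1000) ?_ (by norm_num) (fun i => (hM i).le)
    (fun i => ?_) (fun i => norm_add_le_of_triangle (h1 i) (c.N₁_le i)
      (h2 i) (c.N₂_le i) (hl i) (c.lam_sq i) (c.ξ_ne i) (c.range i)), hM, 1 / 10 ^ 6, by norm_num,
    fun i => le_norm_add_of_triangle (h1 i) (h2 i) (c.N₂_le i) (hl i)
      (c.ξ_ne i) (c.range i) (hmu i) (hnu i)⟩
  · have c₀ := c.conf₀
    have hJ : ∀ i, 0 ≤ ‖ξ i‖ / N₁ i := fun i => (div_pos (hr0 i) (h1 i)).le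
    -- Write ∇_{ξ₂}Φ = hh(ξ-y) ξ + (hh(y) - hh(ξ-y)) y. With `hh_sub_hh` both terms visibly carry a
    -- factor |ξ| and have size |ξ|/N₁ at the coarse scale N₂.
    have t1 := (c₀.ell₁.hh.symb.smul (c₀.ξ_symb (n := n))).mono 2 hJ fun i => by
      rw [div_mul_eq_mul_div, ← mul_div_assoc]
      refine div_le_div_of_nonneg_right ?_ (h1 i).le
      exact mul_le_mul_of_nonneg_right (by linarith [c.N₁_le i]) (hr0 i).le
    have kx : Symb n η (fun i => (N₂ i)⁻¹) (fun i => ‖ξ i‖ * N₁ i) fun i y =>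
        4 * (‖ξ i‖ * ‖ξ i‖ - 2 * inner ℝ (ξ i) y) := by
      refine (((c₀.norm_ξ_symb.mul c₀.norm_ξ_symb).mono 143
        (fun i => mul_nonneg (hr0 i).le (h1 i).le) fun i => ?_).sub
        (((c₀.ξ_symb.inner c₀.ell₂.symb).const_mul 2).mono 64
          (fun i => mul_nonneg (hr0 i).le (h1 i).le) fun i => ?_)).const_mul 4
      · nlinarith [c.norm_ξ_le i, hr0 i]
      · nlinarith [c.N₂_le i, hr0 i]
    have kd : Symb n η (fun i => (N₂ i)⁻¹) (fun _ => 1) fun i y => 2 + ‖ξ i - y‖ ^ 2 + ‖y‖ ^ 2 :=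
      c₀.ell_denom.symb.mono (66 ^ 2) (fun _ => zero_le_one) fun i => by
        rw [mul_one]
        exact pow_le_pow_left₀ (by linarith [h1 i, h2 i]) (by linarith [c.N₁_le i, c.N₂_le i]) 2
    have kH₁ : Ell n η (fun i => (N₂ i)⁻¹) N₁ fun i y => H (ξ i - y) :=
      c₀.ell₁.H.resize 2 1 h1 (fun i => by nlinarith [c.N₁_le i, h1 i])
        fun i => by nlinarith [h1 i]
    have kH₂ : Ell n η (fun i => (N₂ i)⁻¹) N₂ fun i y => H y :=
      c₀.ell₂.H.resize 65 1 h2 (fun i => by nlinarith [c.N₁_le i, c.N₂_le i, h2 i])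
        fun i => by nlinarith [h2 i]
    have ks : Ell n η (fun i => (N₂ i)⁻¹) (fun i => (N₂ i)⁻¹) fun i y => hh y + hh (ξ i - y) := by
      refine .of_pos_lower ((c₀.ell₂.hh.symb.mono 65 (fun i => (inv_pos.2 (h2 i)).le)
        fun i => ?_).add (c₀.ell₁.hh.symb.mono 128 (fun i => (inv_pos.2 (h2 i)).le) fun i => ?_))
        (fun i => inv_pos.2 (h2 i)) (c := 5 / 11) (by norm_num) fun i => ?_
      · rw [div_eq_mul_inv]
        exact mul_le_mul_of_nonneg_right (by linarith [c.N₁_le i, c.N₂_le i])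
          (inv_pos.2 (h2 i)).le
      · rw [← div_eq_mul_inv, div_le_div_iff₀ (h1 i) (h2 i)]
        nlinarith [c.N₁_le i, c.N₂_le i, h1 i, h2 i]
      · have k1 := one_le_hh (c.η_ne i)
        have k2 := hh_pos (c.η_ne i)
        have k3 := hh_pos (c.conf.ξ₁_ne i)
        have k4 := (c.range i).up₂
        have : 5 / 11 ≤ hh (η i) * N₂ i := by nlinarith
        rw [← div_eq_mul_inv, div_le_iff₀ (h2 i)]
        nlinarith [h2 i, mul_pos k3 (h2 i)]
    have kq := (((kH₁.mul kH₁).mul (kH₂.mul kH₂)).mul ks).inv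
    have t2 := (((kx.mul kd).mul kq.symb).smul c₀.ell₂.symb).mono 1 hJ fun i => le_of_eq (by
      have := (h1 i).ne'
      have := (h2 i).ne'
      field_simp)
    refine (t1.add t2).congr fun i => ?_
    filter_upwards [c₀.eventually_ne i] with y hy
    rw [← hh_sub_hh hy.1 hy.2, sub_smul, smul_sub]
    abel
  · rw [div_mul_eq_mul_div]
    linarith [hM i]

theorem phaseFactor_ell (c : LowConf N₁ N₂ lam ξ η)
    (h : ∀ i, 1 / 4 ≤ mu (ξ i) (η i) ∨ (10 ^ 7 - 1) * (1 + mu (ξ i) (η i)) ≤ N₁ i ^ 2) :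
    Ell n η (fun i => (N₂ i * lam i)⁻¹) (fun i => lam i * lam i) fun i y =>
      phaseFactor (ξ i) y :=
  ⟨c.phaseFactor_symb, fun i => mul_pos (c.lam_pos i) (c.lam_pos i), 1 / 32, by norm_num,
    fun i => by
      rw [← sq, c.lam_sq]
      exact le_abs_phaseFactor (c.N₁_pos i) (c.N₁_le i) (c.N₂_le i) (c.ξ_ne i) (c.η_ne i)
        (c.range i) (h i)⟩

/-- Here 1/Φ ≲ N₁/(|ξ|N₂λ²) and |∇_ξΦ| ≲ N₂λ/N₁, so the product with U(ξ) ≤ |ξ| is ≲ 1/λ. -/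
theorem bT_symb (c : LowConf N₁ N₂ lam ξ η)
    (h : ∀ i, 1 / 4 ≤ mu (ξ i) (η i) ∨ (10 ^ 7 - 1) * (1 + mu (ξ i) (η i)) ≤ N₁ i ^ 2)
    {κ : ι → E → E → ℝ}
    (hκ : Symb n η (fun i => (N₂ i * lam i)⁻¹) (fun _ => 1) fun i y => κ i (ξ i - y) y) :
    Symb n η (fun i => (N₂ i * lam i)⁻¹) (fun i => (lam i)⁻¹) fun i =>
      slice (bT (κ i)) (ξ i) := by
  have h1 := c.N₁_pos
  have h2 := c.N₂_pos
  have hl := c.lam_pos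
  have hS : Symb n η (fun i => (N₂ i * lam i)⁻¹) N₁ fun i y => H (ξ i) + H y + H (ξ i - y) := by
    refine ((c.const_symb (143 * 145) (fun i => (h1 i).le) fun i => ?_).add
      (c.conf.ell₂.H.symb.mono (64 * 65) (fun i => (h1 i).le) fun i => ?_)).add
      (c.conf.ell₁.H.symb.mono 2 (fun i => (h1 i).le) fun i => ?_)
    · rw [Real.norm_of_nonneg (H_nonneg _)]
      calc H (ξ i) ≤ ‖ξ i‖ * (2 + ‖ξ i‖) := H_le _
        _ ≤ (143 * N₁ i) * 145 :=
          mul_le_mul (c.norm_ξ_le i) (by linarith [c.norm_ξ_le i, c.N₁_le i]) (by positivity)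
            (by linarith [h1 i])
        _ = _ := by ring
    · nlinarith [c.N₁_le i, c.N₂_le i, h1 i, h2 i]
    · nlinarith [c.N₁_le i, h1 i]
  refine c.conf.bT_symb (C := 1) hκ (c.conf.inv_Φ_symb (c.phaseFactor_ell h) hS) c.gradXi_symb
    (fun i => (inv_pos.2 (hl i)).le) fun i => ?_
  have hp : 0 < ‖ξ i‖ := norm_pos_iff.2 (c.ξ_ne i)
  have e1 : (‖ξ i‖ * N₂ i * (lam i * lam i))⁻¹ * N₁ i * (N₂ i * lam i / N₁ i) =
      ‖ξ i‖⁻¹ * (lam i)⁻¹ := by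
    have := (h1 i).ne'
    have := (h2 i).ne'
    have := (hl i).ne'
    field_simp
  rw [e1, ← mul_assoc]
  refine mul_le_mul_of_nonneg_right ?_ (inv_pos.2 (hl i)).le
  rw [← div_eq_mul_inv, div_le_one hp]
  exact U_le_norm _

/-- The factors λ/N₁ in the two gradients cancel, and U(ξ) ≤ |ξ| absorbs the |ξ| in the denominator.
-/
theorem bX_symb (c : LowConf N₁ N₂ lam ξ η) (hmu : ∀ i, mu (ξ i) (η i) ≤ 1 / 2)
    (hnu : ∀ i, lam i ^ 2 ≤ 2 * 10 ^ 7 * (1 + mu (ξ i) (η i))) {κ : ι → E → E → ℝ}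
    (hκ : Symb n η (fun i => (N₂ i * lam i)⁻¹) (fun _ => 1) fun i y => κ i (ξ i - y) y) :
    Symb n η (fun i => (N₂ i * lam i)⁻¹) N₂ fun i => slice (bX (κ i)) (ξ i) := by
  refine c.conf.bX_symb (C := 1) hκ (c.gradXi₂_ell hmu hnu) c.gradXi_symb
    (fun i => (c.N₂_pos i).le) fun i => ?_
  have h1 := c.N₁_pos i
  have h2 := c.N₂_pos i
  have hl := c.lam_pos i
  calc U (ξ i) * (N₂ i * lam i / N₁ i) ≤ ‖ξ i‖ * (N₂ i * lam i / N₁ i) :=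
        mul_le_mul_of_nonneg_right (U_le_norm _) (by positivity)
    _ = 1 * (N₂ i * (‖ξ i‖ * lam i / N₁ i)) := by ring

end LowConf

/-! ### Families of localized symbols -/

/-- Dyadic sizes in the region `P`, together with one of the two symbols `A`. -/
structure Datum (β : ℝ) (P : ℝ → ℝ → Prop) where
  N₁ : ℝ
  N₂ : ℝ
  A : E → E → ℝ
  N₁_pos : 0 < N₁
  N₂_pos : 0 < N₂
  A_eq : A = A₁ β ∨ A = A₂
  region : P N₁ N₂

namespace Datum

variable {β : ℝ} {P : ℝ → ℝ → Prop} {q : ℝ → ℝ → Prop} {g : ℝ → ℝ → ℝ} {φ : E → ℝ} {n : ℕ}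

/-- The localization of `A` by the cutoffs and by a function `g` of the angle of `ξ` and `ξ₂`. -/
def κ (φ : E → ℝ) (g : ℝ → ℝ → ℝ) (d : Datum β P) (ξ₁ ξ₂ : E) : ℝ :=
  g d.N₁ (mu (ξ₁ + ξ₂) ξ₂) * cutoff φ d.N₁ d.N₂ ξ₁ ξ₂ * d.A ξ₁ ξ₂

/-- The set of frequencies to which `κ` localizes. -/
def good (q : ℝ → ℝ → Prop) (d : Datum β P) (ξ η : E) : Prop :=
  InRange d.N₁ d.N₂ ξ η ∧ q d.N₁ (mu ξ η)

theorem conf {w : Datum β P → ℝ} (hw : ∀ d, 0 < w d) (h1 : ∀ d, 1 ≤ 128 * (d.N₁ * w d))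
    (h2 : ∀ d, 1 ≤ 128 * (d.N₂ * w d)) :
    Conf (fun p : GoodPt (good (β := β) (P := P) q) => p.1.1.N₁) (fun p => p.1.1.N₂)
      (fun p => w p.1.1) (fun p => p.1.2.1) fun p => p.1.2.2 :=
  ⟨fun p => p.1.1.N₁_pos, fun p => p.1.1.N₂_pos, fun p => hw p.1.1, fun p => h1 p.1.1,
    fun p => h2 p.1.1, fun p => p.2.1, fun p => p.2.2.1⟩

theorem lowConf (hP : ∀ N₁ N₂, P N₁ N₂ → N₂ ≤ 64 * N₁ ∧ N₁ ≤ 1) :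
    LowConf (fun p : GoodPt (good (β := β) (P := P) q) => p.1.1.N₁) (fun p => p.1.1.N₂)
      (fun p => √(1 + mu p.1.2.1 p.1.2.2 + p.1.1.N₁ ^ 2)) (fun p => p.1.2.1)
      fun p => p.1.2.2 := by
  have key : ∀ p : GoodPt (good (β := β) (P := P) q),
      0 < 1 + mu p.1.2.1 p.1.2.2 + p.1.1.N₁ ^ 2 := fun p => by
    have h1 := p.1.1.N₁_pos
    have hη : p.1.2.2 ≠ 0 := by
      have := p.2.2.1.low₂
      have := p.1.1.N₂_pos
      exact norm_pos_iff.1 (by linarith)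
    have := neg_one_le_mu p.2.1 hη
    have : 0 < p.1.1.N₁ ^ 2 := by positivity
    linarith
  exact ⟨fun p => p.1.1.N₁_pos, fun p => p.1.1.N₂_pos, fun p => Real.sqrt_pos.2 (key p),
    fun p => (hP _ _ p.1.1.region).2, fun p => (hP _ _ p.1.1.region).1,
    fun p => Real.sq_sqrt (key p).le, fun p => p.2.1, fun p => p.2.2.1⟩

theorem κ_symb (hφ : IsBump φ) {w : GoodPt (good (β := β) (P := P) q) → ℝ}
    (c : Conf (fun p : GoodPt (good (β := β) (P := P) q) => p.1.1.N₁) (fun p => p.1.1.N₂)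
      w (fun p => p.1.2.1) fun p => p.1.2.2)
    (hg : Symb n (fun p : GoodPt (good (β := β) (P := P) q) => p.1.2.2) w (fun _ => 1)
      fun p y => g p.1.1.N₁ (mu p.1.2.1 y)) :
    Symb n (fun p : GoodPt (good (β := β) (P := P) q) => p.1.2.2) w (fun _ => 1)
      fun p y => κ φ g p.1.1 (p.1.2.1 - y) y := by
  refine (((hg.mul (c.cutoff_symb hφ)).mul (c.A_symb (A := fun p => p.1.1.A)
    fun p => p.1.1.A_eq)).mono 1 (fun _ => zero_le_one) fun _ => by norm_num).congr
    fun p => Filter.Eventually.of_forall fun y => ?_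
  simp only [κ, sub_add_cancel]

/-- Either the dyadic cutoffs vanish near η, or μ leaves the closed set cut out by q, and then the
angular factor g vanishes nearby. -/
theorem κ_eventually_eq_zero (hφ : IsBump φ) (hq : ∀ N, IsClosed {t | q N t})
    (hgq : ∀ N t, 0 < N → -1 ≤ t → g N t ≠ 0 → q N t) (d : Datum β P) {ξ η : E} (hξ : ξ ≠ 0)
    (h : ¬ good q d ξ η) : ∀ᶠ y in nhds η, κ φ g d (ξ - y) y = 0 := by
  by_cases hr : InRange d.N₁ d.N₂ ξ η
  · have hq' : ¬ q d.N₁ (mu ξ η) := fun h' => h ⟨hr, h'⟩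
    have hη : η ≠ 0 := by
      have := hr.low₂
      have := d.N₂_pos
      exact norm_pos_iff.1 (by linarith)
    have hc : ContinuousAt (fun y => mu ξ y) η := by
      have : ContinuousAt (fun y : E => unit y) η := by
        unfold unit
        exact (continuousAt_id.norm.inv₀ (norm_ne_zero_iff.2 hη)).smul continuousAt_id
      exact continuousAt_const.inner this
    filter_upwards [hc.eventually ((hq d.N₁).isOpen_compl.mem_nhds hq'),
      continuousAt_id.eventually_ne hη] with y hy hy0
    have : g d.N₁ (mu ξ y) = 0 := by
      by_contra hne
      exact hy (hgq _ _ d.N₁_pos (neg_one_le_mu hξ hy0) hne)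
    simp [κ, this]
  · filter_upwards [cutoff_eventuallyEq_zero hφ d.N₁_pos d.N₂_pos hr] with y hy
    simp [κ, hy]

theorem norm_snd_le {d : Datum β P} {ξ η : E} (h : good q d ξ η) :
    ‖η - 0‖ ≤ 11 / 5 * d.N₂ := by
  rw [sub_zero]
  linarith [h.1.up₂]

/-! ### Norms of the multipliers in the individual regions -/

/-- The smaller frequency is ξ₁ = ξ - ξ₂, so for fixed ξ the support in ξ₂ is a ball of radius ∼ N₁
centred at ξ. In the other ball estimates the centre is 0 and the radius ∼ N₂. -/
theorem symbNorm_bT_of_small₁ (hφ : IsBump φ) (hP : ∀ N₁ N₂, P N₁ N₂ → 64 * N₁ ≤ N₂) :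
    ∃ C : ℝ, 0 < C ∧ ∀ d : Datum β P,
      symbNorm (bT (d.κ φ fun _ _ => 1)) ≤ ENNReal.ofReal (C * (1 / d.N₂)) := by
  have c := conf (β := β) (P := P) (q := fun _ _ => True) (w := fun d => (d.N₁)⁻¹)
    (fun d => inv_pos.2 d.N₁_pos) (fun d => by rw [mul_inv_cancel₀ d.N₁_pos.ne']; norm_num)
    fun d => by
      rw [← div_eq_mul_inv, ← mul_div_assoc, le_div_iff₀ d.N₁_pos]
      linarith [hP _ _ d.region, d.N₁_pos]
  refine symbNorm_le_of_ball (good := good fun _ _ => True) (R := fun d => d.N₁)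
    (fun d => (div_pos one_pos d.N₂_pos).le) (fun d => d.N₁_pos) (z := fun _ ξ => ξ)
    (C₀ := 11 / 5) (c.bT_symb_of_small₁ (fun p => hP _ _ p.1.1.region)
      (κ_symb hφ c c.one_symb)) (fun d ξ η hξ h => ?_) fun d ξ η h => ?_
  · exact slice_bT_eq_zero (κ_eventually_eq_zero hφ (fun _ => isClosed_const)
      (fun _ _ _ _ _ => trivial) d hξ h)
  · rw [norm_sub_rev]
    linarith [h.1.up₁]

theorem symbNorm_bX_of_small₂ (hφ : IsBump φ)
    (hP : ∀ N₁ N₂, P N₁ N₂ → 64 * N₂ ≤ N₁ ∧ 1 ≤ N₁) :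
    ∃ C : ℝ, 0 < C ∧ ∀ d : Datum β P,
      symbNorm (bX (d.κ φ fun _ _ => 1)) ≤ ENNReal.ofReal (C * (d.N₂ / d.N₁)) ∧
      symbNorm (bXtilde (d.κ φ fun _ _ => 1)) ≤
        ENNReal.ofReal (C * (1 / d.N₂ * (d.N₂ / d.N₁))) := by
  have c := conf (β := β) (P := P) (q := fun _ _ => True) (w := fun d => (d.N₂)⁻¹)
    (fun d => inv_pos.2 d.N₂_pos) (fun d => by
      rw [← div_eq_mul_inv, ← mul_div_assoc, le_div_iff₀ d.N₂_pos]
      linarith [hP _ _ d.region, d.N₂_pos])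
    fun d => by rw [mul_inv_cancel₀ d.N₂_pos.ne']; norm_num
  -- Three derivatives: two for Ḣ² and one for the divergence.
  have k := c.bX_symb_of_small₂ (n := 3) (fun p => (hP _ _ p.1.1.region).1)
    (fun p => (hP _ _ p.1.1.region).2) (κ_symb (g := fun _ _ => 1) hφ c c.one_symb)
  have hz : ∀ (d : Datum β P) (ξ η : E), ξ ≠ 0 → ¬ good (fun _ _ => True) d ξ η →
      slice (bX (d.κ φ fun _ _ => 1)) ξ =ᶠ[nhds η] 0 := fun d ξ η hξ h =>
    slice_bX_eq_zero (κ_eventually_eq_zero hφ (fun _ => isClosed_const)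
      (fun _ _ _ _ _ => trivial) d hξ h)
  obtain ⟨C, hC, h1⟩ := symbNorm_le_of_ball (good := good fun _ _ => True) (R := fun d => d.N₂)
    (M := fun d => d.N₂ / d.N₁)
    (fun d => (div_pos d.N₂_pos d.N₁_pos).le) (fun d => d.N₂_pos) (z := fun _ _ => 0)
    (C₀ := 11 / 5) (k.of_le (by norm_num)) hz fun d ξ η h => norm_snd_le h
  obtain ⟨D, hD, h2⟩ := symbNorm_le_of_ball (good := good fun _ _ => True) (R := fun d => d.N₂)
    (M := fun d => 1 / d.N₂ * (d.N₂ / d.N₁))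
    (fun d => by have := d.N₂_pos; have := d.N₁_pos; positivity)
    (fun d => d.N₂_pos) (z := fun _ _ => 0)
    (C₀ := 11 / 5) (k.divXi₂.mono 1
      (fun p => by have := p.1.1.N₂_pos; have := p.1.1.N₁_pos; positivity)
      fun p => le_of_eq (by rw [one_mul, one_div, mul_comm]))
    (fun d ξ η hξ h => slice_divXi₂_eventuallyEq_zero (hz d ξ η hξ h))
    fun d ξ η h => norm_snd_le h
  refine ⟨C + D, by positivity, fun d => ⟨(h1 d).trans (ENNReal.ofReal_le_ofReal ?_),
    (h2 d).trans (ENNReal.ofReal_le_ofReal ?_)⟩⟩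
  · have := d.N₂_pos; have := d.N₁_pos
    exact mul_le_mul_of_nonneg_right (by linarith) (by positivity)
  · have := d.N₂_pos; have := d.N₁_pos
    exact mul_le_mul_of_nonneg_right (by linarith) (by positivity)

/-! ### Norms at comparable frequencies N₁ ∼ N₂ ≳ 1. -/

/-- Sizes that are comparable and bounded below. -/
abbrev Comparable (N₁ N₂ : ℝ) : Prop := (N₁ ≤ 64 * N₂ ∧ N₂ ≤ 64 * N₁) ∧ 1 ≤ N₁

theorem conf_comparable : Conf (fun p : GoodPt (good (β := β) (P := Comparable) q) => p.1.1.N₁)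
      (fun p => p.1.1.N₂) (fun p => (p.1.1.N₂)⁻¹) (fun p => p.1.2.1) fun p => p.1.2.2 :=
  conf (w := fun d => (d.N₂)⁻¹)
    (fun d => inv_pos.2 d.N₂_pos) (fun d => by
      rw [← div_eq_mul_inv, ← mul_div_assoc, le_div_iff₀ d.N₂_pos]
      linarith [d.region.1.2, d.N₁_pos])
    fun d => by rw [mul_inv_cancel₀ d.N₂_pos.ne']; norm_num

/-- Where `ξ` and `ξ₂` are almost parallel, the phase is large. -/
theorem le_abs_phaseFactor_of_parallel {N₁ N₂ : ℝ} {ξ η : E} (hN₁ : 1 ≤ N₁) (h2 : 0 < N₂)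
    (hξ : ξ ≠ 0) (h : InRange N₁ N₂ ξ η) (hq : 10 ^ 7 * (1 - mu ξ η ^ 2) ≤ 1) :
    1 / 32 * (N₂ * N₂) ≤ |phaseFactor ξ η| := by
  obtain ⟨k1, k2, k3, k4⟩ := h
  have hη : η ≠ 0 := norm_pos_iff.1 (by linarith)
  have e1 : (N₂ / 4) ^ 2 ≤ ‖η‖ ^ 2 := pow_le_pow_left₀ (by positivity) (by linarith) 2
  rcases le_total (1 / 2) (mu ξ η) with hm | hm
  · refine le_trans ?_ ((phaseFactor_ge hξ hη (by linarith)).trans (le_abs_self _))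
    nlinarith [sq_nonneg ‖ξ‖]
  · have n2 : ‖ξ - η‖ ≤ ‖ξ‖ + ‖η‖ := norm_sub_le _ _
    have hν : 0 ≤ 1 + mu ξ η := by linarith [neg_one_le_mu hξ hη]
    have hν' : 10 ^ 7 * (1 + mu ξ η) ≤ 2 := by nlinarith
    -- Although |ξ| may be tiny, |ξ| + |η| ≥ |ξ₁| ≥ 1/4, so `phaseFactor_le` applies once 1 + μ ≤
    -- 2·10⁻⁷.
    have e2 : (1 / 4) ^ 2 ≤ (‖ξ‖ + ‖η‖) ^ 2 := pow_le_pow_left₀ (by norm_num) (by linarith) 2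
    have e3 : ‖η‖ ^ 2 ≤ (‖ξ‖ + ‖η‖) ^ 2 :=
      pow_le_pow_left₀ (norm_nonneg _) (by linarith [norm_nonneg ξ]) 2
    have k := phaseFactor_le (ξ := ξ) (η := η) (by nlinarith)
    rw [abs_of_nonpos (by nlinarith)]
    nlinarith

/-- Cutoff to almost parallel frequencies. -/
def parallelCut (t : ℝ) : ℝ := Real.smoothTransition (2 - 2 * 10 ^ 7 * (1 - t ^ 2))

theorem parallelCut_contDiff : ContDiff ℝ ∞ parallelCut :=
  Real.smoothTransition.contDiff.comp (by fun_prop)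

theorem parallelCut_ne_zero {t : ℝ} (h : parallelCut t ≠ 0) : 10 ^ 7 * (1 - t ^ 2) ≤ 1 := by
  by_contra hlt
  exact h (Real.smoothTransition.zero_of_nonpos (by linarith))

theorem one_sub_parallelCut_ne_zero {t : ℝ} (h : 1 - parallelCut t ≠ 0) :
    1 / (2 * 10 ^ 7) ≤ 1 - t ^ 2 := by
  by_contra hlt
  rw [not_le, lt_div_iff₀ (by norm_num)] at hlt
  exact h (by rw [parallelCut, Real.smoothTransition.one_of_one_le (by linarith), sub_self])

theorem comp_mu_symb {ι : Type*} {N₁ N₂ w : ι → ℝ} {ξ η : ι → E} (c : Conf N₁ N₂ w ξ η)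
    {f : ℝ → ℝ} (hf : ContDiff ℝ ∞ f) :
    Symb n η w (fun _ => 1) fun i y => f (mu (ξ i) y) :=
  c.mu_symb.comp isOpen_univ hf.contDiffOn (isCompact_Icc (a := (-1 : ℝ)) (b := 1))
    (Set.subset_univ _) fun i => ⟨neg_one_le_mu (c.ξ_ne i) (c.η_ne i),
      mu_le_one (c.ξ_ne i) (c.η_ne i)⟩

theorem symbNorm_bT_of_comparable (hφ : IsBump φ) :
    ∃ C : ℝ, 0 < C ∧ ∀ d : Datum β Comparable,
      symbNorm (bT (d.κ φ fun _ => parallelCut)) ≤ ENNReal.ofReal (C * 1) := by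
  have c := conf_comparable (β := β) (q := fun _ t => 10 ^ 7 * (1 - t ^ 2) ≤ 1)
  refine symbNorm_le_of_ball (good := good fun _ t => 10 ^ 7 * (1 - t ^ 2) ≤ 1)
    (R := fun d => d.N₂)
    (fun d => zero_le_one) (fun d => d.N₂_pos) (z := fun _ _ => 0)
    (C₀ := 11 / 5) (c.bT_symb_of_comparable (fun p => p.1.1.region.1.1)
      (fun p => p.1.1.region.2) (c₀ := 1 / 32) (by norm_num)
      (fun p => le_abs_phaseFactor_of_parallel p.1.1.region.2 p.1.1.N₂_pos p.2.1 p.2.2.1 p.2.2.2)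
      (κ_symb hφ c (comp_mu_symb c parallelCut_contDiff))) (fun d ξ η hξ h => ?_)
    fun d ξ η h => norm_snd_le h
  exact slice_bT_eq_zero (κ_eventually_eq_zero hφ
    (fun _ => isClosed_le (by fun_prop) continuous_const)
    (fun _ _ _ _ h => parallelCut_ne_zero h) d hξ h)

theorem symbNorm_bAng_of_comparable (hφ : IsBump φ) :
    ∃ C : ℝ, 0 < C ∧ ∀ d : Datum β Comparable,
      symbNorm (bAng (d.κ φ fun _ t => 1 - parallelCut t)) ≤ ENNReal.ofReal (C * 1) ∧
      symbNorm (bAng₁ (d.κ φ fun _ t => 1 - parallelCut t)) ≤ ENNReal.ofReal (C * 1) ∧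
      symbNorm (bAng₂ (d.κ φ fun _ t => 1 - parallelCut t)) ≤ ENNReal.ofReal (C * 1) ∧
      symbNorm (bAngTilde (d.κ φ fun _ t => 1 - parallelCut t)) ≤ ENNReal.ofReal (C * 1) := by
  have c := conf_comparable (β := β) (q := fun _ t => 1 / (2 * 10 ^ 7) ≤ 1 - t ^ 2)
  have h12 := fun p : GoodPt (good (β := β) (P := Comparable)
    fun _ t => 1 / (2 * 10 ^ 7) ≤ 1 - t ^ 2) => p.1.1.region.1.1
  have h21 := fun p : GoodPt (good (β := β) (P := Comparable)
    fun _ t => 1 / (2 * 10 ^ 7) ≤ 1 - t ^ 2) => p.1.1.region.1.2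
  have hN := fun p : GoodPt (good (β := β) (P := Comparable)
    fun _ t => 1 / (2 * 10 ^ 7) ≤ 1 - t ^ 2) => p.1.1.region.2
  have hmu := fun p : GoodPt (good (β := β) (P := Comparable)
    fun _ t => 1 / (2 * 10 ^ 7) ≤ 1 - t ^ 2) => p.2.2.2
  have hc₀ : (0 : ℝ) < 1 / (2 * 10 ^ 7) := by norm_num
  have hκ := κ_symb (n := 3) (g := fun _ t => 1 - parallelCut t) hφ c (comp_mu_symb c
    (contDiff_const.sub parallelCut_contDiff : ContDiff ℝ ∞ fun t => 1 - parallelCut t))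
  have hκ' := hκ.of_le (m := 2) (by norm_num)
  have hz : ∀ (d : Datum β Comparable) (ξ η : E), ξ ≠ 0 →
      ¬ good (fun _ t => 1 / (2 * 10 ^ 7) ≤ 1 - t ^ 2) d ξ η → ∀ᶠ y in nhds η,
        mAng (d.κ φ fun _ t => 1 - parallelCut t) (ξ - y) y = 0 := fun d ξ η hξ h =>
    slice_mAng_eq_zero (κ_eventually_eq_zero hφ (q := fun _ t => 1 / (2 * 10 ^ 7) ≤ 1 - t ^ 2)
      (fun _ => isClosed_le continuous_const (by fun_prop))
      (fun _ _ _ _ h => one_sub_parallelCut_ne_zero h) d hξ h)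
  -- The four multipliers take values in different spaces but share scale, size and support: each of
  -- them vanishes wherever `mAng` vanishes locally.
  have main : ∀ {F : Type} [NormedAddCommGroup F] [NormedSpace ℝ F]
      {b : Datum β Comparable → E → E → F},
      Symb 2 (fun p : GoodPt (good (β := β) (P := Comparable)
        fun _ t => 1 / (2 * 10 ^ 7) ≤ 1 - t ^ 2) => p.1.2.2) (fun p => (p.1.1.N₂)⁻¹)
        (fun _ => 1) (fun p => slice (b p.1.1) p.1.2.1) →
      (∀ d ξ η, (∀ᶠ y in nhds η, mAng (d.κ φ fun _ t => 1 - parallelCut t) (ξ - y) y = 0) →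
        slice (b d) ξ =ᶠ[nhds η] 0) →
      ∃ C : ℝ, 0 < C ∧ ∀ d, symbNorm (b d) ≤ ENNReal.ofReal (C * 1) := fun hs h0 =>
    symbNorm_le_of_ball (R := fun d => d.N₂) (fun d => zero_le_one) (fun d => d.N₂_pos)
      (z := fun _ _ => 0) (C₀ := 11 / 5) hs (fun d ξ η hξ h => h0 d ξ η (hz d ξ η hξ h))
      fun d ξ η h => norm_snd_le h
  obtain ⟨C₁, hC₁, b₁⟩ := main
    (b := fun d => bAng (d.κ φ fun _ t => 1 - parallelCut t)) (c.bAng_symb h12 hN hc₀ hmu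
    (fun p => by rw [mul_inv_cancel₀ p.1.1.N₂_pos.ne']) hκ) fun d ξ η h =>
      slice_divXi₂_eventuallyEq_zero (by
        filter_upwards [h] with y hy
        simp [slice, hy, tensor_zero_left])
  obtain ⟨C₂, hC₂, b₂⟩ := main
    (b := fun d => bAng₁ (d.κ φ fun _ t => 1 - parallelCut t))
    (c.bAng₁_symb h12 h21 hN hc₀ hmu hκ') fun d ξ η h => by
    filter_upwards [h] with y hy
    simp [slice, bAng₁, hy, tensor_zero_left]
  obtain ⟨C₃, hC₃, b₃⟩ := main
    (b := fun d => bAng₂ (d.κ φ fun _ t => 1 - parallelCut t))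
    (c.bAng₂_symb h12 hN hc₀ hmu hκ') fun d ξ η h => by
    filter_upwards [h] with y hy
    simp [slice, bAng₂, hy, tensor_zero_left]
  obtain ⟨C₄, hC₄, b₄⟩ := main
    (b := fun d => bAngTilde (d.κ φ fun _ t => 1 - parallelCut t))
    (c.bAngTilde_symb h12 h21 hN hc₀ hmu hκ') fun d ξ η h => by
    filter_upwards [h] with y hy
    simp [slice, bAngTilde, hy, tensor_zero_left]
  refine ⟨C₁ + C₂ + C₃ + C₄, by positivity, fun d => ⟨(b₁ d).trans ?_, (b₂ d).trans ?_,
    (b₃ d).trans ?_, (b₄ d).trans ?_⟩⟩ <;> exact ENNReal.ofReal_le_ofReal (by linarith)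

/-! ### Norms at low frequencies. -/

/-- Sizes with `N₂ ≲ N₁ ≲ 1`. -/
abbrev Low (N₁ N₂ : ℝ) : Prop := N₂ ≤ 64 * N₁ ∧ N₁ ≤ 1

/-- Cutoff to the region of time non-resonance for low frequencies. -/
def timeCut (N t : ℝ) : ℝ :=
  1 - (1 - Real.smoothTransition (2 - 2 * 10 ^ 7 * ((1 + t) * (1 + t + N ^ 2)⁻¹))) *
    (1 - Real.smoothTransition (4 * t - 1))

theorem timeCut_mem (N t : ℝ) : timeCut N t ∈ Set.Icc 0 1 := by
  have h1 := Real.smoothTransition.nonneg (2 - 2 * 10 ^ 7 * ((1 + t) * (1 + t + N ^ 2)⁻¹))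
  have h2 := Real.smoothTransition.le_one (2 - 2 * 10 ^ 7 * ((1 + t) * (1 + t + N ^ 2)⁻¹))
  have h3 := Real.smoothTransition.nonneg (4 * t - 1)
  have h4 := Real.smoothTransition.le_one (4 * t - 1)
  constructor
  · rw [timeCut]
    nlinarith
  · rw [timeCut]
    nlinarith

/-- The expression 1 - (1-a)(1-b) is a smooth union of two cutoffs, so one of a, b must be nonzero:
b forces t ≥ 1/4, and a forces 10⁷(1+t) ≤ 1 + t + N². -/
theorem timeCut_ne_zero {N t : ℝ} (hN : 0 < N) (h : timeCut N t ≠ 0) :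
    1 / 4 ≤ t ∨ (10 ^ 7 - 1) * (1 + t) ≤ N ^ 2 := by
  by_contra hlt
  rw [not_or, not_le, not_le] at hlt
  have hN2 : 0 < N ^ 2 := by positivity
  have hpos : 0 < 1 + t + N ^ 2 := by linarith
  refine h ?_
  rw [timeCut, Real.smoothTransition.zero_of_nonpos (x := 4 * t - 1) (by linarith),
    Real.smoothTransition.zero_of_nonpos]
  · norm_num
  · have : 1 ≤ 10 ^ 7 * ((1 + t) * (1 + t + N ^ 2)⁻¹) := by
      rw [← div_eq_mul_inv, ← mul_div_assoc, le_div_iff₀ hpos]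
      linarith
    linarith

theorem one_sub_timeCut_ne_zero {N t : ℝ} (hN : 0 < N) (ht : -1 ≤ t) (h : 1 - timeCut N t ≠ 0) :
    t ≤ 1 / 2 ∧ 1 + t + N ^ 2 ≤ 2 * 10 ^ 7 * (1 + t) := by
  have hpos : 0 < 1 + t + N ^ 2 := by
    have : 0 < N ^ 2 := by positivity
    linarith
  constructor
  · by_contra hlt
    refine h ?_
    rw [timeCut, Real.smoothTransition.one_of_one_le (x := 4 * t - 1) (by linarith)]
    norm_num
  · by_contra hlt
    refine h ?_
    rw [timeCut, Real.smoothTransition.one_of_one_le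
      (x := 2 - 2 * 10 ^ 7 * ((1 + t) * (1 + t + N ^ 2)⁻¹))]
    · norm_num
    · have : 2 * 10 ^ 7 * ((1 + t) * (1 + t + N ^ 2)⁻¹) ≤ 1 := by
        rw [← div_eq_mul_inv, ← mul_div_assoc, div_le_one hpos]
        linarith
      linarith

/-- (1+μ)/(1+μ+N₁²) is a quotient of symbols of size λ² with values in [0, 1], hence of order 1 at
scale N₂λ. -/
theorem timeCut_symb {ι : Type*} {N₁ N₂ lam : ι → ℝ} {ξ η : ι → E} (c : LowConf N₁ N₂ lam ξ η) :
    Symb n η (fun i => (N₂ i * lam i)⁻¹) (fun _ => 1) fun i y => timeCut (N₁ i) (mu (ξ i) y) := by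
  have hS : ContDiff ℝ ∞ Real.smoothTransition := Real.smoothTransition.contDiff
  have h2 : ∀ i, 0 < lam i * lam i := fun i => mul_pos (c.lam_pos i) (c.lam_pos i)
  have kd : Symb n η (fun i => (N₂ i * lam i)⁻¹) (fun i => lam i * lam i) fun i y =>
      1 + mu (ξ i) y + N₁ i ^ 2 :=
    c.nu_symb.add (c.const_symb 1 (fun i => (h2 i).le) fun i => by
      rw [Real.norm_of_nonneg (sq_nonneg _), one_mul, ← sq]
      exact pow_le_pow_left₀ (c.N₁_pos i).le (c.N₁_le_lam i) 2)
  have ks := (c.nu_symb.mul (kd.inv_of_pos h2 (c := 1) one_pos fun i => by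
    rw [one_mul, ← sq, c.lam_sq])).mono (M' := fun _ => 1) 1 (fun _ => zero_le_one) fun i => by
      rw [mul_inv_cancel₀ (h2 i).ne', one_mul]
  have k1 := ks.comp (g := fun s => 1 - Real.smoothTransition (2 - 2 * 10 ^ 7 * s)) isOpen_univ
    (ContDiff.contDiffOn (contDiff_const.sub (hS.comp (by fun_prop))))
    (isCompact_Icc (a := (0 : ℝ)) (b := 1)) (Set.subset_univ _) fun i => by
      have h3 := c.lam_sq i
      have h4 := c.lam_pos i
      have h5 := c.nu_nonneg i
      rw [← h3]
      refine ⟨by positivity, ?_⟩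
      rw [← div_eq_mul_inv, div_le_one (by positivity)]
      linarith [sq_nonneg (N₁ i)]
  have k2 := comp_mu_symb (n := n) c.conf (f := fun t => 1 - Real.smoothTransition (4 * t - 1))
    (contDiff_const.sub (hS.comp (by fun_prop)))
  exact c.conf.one_symb.sub ((k1.mul k2).mono 1 (fun _ => zero_le_one) fun i => by norm_num)

theorem symbNorm_bT_of_low (hφ : IsBump φ) :
    ∃ C : ℝ, 0 < C ∧ ∀ d : Datum β Low,
      symbNorm (bT (d.κ φ timeCut)) ≤ ENNReal.ofReal (C * (1 * √((d.N₁)⁻¹ ^ 3))) := by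
  have c := lowConf (β := β) (P := Low)
    (q := fun N t => 1 / 4 ≤ t ∨ (10 ^ 7 - 1) * (1 + t) ≤ N ^ 2) fun _ _ h => h
  refine symbNorm_le_of_cap
    (good := good fun N t => 1 / 4 ≤ t ∨ (10 ^ 7 - 1) * (1 + t) ≤ N ^ 2)
    (M := fun _ => 1) (N₁ := fun d => d.N₁) (N₂ := fun d => d.N₂)
    (fun d => zero_le_one) (fun d => d.N₁_pos) (fun d => d.N₂_pos) (C₀ := 11 / 5)
    ((c.bT_symb (fun p => p.2.2.2) (κ_symb hφ c.conf (timeCut_symb c))).mono 1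
      (fun p => mul_nonneg zero_le_one (inv_nonneg.2 (Real.sqrt_nonneg _)))
      fun p => by rw [one_mul, one_mul])
    (fun d ξ η hξ h => ?_) fun d ξ η h => ?_
  · exact slice_bT_eq_zero (κ_eventually_eq_zero hφ
      (q := fun N t => 1 / 4 ≤ t ∨ (10 ^ 7 - 1) * (1 + t) ≤ N ^ 2)
      (fun _ => (isClosed_le continuous_const continuous_id).union
        (isClosed_le (by fun_prop) continuous_const))
      (fun _ _ hN _ h => timeCut_ne_zero hN h) d hξ h)
  · simpa using norm_snd_le h

theorem symbNorm_bX_of_low (hφ : IsBump φ) :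
    ∃ C : ℝ, 0 < C ∧ ∀ d : Datum β Low,
      symbNorm (bX (d.κ φ fun N t => 1 - timeCut N t)) ≤
        ENNReal.ofReal (C * (d.N₂ * √((d.N₁)⁻¹ ^ 3))) ∧
      symbNorm (bXtilde (d.κ φ fun N t => 1 - timeCut N t)) ≤
        ENNReal.ofReal (C * (1 * √((d.N₁)⁻¹ ^ 3))) := by
  have c := lowConf (β := β) (P := Low)
    (q := fun N t => t ≤ 1 / 2 ∧ 1 + t + N ^ 2 ≤ 2 * 10 ^ 7 * (1 + t)) fun _ _ h => h
  have hκ := κ_symb (n := 3) hφ c.conf (g := fun N t => 1 - timeCut N t)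
    (c.conf.one_symb.sub (timeCut_symb c))
  have k := c.bX_symb (fun p => p.2.2.2.1)
    (fun p => by rw [c.lam_sq]; exact p.2.2.2.2) hκ
  have hz : ∀ (d : Datum β Low) (ξ η : E), ξ ≠ 0 →
      ¬ good (fun N t => t ≤ 1 / 2 ∧ 1 + t + N ^ 2 ≤ 2 * 10 ^ 7 * (1 + t)) d ξ η →
      slice (bX (d.κ φ fun N t => 1 - timeCut N t)) ξ =ᶠ[nhds η] 0 := fun d ξ η hξ h =>
    slice_bX_eq_zero (κ_eventually_eq_zero hφ
      (q := fun N t => t ≤ 1 / 2 ∧ 1 + t + N ^ 2 ≤ 2 * 10 ^ 7 * (1 + t))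
      (fun _ => (isClosed_le continuous_id continuous_const).inter
        (isClosed_le (by fun_prop) (by fun_prop)))
      (fun _ _ hN ht h => one_sub_timeCut_ne_zero hN ht h) d hξ h)
  obtain ⟨C, hC, h1⟩ := symbNorm_le_of_cap
    (M := fun d => d.N₂) (N₁ := fun d => d.N₁) (N₂ := fun d => d.N₂)
    (fun d => d.N₂_pos.le) (fun d => d.N₁_pos) (fun d => d.N₂_pos) (C₀ := 11 / 5)
    -- Since λ ≤ 2, the size N₂ may be weakened to 2N₂/λ, the form required by the cap estimate. The
    -- divergence has size 1/λ by itself.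
    ((k.of_le (by norm_num)).mono 2
      (fun p => mul_nonneg p.1.1.N₂_pos.le (inv_nonneg.2 (Real.sqrt_nonneg _)))
      fun p => by
        have h2 := p.1.1.N₂_pos
        rw [← div_eq_mul_inv, ← mul_div_assoc, le_div_iff₀ (c.lam_pos p), mul_comm]
        exact mul_le_mul_of_nonneg_right (c.lam_le p) h2.le) hz
    fun d ξ η h => by simpa using norm_snd_le h
  obtain ⟨D, hD, h2⟩ := symbNorm_le_of_cap
    (M := fun _ => 1) (N₁ := fun d => d.N₁) (N₂ := fun d => d.N₂)
    (fun d => zero_le_one) (fun d => d.N₁_pos) (fun d => d.N₂_pos) (C₀ := 11 / 5)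
    (k.divXi₂.mono 1
      (fun p => mul_nonneg zero_le_one (inv_nonneg.2 (Real.sqrt_nonneg _)))
      fun p => by
        rw [one_mul, one_mul, mul_inv, mul_inv_cancel_left₀ p.1.1.N₂_pos.ne'])
    (fun d ξ η hξ h => slice_divXi₂_eventuallyEq_zero (hz d ξ η hξ h))
    fun d ξ η h => by simpa using norm_snd_le h
  refine ⟨C + D, by positivity, fun d => ⟨(h1 d).trans (ENNReal.ofReal_le_ofReal ?_),
    (h2 d).trans (ENNReal.ofReal_le_ofReal ?_)⟩⟩
  · have := d.N₂_pos; have := d.N₁_pos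
    exact mul_le_mul_of_nonneg_right (by linarith) (by positivity)
  · have := d.N₂_pos; have := d.N₁_pos
    exact mul_le_mul_of_nonneg_right (by linarith) (by positivity)

end Datum

/-! ### The partition -/

open Datum in
/-- The functions of the partition, as functions of the cosine `t` of the angle of `ξ` and
`ξ₂`. -/
def weight (N₁ N₂ t : ℝ) : Fin 8 → ℝ :=
  if 64 * N₁ ≤ N₂ then ![1, 0, 0, 0, 0, 0, 0, 0]
  else if 64 * N₂ ≤ N₁ ∧ 1 ≤ N₁ then ![0, 0, 0, 0, 1, 0, 0, 0]
  else if 1 ≤ N₁ then ![0, parallelCut t, 0, 1 - parallelCut t, 0, 0, 0, 0]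
  else ![0, 0, 0, 0, 0, timeCut N₁ t, 1 - timeCut N₁ t, 0]

open Datum in
theorem weight_cases (N₁ N₂ : ℝ) :
    (64 * N₁ ≤ N₂ ∧ weight N₁ N₂ = fun _ => ![1, 0, 0, 0, 0, 0, 0, 0]) ∨
    ((64 * N₂ ≤ N₁ ∧ 1 ≤ N₁) ∧ weight N₁ N₂ = fun _ => ![0, 0, 0, 0, 1, 0, 0, 0]) ∨
    (Comparable N₁ N₂ ∧ weight N₁ N₂ =
      fun t => ![0, parallelCut t, 0, 1 - parallelCut t, 0, 0, 0, 0]) ∨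
    (Low N₁ N₂ ∧ weight N₁ N₂ =
      fun t => ![0, 0, 0, 0, 0, timeCut N₁ t, 1 - timeCut N₁ t, 0]) := by
  by_cases h1 : 64 * N₁ ≤ N₂
  · exact Or.inl ⟨h1, funext fun t => if_pos h1⟩
  by_cases h2 : 64 * N₂ ≤ N₁ ∧ 1 ≤ N₁
  · exact Or.inr (Or.inl ⟨h2, funext fun t => by rw [weight, if_neg h1, if_pos h2]⟩)
  rw [not_le] at h1
  by_cases h3 : 1 ≤ N₁
  · refine Or.inr (Or.inr (Or.inl ⟨⟨⟨?_, h1.le⟩, h3⟩,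
      funext fun t => by rw [weight, if_neg h1.not_ge, if_neg h2, if_pos h3]⟩))
    by_contra hlt
    exact h2 ⟨by linarith, h3⟩
  · exact Or.inr (Or.inr (Or.inr ⟨⟨h1.le, (not_le.1 h3).le⟩,
      funext fun t => by rw [weight, if_neg h1.not_ge, if_neg h2, if_neg h3]⟩))

theorem parallelCut_mem (t : ℝ) : Datum.parallelCut t ∈ Set.Icc 0 1 :=
  ⟨Real.smoothTransition.nonneg _, Real.smoothTransition.le_one _⟩

theorem timeCut_contDiffAt {N t : ℝ} (hN : 0 < N) (ht : -1 ≤ t) :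
    ContDiffAt ℝ ∞ (Datum.timeCut N) t := by
  have hS : ContDiff ℝ ∞ Real.smoothTransition := Real.smoothTransition.contDiff
  have hpos : 1 + t + N ^ 2 ≠ 0 := by
    have : 0 < N ^ 2 := by positivity
    linarith
  have h1 : ContDiffAt ℝ ∞ (fun t : ℝ => (1 + t + N ^ 2)⁻¹) t :=
    ContDiffAt.inv (by fun_prop) hpos
  have h2 : ContDiffAt ℝ ∞ (fun t : ℝ => 2 - 2 * 10 ^ 7 * ((1 + t) * (1 + t + N ^ 2)⁻¹)) t := by
    fun_prop
  unfold Datum.timeCut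
  exact contDiffAt_const.sub ((contDiffAt_const.sub (hS.contDiffAt.comp t h2)).mul
    (contDiffAt_const.sub (hS.contDiffAt.comp t (by fun_prop))))

theorem weight_contDiffAt {N₁ N₂ t : ℝ} (h1 : 0 < N₁) (ht : -1 ≤ t) (j : Fin 8) :
    ContDiffAt ℝ ∞ (fun t => weight N₁ N₂ t j) t := by
  have hp : ContDiffAt ℝ ∞ Datum.parallelCut t := Datum.parallelCut_contDiff.contDiffAt
  have hq := timeCut_contDiffAt h1 ht
  rcases weight_cases N₁ N₂ with ⟨-, h⟩ | ⟨-, h⟩ | ⟨-, h⟩ | ⟨-, h⟩ <;> rw [h] <;> fin_cases j <;>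
    first
      | exact contDiffAt_const
      | exact hp
      | exact contDiffAt_const.sub hp
      | exact hq
      | exact contDiffAt_const.sub hq

theorem contDiffAt_unit {ζ : E} (h : ζ ≠ 0) : ContDiffAt ℝ ∞ unit ζ := by
  unfold unit
  exact ((contDiffAt_id.norm ℝ h).inv (norm_ne_zero_iff.2 h)).smul contDiffAt_id

theorem Φ_ne_zero_of_phaseFactor {ξ η : E} (hξ : ξ ≠ 0) (hη : η ≠ 0)
    (h : 0 < |phaseFactor ξ η|) : Φ (ξ - η) η ≠ 0 := by
  intro h0
  have h1 := Φ_mul_sum hξ hη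
  rw [h0, zero_mul] at h1
  have h2 := norm_ne_zero_iff.2 hξ
  have h3 := norm_ne_zero_iff.2 hη
  have h4 := abs_pos.1 h
  exact (by positivity : 2 * (‖ξ‖ * ‖η‖) * phaseFactor ξ η ≠ 0) h1.symm

theorem Φ_pos_of_lt {ξ₁ ξ₂ : E} (h : ‖ξ₁‖ < ‖ξ₂‖) : 0 < Φ ξ₁ ξ₂ := by
  have h1 : jap ξ₁ ≤ jap ξ₂ := Real.sqrt_le_sqrt (by nlinarith [norm_nonneg ξ₁])
  have h2 : H ξ₁ < H ξ₂ := mul_lt_mul h h1 (jap_pos _) (norm_nonneg _)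
  have := H_nonneg (ξ₁ + ξ₂)
  rw [Φ]
  linarith

/-- The weights sum to 1 for every angle, not only on the support of the cutoff. Non-resonance
follows from the lower bounds that also control the multipliers. -/
theorem isNonresonantPartition {φ : E → ℝ} (hφ : IsBump φ) {N₁ N₂ : ℝ} (h1 : 0 < N₁)
    (h2 : 0 < N₂) :
    IsNonresonantPartition φ N₁ N₂ fun j ξ₁ ξ₂ => weight N₁ N₂ (mu (ξ₁ + ξ₂) ξ₂) j where
  nonneg j ξ₁ ξ₂ := by
    have hp := parallelCut_mem (mu (ξ₁ + ξ₂) ξ₂)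
    have hq := Datum.timeCut_mem N₁ (mu (ξ₁ + ξ₂) ξ₂)
    rcases weight_cases N₁ N₂ with ⟨-, h⟩ | ⟨-, h⟩ | ⟨-, h⟩ | ⟨-, h⟩ <;> rw [h] <;>
      fin_cases j <;>
      first
        | exact le_rfl
        | exact zero_le_one
        | exact hp.1
        | exact sub_nonneg.2 hp.2
        | exact hq.1
        | exact sub_nonneg.2 hq.2
  smooth j := by
    rintro ⟨ξ₁, ξ₂⟩ ⟨-, hη, hξ⟩
    have hmu : ContDiffAt ℝ ∞ (fun p : E × E => mu (p.1 + p.2) p.2) (ξ₁, ξ₂) := by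
      have k1 : ContDiffAt ℝ ∞ (fun p : E × E => unit (p.1 + p.2)) (ξ₁, ξ₂) :=
        ContDiffAt.comp (ξ₁, ξ₂) (g := unit) (contDiffAt_unit hξ) (by fun_prop)
      have k2 : ContDiffAt ℝ ∞ (fun p : E × E => unit p.2) (ξ₁, ξ₂) :=
        ContDiffAt.comp (ξ₁, ξ₂) (g := unit) (contDiffAt_unit hη) (by fun_prop)
      exact k1.inner ℝ k2
    exact (ContDiffAt.comp (ξ₁, ξ₂) (g := fun t => weight N₁ N₂ t j)
      (weight_contDiffAt h1 (neg_one_le_mu hξ hη) j) hmu).contDiffWithinAt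
  sum_eq_one p _ := by
    rcases weight_cases N₁ N₂ with ⟨-, h⟩ | ⟨-, h⟩ | ⟨-, h⟩ | ⟨-, h⟩ <;> rw [h] <;>
      simp [Fin.sum_univ_succ]
  time j hj ξ₁ η hξ hne := by
    obtain ⟨ξ, rfl⟩ : ∃ ξ, ξ₁ = ξ - η := ⟨ξ₁ + η, by simp⟩
    rw [sub_add_cancel] at hξ hne
    have hr := inRange_of_cutoff_ne_zero hφ h1 h2 (right_ne_zero_of_mul hne)
    have hw := left_ne_zero_of_mul hne
    have hη : η ≠ 0 := norm_pos_iff.1 (by linarith [hr.low₂])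
    have hpos := neg_one_le_mu hξ hη
    rcases weight_cases N₁ N₂ with ⟨h, hw'⟩ | ⟨-, hw'⟩ | ⟨h, hw'⟩ | ⟨h, hw'⟩
    · exact (Φ_pos_of_lt (by linarith [hr.up₁, hr.low₂])).ne'
    · rw [hw'] at hw
      fin_cases hj <;> exact absurd rfl hw
    · rw [hw'] at hw
      refine Φ_ne_zero_of_phaseFactor hξ hη ?_
      have key : mu ξ η ∈ {t | Datum.parallelCut t ≠ 0} := by
        fin_cases hj <;> first | exact absurd rfl hw | exact hw
      exact lt_of_lt_of_le (by positivity) (Datum.le_abs_phaseFactor_of_parallel h.2 h2 hξ hr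
        (Datum.parallelCut_ne_zero key))
    · rw [hw'] at hw
      refine Φ_ne_zero_of_phaseFactor hξ hη ?_
      have key : mu ξ η ∈ {t | Datum.timeCut N₁ t ≠ 0} := by
        fin_cases hj <;> first | exact absurd rfl hw | exact hw
      refine lt_of_lt_of_le ?_ (le_abs_phaseFactor h1 h.2 h.1 hξ hη hr
        (Datum.timeCut_ne_zero h1 key))
      have : 0 < N₁ ^ 2 := by positivity
      linarith
  space j hj ξ₁ η hξ hne := by
    obtain ⟨ξ, rfl⟩ : ∃ ξ, ξ₁ = ξ - η := ⟨ξ₁ + η, by simp⟩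
    rw [sub_add_cancel] at hξ hne
    have hr := inRange_of_cutoff_ne_zero hφ h1 h2 (right_ne_zero_of_mul hne)
    have hw := left_ne_zero_of_mul hne
    have hη : η ≠ 0 := norm_pos_iff.1 (by linarith [hr.low₂])
    have hξ₁ : ξ - η ≠ 0 := norm_pos_iff.1 (by linarith [hr.low₁])
    have hpos := neg_one_le_mu hξ hη
    rw [gradXi₂_Φ hξ₁ hη]
    rcases weight_cases N₁ N₂ with ⟨-, hw'⟩ | ⟨h, hw'⟩ | ⟨-, hw'⟩ | ⟨h, hw'⟩
    · rw [hw'] at hw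
      fin_cases hj <;> exact absurd rfl hw
    -- If the gradient vanished, H'(|ξ₂|) = H'(|ξ₁|), against strict monotonicity of H' since |ξ₂| <
    -- |ξ₁|.
    · intro h0
      have hlt : ‖η‖ < ‖ξ - η‖ := by linarith [hr.up₂, hr.low₁, h.1]
      have k1 := hh_sub_ge hξ₁ hη hlt.le
      have k2 : hh η * ‖η‖ = hh (ξ - η) * ‖ξ - η‖ := by
        rw [← norm_hh_smul, ← norm_hh_smul, eq_neg_of_add_eq_zero_left h0, norm_neg]
      rw [k2, sub_self, zero_mul] at k1
      nlinarith [norm_nonneg η]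
    · rw [hw'] at hw
      fin_cases hj <;> exact absurd rfl hw
    · rw [hw'] at hw
      have key : mu ξ η ∈ {t | 1 - Datum.timeCut N₁ t ≠ 0} := by
        fin_cases hj <;> first | exact absurd rfl hw | exact hw
      have hq := Datum.one_sub_timeCut_ne_zero h1 hpos key
      have hs : 0 < 1 + mu ξ η + N₁ ^ 2 := by
        have : 0 < N₁ ^ 2 := by positivity
        linarith
      have k := le_norm_add_of_triangle h1 h2 h.1 (Real.sqrt_pos.2 hs) hξ hr hq.1
        (by rw [Real.sq_sqrt hs.le]; exact hq.2)
      have h3 := norm_pos_iff.2 hξ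
      have h4 := Real.sqrt_pos.2 hs
      exact norm_pos_iff.1 (lt_of_lt_of_le (by positivity) k)
  angular ξ₁ η hξ hne := by
    obtain ⟨ξ, rfl⟩ : ∃ ξ, ξ₁ = ξ - η := ⟨ξ₁ + η, by simp⟩
    rw [sub_add_cancel] at hξ hne
    have hr := inRange_of_cutoff_ne_zero hφ h1 h2 (right_ne_zero_of_mul hne)
    have hw := left_ne_zero_of_mul hne
    have hη : η ≠ 0 := norm_pos_iff.1 (by linarith [hr.low₂])
    have hξ₁ : ξ - η ≠ 0 := norm_pos_iff.1 (by linarith [hr.low₁])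
    rw [gradXi₂_Φ hξ₁ hη, sub_add_cancel, inner_add_right, inner_smul_right, inner_perp_self hη,
      mul_zero, zero_add, inner_perp_gradH hξ hη]
    rcases weight_cases N₁ N₂ with ⟨-, hw'⟩ | ⟨-, hw'⟩ | ⟨-, hw'⟩ | ⟨-, hw'⟩ <;> rw [hw'] at hw
    · exact absurd rfl hw
    · exact absurd rfl hw
    · have k := Datum.one_sub_parallelCut_ne_zero (t := mu ξ η) hw
      have k' : 0 < 1 - mu ξ η ^ 2 := lt_of_lt_of_le (by norm_num) k
      have := hh_pos hξ₁
      have := norm_pos_iff.2 hξ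
      positivity
    · exact absurd rfl hw

/-! ### Vanishing multipliers -/

theorem bT_zero : bT (0 : E → E → ℝ) = 0 := by
  ext1 ξ₁; ext1 ξ₂
  simp [bT]

theorem bX_zero : bX (0 : E → E → ℝ) = 0 := by
  ext1 ξ₁; ext1 ξ₂
  simp [bX]

theorem divXi₂_zero : divXi₂ (0 : E → E → T) = 0 := by
  ext ξ₁ ξ₂ i
  simp [divXi₂]

theorem bXtilde_zero : bXtilde (0 : E → E → ℝ) = 0 := by
  rw [bXtilde, bX_zero, divXi₂_zero]

theorem mAng_zero (ξ₁ ξ₂ : E) : mAng (0 : E → E → ℝ) ξ₁ ξ₂ = 0 := by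
  simp [mAng]

theorem bAng_zero : bAng (0 : E → E → ℝ) = 0 := by
  simp only [bAng, mAng_zero, tensor_zero_left]
  exact divXi₂_zero

theorem bAng₁_zero : bAng₁ (0 : E → E → ℝ) = 0 := by
  ext1 ξ₁; ext1 ξ₂
  simp [bAng₁, mAng_zero, tensor_zero_left]

theorem bAng₂_zero : bAng₂ (0 : E → E → ℝ) = 0 := by
  ext1 ξ₁; ext1 ξ₂
  simp [bAng₂, mAng_zero, tensor_zero_left]

theorem bAngTilde_zero : bAngTilde (0 : E → E → ℝ) = 0 := by
  ext1 ξ₁; ext1 ξ₂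
  simp [bAngTilde, mAng_zero, tensor_zero_left]

/-! ### Comparison of the low-frequency bounds with the asserted ones. -/

theorem sqrt_inv_pow_three {N : ℝ} (hN : 0 < N) : √(N⁻¹ ^ 3) = 1 / (N * √N) := by
  have h : N⁻¹ ^ 3 = (1 / (N * √N)) ^ 2 := by
    rw [div_pow, mul_pow, Real.sq_sqrt hN.le]
    field_simp
  rw [h, Real.sqrt_sq (by positivity)]

/-- The cap estimate yields N₁^{-3/2}, and N₂N₁^{-3/2} for b^X. The assertions are weaker, because
N₂ ≤ 64N₁ allows a power of N₁ to be traded for the same power of N₂. -/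
theorem low_size_bounds {N₁ N₂ C D : ℝ} (h1 : 0 < N₁) (h2 : 0 < N₂) (h : N₂ ≤ 64 * N₁)
    (hC : 0 ≤ C) (hD : 64 * C ≤ D) :
    C * (1 * √(N₁⁻¹ ^ 3)) ≤ D / (N₁ * √N₂) ∧ C * (N₂ * √(N₁⁻¹ ^ 3)) ≤ D * (1 / √N₁) ∧
      C * (1 * √(N₁⁻¹ ^ 3)) ≤ D * (1 / N₂ * (1 / √N₁)) := by
  have s1 := Real.sqrt_pos.2 h1
  have s2 := Real.sqrt_pos.2 h2
  have hs : √N₂ ≤ 8 * √N₁ := by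
    rw [Real.sqrt_le_left (by positivity), mul_pow, Real.sq_sqrt h1.le]
    linarith
  rw [sqrt_inv_pow_three h1]
  refine ⟨?_, ?_, ?_⟩
  · rw [one_mul, mul_one_div, div_le_div_iff₀ (by positivity) (by positivity)]
    calc C * (N₁ * √N₂) ≤ C * (N₁ * (8 * √N₁)) := by gcongr
      _ = (8 * C) * (N₁ * √N₁) := by ring
      _ ≤ D * (N₁ * √N₁) := mul_le_mul_of_nonneg_right (by linarith) (by positivity)
  · rw [mul_one_div, mul_one_div, ← mul_div_assoc, div_le_div_iff₀ (by positivity) s1]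
    calc C * N₂ * √N₁ ≤ C * (64 * N₁) * √N₁ := by gcongr
      _ = (64 * C) * (N₁ * √N₁) := by ring
      _ ≤ D * (N₁ * √N₁) := mul_le_mul_of_nonneg_right hD (by positivity)
  · rw [one_mul, mul_one_div, div_mul_div_comm, one_mul, mul_one_div,
      div_le_div_iff₀ (by positivity) (by positivity)]
    calc C * (N₂ * √N₁) ≤ C * (64 * N₁ * √N₁) := by gcongr
      _ = (64 * C) * (N₁ * √N₁) := by ring
      _ ≤ D * (N₁ * √N₁) := mul_le_mul_of_nonneg_right hD (by positivity)

end CubicQuintic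

end

/-! ### Assembly of the regions. -/

theorem proposition8p1 (φ : E → ℝ) (hφ : IsBump φ) :
    ∃ ρ : ℤ → ℤ → Fin 8 → E → E → ℝ,
      (∀ n₁ n₂ : ℤ, IsNonresonantPartition φ ((2 : ℝ) ^ n₁) ((2 : ℝ) ^ n₂) (ρ n₁ n₂)) ∧
      ∀ β : ℝ, ∃ C : ℝ, 0 < C ∧
        ∀ (n₁ n₂ : ℤ) (N₁ N₂ : ℝ), N₁ = (2 : ℝ) ^ n₁ → N₂ = (2 : ℝ) ^ n₂ →
        ∀ A : E → E → ℝ, (A = A₁ β ∨ A = A₂) →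
        ∀ κ : Fin 8 → E → E → ℝ,
          (κ = fun j ξ₁ ξ₂ => ρ n₁ n₂ j ξ₁ ξ₂ * cutoff φ N₁ N₂ ξ₁ ξ₂ * A ξ₁ ξ₂) →
          -- time non-resonant regions 1, 2, 3, 6
          (symbNorm (bT (κ 0)) ≤ ENNReal.ofReal (C / N₂) ∧
            (bT (κ 0) ≠ 0 → N₁ ≤ C * N₂)) ∧
          (∀ j ∈ ({1, 2} : Finset (Fin 8)),
            symbNorm (bT (κ j)) ≤ ENNReal.ofReal C ∧
            (bT (κ j) ≠ 0 → N₁ ≤ C * N₂ ∧ N₂ ≤ C * N₁)) ∧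
          (symbNorm (bT (κ 5)) ≤ ENNReal.ofReal (C / (N₁ * √N₂)) ∧
            (bT (κ 5) ≠ 0 → N₂ ≤ C * N₁ ∧ N₁ ≤ C)) ∧
          -- space non-resonant regions 5, 7, 8
          (symbNorm (bX (κ 4)) ≤ ENNReal.ofReal (C * (N₂ / N₁)) ∧
            symbNorm (bXtilde (κ 4)) ≤ ENNReal.ofReal (C * (1 / N₂ * (N₂ / N₁))) ∧
            (bX (κ 4) ≠ 0 ∨ bXtilde (κ 4) ≠ 0 → 1 ≤ C * N₁ ∧ 64 * N₂ ≤ N₁)) ∧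
          (∀ j ∈ ({6, 7} : Finset (Fin 8)),
            symbNorm (bX (κ j)) ≤ ENNReal.ofReal (C * (1 / √N₁)) ∧
            symbNorm (bXtilde (κ j)) ≤ ENNReal.ofReal (C * (1 / N₂ * (1 / √N₁))) ∧
            (bX (κ j) ≠ 0 ∨ bXtilde (κ j) ≠ 0 → N₂ ≤ C * N₁ ∧ N₁ ≤ C)) ∧
          -- angular non-resonant region 4
          (symbNorm (bAng (κ 3)) + symbNorm (bAng₁ (κ 3)) + symbNorm (bAngTilde (κ 3))
              ≤ ENNReal.ofReal C ∧
            symbNorm (bAng (κ 3)) + symbNorm (bAng₂ (κ 3)) + symbNorm (bAngTilde (κ 3))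
              ≤ ENNReal.ofReal C ∧
            (bAng (κ 3) ≠ 0 ∨ bAng₁ (κ 3) ≠ 0 ∨ bAng₂ (κ 3) ≠ 0 ∨ bAngTilde (κ 3) ≠ 0 →
              1 ≤ C * N₁ ∧ N₁ ≤ C * N₂ ∧ N₂ ≤ C * N₁)) := by
  refine ⟨fun n₁ n₂ j ξ₁ ξ₂ => weight ((2 : ℝ) ^ n₁) ((2 : ℝ) ^ n₂) (mu (ξ₁ + ξ₂) ξ₂) j,
    fun n₁ n₂ => isNonresonantPartition hφ (by positivity) (by positivity), fun β => ?_⟩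
  obtain ⟨C₁, hC₁, b₁⟩ := Datum.symbNorm_bT_of_small₁ (β := β)
    (P := fun N₁ N₂ => 64 * N₁ ≤ N₂) hφ fun _ _ h => h
  obtain ⟨C₂, hC₂, b₂⟩ := Datum.symbNorm_bX_of_small₂ (β := β)
    (P := fun N₁ N₂ => 64 * N₂ ≤ N₁ ∧ 1 ≤ N₁) hφ fun _ _ h => h
  obtain ⟨C₃, hC₃, b₃⟩ := Datum.symbNorm_bT_of_comparable (β := β) hφ
  obtain ⟨C₄, hC₄, b₄⟩ := Datum.symbNorm_bAng_of_comparable (β := β) hφ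
  obtain ⟨C₅, hC₅, b₅⟩ := Datum.symbNorm_bT_of_low (β := β) hφ
  obtain ⟨C₆, hC₆, b₆⟩ := Datum.symbNorm_bX_of_low (β := β) hφ
  -- The factor 64 covers both the size ratios in the support conditions and the loss in
  -- `low_size_bounds`; it also dominates the three summands 3C₄ of the angular estimate.
  refine ⟨64 * (1 + C₁ + C₂ + C₃ + C₄ + C₅ + C₆), by positivity, ?_⟩
  set C := 64 * (1 + C₁ + C₂ + C₃ + C₄ + C₅ + C₆) with hC
  have hC64 : 64 ≤ C := by linarith
  intro n₁ n₂ N₁ N₂ e₁ e₂ A hA κ hκ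
  have h1 : 0 < N₁ := by rw [e₁]; positivity
  have h2 : 0 < N₂ := by rw [e₂]; positivity
  beta_reduce at hκ
  rw [← e₁, ← e₂] at hκ
  -- For given N₁, N₂ at most two weights are nonzero; the multipliers of all others vanish
  -- identically, so their bounds and support conditions are trivial.
  have hzero : ∀ j, (∀ t, weight N₁ N₂ t j = 0) → κ j = 0 := fun j hj => by
    ext ξ₁ ξ₂
    simp [hκ, hj]
  simp only [Finset.mem_insert, Finset.mem_singleton, forall_eq_or_imp, forall_eq]
  have zT : symbNorm (0 : E → E → T) = 0 := symbNorm_zero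
  have zE : symbNorm (0 : E → E → E) = 0 := symbNorm_zero
  rcases weight_cases N₁ N₂ with ⟨h, hw⟩ | ⟨h, hw⟩ | ⟨h, hw⟩ | ⟨h, hw⟩
  · rw [hzero 1 fun t => by rw [hw]; rfl, hzero 2 fun t => by rw [hw]; rfl,
      hzero 3 fun t => by rw [hw]; rfl, hzero 4 fun t => by rw [hw]; rfl,
      hzero 5 fun t => by rw [hw]; rfl, hzero 6 fun t => by rw [hw]; rfl,
      hzero 7 fun t => by rw [hw]; rfl]
    simp only [bT_zero, bX_zero, bXtilde_zero, bAng_zero, bAng₁_zero, bAng₂_zero, bAngTilde_zero,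
      zT, zE, ne_eq, not_true, or_self, false_imp_iff, and_true, zero_le, add_zero]
    have hd := b₁ ⟨N₁, N₂, A, h1, h2, hA, h⟩
    have e : κ 0 = Datum.κ φ (fun _ _ => 1)
        (⟨N₁, N₂, A, h1, h2, hA, h⟩ : Datum β fun N₁ N₂ => 64 * N₁ ≤ N₂) := by
      rw [hκ, hw]; rfl
    rw [e]
    refine ⟨hd.trans (ENNReal.ofReal_le_ofReal ?_), fun _ => by nlinarith⟩
    rw [mul_one_div]
    exact div_le_div_of_nonneg_right (by linarith) h2.le
  · rw [hzero 0 fun t => by rw [hw]; rfl, hzero 1 fun t => by rw [hw]; rfl,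
      hzero 2 fun t => by rw [hw]; rfl, hzero 3 fun t => by rw [hw]; rfl,
      hzero 5 fun t => by rw [hw]; rfl, hzero 6 fun t => by rw [hw]; rfl,
      hzero 7 fun t => by rw [hw]; rfl]
    simp only [bT_zero, bX_zero, bXtilde_zero, bAng_zero, bAng₁_zero, bAng₂_zero, bAngTilde_zero,
      zT, zE, ne_eq, not_true, or_self, false_imp_iff, and_true, true_and, zero_le, add_zero]
    have hd := b₂ ⟨N₁, N₂, A, h1, h2, hA, h⟩
    have e : κ 4 = Datum.κ φ (fun _ _ => 1)
        (⟨N₁, N₂, A, h1, h2, hA, h⟩ : Datum β fun N₁ N₂ => 64 * N₂ ≤ N₁ ∧ 1 ≤ N₁) := by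
      rw [hκ, hw]; rfl
    rw [e]
    refine ⟨hd.1.trans (ENNReal.ofReal_le_ofReal ?_), hd.2.trans (ENNReal.ofReal_le_ofReal ?_),
      fun _ => ⟨by nlinarith [h.2], h.1⟩⟩ <;>
    exact mul_le_mul_of_nonneg_right (by linarith) (by positivity)
  · rw [hzero 0 fun t => by rw [hw]; rfl, hzero 2 fun t => by rw [hw]; rfl,
      hzero 4 fun t => by rw [hw]; rfl, hzero 5 fun t => by rw [hw]; rfl,
      hzero 6 fun t => by rw [hw]; rfl, hzero 7 fun t => by rw [hw]; rfl]
    simp only [bT_zero, bX_zero, bXtilde_zero,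
      zT, zE, ne_eq, not_true, or_self, false_imp_iff, and_true, true_and, zero_le]
    have hd := b₃ ⟨N₁, N₂, A, h1, h2, hA, h⟩
    obtain ⟨k₁, k₂, k₃, k₄⟩ := b₄ ⟨N₁, N₂, A, h1, h2, hA, h⟩
    have e : κ 1 = Datum.κ φ (fun _ => Datum.parallelCut)
        (⟨N₁, N₂, A, h1, h2, hA, h⟩ : Datum β Datum.Comparable) := by
      rw [hκ, hw]; rfl
    have e' : κ 3 = Datum.κ φ (fun _ t => 1 - Datum.parallelCut t)
        (⟨N₁, N₂, A, h1, h2, hA, h⟩ : Datum β Datum.Comparable) := by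
      rw [hκ, hw]; rfl
    have hN : N₁ ≤ C * N₂ ∧ N₂ ≤ C * N₁ :=
      ⟨h.1.1.trans (mul_le_mul_of_nonneg_right hC64 h2.le),
        h.1.2.trans (mul_le_mul_of_nonneg_right hC64 h1.le)⟩
    have hsum : ENNReal.ofReal (C₄ * 1) + ENNReal.ofReal (C₄ * 1) + ENNReal.ofReal (C₄ * 1) ≤
        ENNReal.ofReal C := by
      rw [← ENNReal.ofReal_add (by positivity) (by positivity),
        ← ENNReal.ofReal_add (by positivity) (by positivity)]
      exact ENNReal.ofReal_le_ofReal (by linarith)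
    rw [e, e']
    exact ⟨⟨hd.trans (ENNReal.ofReal_le_ofReal (by linarith)), fun _ => hN⟩,
      (add_le_add (add_le_add k₁ k₂) k₄).trans hsum,
      (add_le_add (add_le_add k₁ k₃) k₄).trans hsum, fun _ => ⟨by nlinarith [h.2], hN⟩⟩
  · rw [hzero 0 fun t => by rw [hw]; rfl, hzero 1 fun t => by rw [hw]; rfl,
      hzero 2 fun t => by rw [hw]; rfl, hzero 3 fun t => by rw [hw]; rfl,
      hzero 4 fun t => by rw [hw]; rfl, hzero 7 fun t => by rw [hw]; rfl]
    simp only [bT_zero, bX_zero, bXtilde_zero, bAng_zero, bAng₁_zero, bAng₂_zero, bAngTilde_zero,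
      zT, zE, ne_eq, not_true, or_self, false_imp_iff, and_true, true_and, zero_le, add_zero]
    have hd := b₅ ⟨N₁, N₂, A, h1, h2, hA, h⟩
    have hd' := b₆ ⟨N₁, N₂, A, h1, h2, hA, h⟩
    have e : κ 5 = Datum.κ φ Datum.timeCut
        (⟨N₁, N₂, A, h1, h2, hA, h⟩ : Datum β Datum.Low) := by
      rw [hκ, hw]; rfl
    have e' : κ 6 = Datum.κ φ (fun N t => 1 - Datum.timeCut N t)
        (⟨N₁, N₂, A, h1, h2, hA, h⟩ : Datum β Datum.Low) := by
      rw [hκ, hw]; rfl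
    have hN : N₂ ≤ C * N₁ ∧ N₁ ≤ C :=
      ⟨h.1.trans (mul_le_mul_of_nonneg_right hC64 h1.le), by linarith [h.2]⟩
    have m₅ := low_size_bounds (D := C) h1 h2 h.1 hC₅.le (by linarith)
    have m₆ := low_size_bounds (D := C) h1 h2 h.1 hC₆.le (by linarith)
    rw [e, e']
    exact ⟨⟨hd.trans (ENNReal.ofReal_le_ofReal m₅.1), fun _ => hN⟩,
      hd'.1.trans (ENNReal.ofReal_le_ofReal m₆.2.1),
      hd'.2.trans (ENNReal.ofReal_le_ofReal m₆.2.2), fun _ => hN⟩
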